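/- Let $\gamma\in(\tfrac23,2)$ and $q^*=\tfrac12(3\gamma-2)$. Consider the evolution equations for $(\Sigma_+,\Sigma_-,N_+,N_-,\Omega)$ (Bianchi type VI$_0$ with an orthogonal perfect fluid, in expansion-normalised variables) \begin{align*} \Sigma_+'&=-(2-q)\Sigma_+-2N_-^2, & \Sigma_-'&=-(2-q)\Sigma_--2\sqrt3\,N_+N_-,\\ N_+'&=(q+2\Sigma_+)N_++2\sqrt3\,\Sigma_-N_-, & N_-'&=(q+2\Sigma_+)N_-+2\sqrt3\,\Sigma_-N_+,\\ \Omega'&=2(q-q^*)\Omega, & q&=q^*\Omega+2(\Sigma_+^2+\Sigma_-^2), \end{align*} on the phase space $B_1^+(\mathrm{VI}_0)$ of all points with $\Omega+\Sigma_+^2+\Sigma_-^2+N_-^2=1$, $\Omega\ge 0$ and $N_->|N_+|$. Since $\Omega$ is determined by the other variables through the constraint, $B_1^+(\mathrm{VI}_0)$ is regarded as a subset of $\mathbb R^4$ with coordinates $(\Sigma_+,\Sigma_-,N_+,N_-)$. Let $F$, $P_2^+(\mathrm{II})$, $P_3^-(\mathrm{II})$ be the equilibria on the boundary of the phase space whose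 coordinates $(\Sigma_+,\Sigma_-,N_+,N_-,\Omega)$ are $$F=(0,0,0,0,1),\qquad P_2^+(\mathrm{II})=\Big(-\tfrac{q^*}8,-\tfrac{\sqrt3\,q^*}8,\nu,\nu,1-\tfrac{q^*}8\Big),\qquad P_3^-(\mathrm{II})=\Big(-\tfrac{q^*}8,\tfrac{\sqrt3\,q^*}8,-\nu,\nu,1-\tfrac{q^*}8\Big),$$ with $\nu=\tfrac14\sqrt{q^*(2-q^*)}$. The past unstable set of an equilibrium $p$ is the set of points $x\in B_1^+(\mathrm{VI}_0)$ such that the solution through $x$ converges to $p$ as $\tau\to-\infty$; denote the past unstable sets of $P_2^+(\mathrm{II})$, $P_3^-(\mathrm{II})$ and $F$ by $\mathscr P^+_{\mathrm{VI}_0}$, $\mathscr P^-_{\mathrm{VI}_0}$ and $\mathscr F_{\mathrm{VI}_0}$. Then $\mathscr P^+_{\mathrm{VI}_0}$, $\mathscr P^-_{\mathrm{VI}_0}$ and $\mathscr F_{\mathrm{VI}_0}$ are nonempty embedded smooth submanifolds of $\mathbb R^4$ of dimensions $1$, $1$ and $2$ respectively. -/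

import Mathlib

open Filter Topology
open scoped ContDiff

noncomputable section

namespace BianchiVI0

/-- Euclidean space `ℝ⁵`, with coordinates `(Σ₊, Σ₋, N₊, N₋, Ω)` numbered `0, 1, 2, 3, 4`. -/
abbrev State : Type := EuclideanSpace ℝ (Fin 5)

/-- `q* = (3γ - 2) / 2`. -/
def qStar (γ : ℝ) : ℝ := (3 * γ - 2) / 2

/-- The deceleration parameter `q = q* Ω + 2 (Σ₊² + Σ₋²)`. -/
def decel (γ : ℝ) (x : State) : ℝ := qStar γ * x 4 + 2 * (x 0 ^ 2 + x 1 ^ 2)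

/-- The right-hand side of the evolution equations of the expansion-normalised variables:
* `Σ₊' = -(2 - q) Σ₊ - 2 N₋²`
* `Σ₋' = -(2 - q) Σ₋ - 2√3 N₊ N₋`
* `N₊' = (q + 2 Σ₊) N₊ + 2√3 Σ₋ N₋`
* `N₋' = (q + 2 Σ₊) N₋ + 2√3 Σ₋ N₊`
* `Ω' = 2 (q - q*) Ω` -/
def vectorField (γ : ℝ) (x : State) : State :=
  !₂[-(2 - decel γ x) * x 0 - 2 * x 3 ^ 2,
     -(2 - decel γ x) * x 1 - 2 * √3 * x 2 * x 3,
     (decel γ x + 2 * x 0) * x 2 + 2 * √3 * x 1 * x 3,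
     (decel γ x + 2 * x 0) * x 3 + 2 * √3 * x 1 * x 2,
     2 * (decel γ x - qStar γ) * x 4]

/-- A global solution `τ ↦ (Σ₊, Σ₋, N₊, N₋, Ω)(τ)` of the evolution equations. -/
def IsSolution (γ : ℝ) (c : ℝ → State) : Prop :=
  ∀ τ : ℝ, HasDerivAt c (vectorField γ (c τ)) τ

/-- The phase space `B₁⁺(VI₀)`: the constraint `Ω + Σ₊² + Σ₋² + N₋² = 1` holds, `Ω ≥ 0`, and
`N₋ > |N₊|` (that is, `N₁ = 0`, `N₂ > 0` and `N₃ < 0`). -/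
def phaseSpace : Set State :=
  {x | x 4 + x 0 ^ 2 + x 1 ^ 2 + x 3 ^ 2 = 1 ∧ 0 ≤ x 4 ∧ |x 2| < x 3}

/-- The past unstable set of `p` in `B₁⁺(VI₀)`: the points of the phase space whose solution
converges to `p` as `τ → -∞`. -/
def unstableSet (γ : ℝ) (p : State) : Set State :=
  {x | x ∈ phaseSpace ∧
    ∃ c : ℝ → State, IsSolution γ c ∧ c 0 = x ∧ Tendsto c atBot (𝓝 p)}

/-- The equilibrium `F`. -/
def pointF : State := !₂[0, 0, 0, 0, 1]

/-- The equilibrium `P₂⁺(II)`, with `N₋ = N₊ > 0`. -/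
def pointP2 (γ : ℝ) : State :=
  !₂[-(qStar γ / 8), -(√3 * qStar γ / 8),
     √(qStar γ * (2 - qStar γ)) / 4, √(qStar γ * (2 - qStar γ)) / 4, 1 - qStar γ / 8]

/-- The equilibrium `P₃⁻(II)`, with `N₋ = -N₊ > 0`. -/
def pointP3 (γ : ℝ) : State :=
  !₂[-(qStar γ / 8), √3 * qStar γ / 8,
     -(√(qStar γ * (2 - qStar γ)) / 4), √(qStar γ * (2 - qStar γ)) / 4, 1 - qStar γ / 8]

/-- The coordinates `(Σ₊, Σ₋, N₊, N₋)`; on the phase space `Ω` is a function of them by the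
constraint, and this is how the phase space is a subset of `ℝ⁴`. -/
def toR4 (x : State) : EuclideanSpace ℝ (Fin 4) := !₂[x 0, x 1, x 2, x 3]

/-- `𝓟⁺_{VI₀}`, as a subset of `ℝ⁴`. -/
def unstableP2 (γ : ℝ) : Set (EuclideanSpace ℝ (Fin 4)) := toR4 '' unstableSet γ (pointP2 γ)

/-- `𝓟⁻_{VI₀}`, as a subset of `ℝ⁴`. -/
def unstableP3 (γ : ℝ) : Set (EuclideanSpace ℝ (Fin 4)) := toR4 '' unstableSet γ (pointP3 γ)

/-- `𝓕_{VI₀}`, as a subset of `ℝ⁴`. -/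
def unstableF (γ : ℝ) : Set (EuclideanSpace ℝ (Fin 4)) := toR4 '' unstableSet γ pointF

/-- `S ⊆ ℝⁿ` is an embedded smooth submanifold of dimension `k` (without boundary): around each
of its points there is a smooth chart `φ` of `ℝⁿ` in which `S` is the slice where all coordinates
from the `k`-th on (counted from `0`) vanish. -/
def IsEmbeddedSubmanifold {n : ℕ} (k : ℕ) (S : Set (EuclideanSpace ℝ (Fin n))) : Prop :=
  k ≤ n ∧ ∀ x ∈ S,
    ∃ φ : OpenPartialHomeomorph (EuclideanSpace ℝ (Fin n)) (EuclideanSpace ℝ (Fin n)),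
      x ∈ φ.source ∧ ContDiffOn ℝ ∞ φ φ.source ∧ ContDiffOn ℝ ∞ φ.symm φ.target ∧
      ∀ y ∈ φ.source, y ∈ S ↔ ∀ i : Fin n, k ≤ (i : ℕ) → φ y i = 0

end BianchiVI0

end

/-! ### Scalar barriers and linear equations -/

namespace BianchiVI0

/-! Write q for q*, so 0 < q < 2. Eliminating Ω gives a polynomial field on ℝ⁴. Since Ω and N₋ ± N₊
obey homogeneous linear equations along solutions, the open set Ω > 0, N₋ > |N₊| is invariant and
carries a complete analytic flow. The equilibria have Ω > 0, so their unstable sets avoid Ω = 0 and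
lie in this region (`toR4_image_unstableSet`).

Cones replace an unstable manifold theorem. Near an equilibrium p a quadratic form B, positive on
stable and negative on unstable directions, satisfies B(x - y, f x - f y) ≤ 0. Hence two orbits that
stay near p in the past and converge to it differ by a vector with B ≤ 0
(`quadratic_nonpos_of_past`).

At P₂ the only unstable direction is transverse to the type II boundary N₋ = N₊. Two orbits
normalised to the same transverse height differ by a vector of height zero in the cone, so they
coincide. A limit of orbits started ever closer to P₂ shows that an orbit exists. A strictly
increasing function (`lyap`) stops this orbit from returning near itself, so it is an embedded
curve. P₃ is the mirror image of P₂ under (Σ₋, N₊) ↦ (-Σ₋, -N₊).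

At F both N directions are unstable with rate q. Orbits leaving F are solved for as x = s w(s), s =
exp(qτ), where w satisfies an integral equation amenable to the inverse function theorem. This
yields an analytic chart Θ in which a plane is sent to such orbits, and the cone shows that nearby
points off the plane are not on orbits that stay near F in the past. What remains is global: an
orbit of the unstable set might come back close to F. A priori bounds exclude this. Ω is bounded
below on the whole unstable set (`exists_density_lower_bound`), the shear is bounded by a multiple
of N₋ (`exists_shear_bound`), and near F N₋ increases, so points of the unstable set near F were
near F for all past times (`exists_past_bound`). The flow carries the local chart to every other
point. -/

open Set in
/-- A differentiable function which is nonincreasing wherever it exceeds `M` stays below `M`. -/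
theorem le_of_deriv_nonpos_above {φ φ' : ℝ → ℝ} {M t₁ t₀ : ℝ} (hφ : ∀ t, HasDerivAt φ (φ' t) t)
    (h : ∀ t, M < φ t → φ' t ≤ 0) (h₁ : φ t₁ ≤ M) (ht : t₁ ≤ t₀) : φ t₀ ≤ M := by
  by_contra! hlt
  have hc : Continuous φ := continuous_iff_continuousAt.2 fun t => (hφ t).continuousAt
  -- The supremum of this set is the last time with φ ≤ M; after it φ exceeds M and therefore cannot
  -- grow.
  set A : Set ℝ := Icc t₁ t₀ ∩ φ ⁻¹' Iic M
  have hA : IsCompact A := isCompact_Icc.inter_right (isClosed_Iic.preimage hc)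
  have hne : A.Nonempty := ⟨t₁, ⟨le_rfl, ht⟩, h₁⟩
  obtain ⟨⟨h2, h3⟩, h4⟩ := hA.sSup_mem hne
  set s := sSup A
  have h5 : ∀ t ∈ interior (Icc s t₀), deriv φ t ≤ 0 := by
    intro t ht'
    rw [interior_Icc] at ht'
    rw [(hφ t).deriv]
    apply h
    by_contra! h6
    exact absurd (le_csSup hA.bddAbove (show t ∈ A from ⟨⟨h2.trans ht'.1.le, ht'.2.le⟩, h6⟩))
      (not_le.2 ht'.1)
  have := antitoneOn_of_deriv_nonpos (convex_Icc s t₀) hc.continuousOn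
    (fun t _ => (hφ t).differentiableAt.differentiableWithinAt) h5 ⟨le_rfl, h3⟩ ⟨h3, le_rfl⟩ h3
  exact absurd (this.trans h4) (not_le.2 hlt)

/-- The barrier principle started at `-∞`. -/
theorem le_of_deriv_nonpos_above_of_tendsto {φ φ' : ℝ → ℝ} {M L : ℝ}
    (hφ : ∀ t, HasDerivAt φ (φ' t) t) (h : ∀ t, M < φ t → φ' t ≤ 0)
    (hL : Tendsto φ atBot (𝓝 L)) (hLM : L ≤ M) (t : ℝ) : φ t ≤ M := by
  refine le_of_forall_pos_le_add fun ε hε => ?_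
  have h1 : ∀ᶠ s in atBot, φ s < M + ε := hL.eventually_lt_const (by linarith)
  obtain ⟨s, hs, hst⟩ := (h1.and (eventually_le_atBot t)).exists
  exact le_of_deriv_nonpos_above hφ (fun u hu => h u (by linarith)) hs.le hst

/-- Integrating factor. It makes the sign of Ω and of N₋ ± N₊, and the vanishing of Ω or of the
constraint defect, persist for all time. -/
theorem eq_exp_mul_of_linear_ode {y k : ℝ → ℝ} (hk : Continuous k)
    (hy : ∀ t, HasDerivAt y (k t * y t) t) (t₀ t : ℝ) :
    y t = Real.exp (∫ s in t₀..t, k s) * y t₀ := by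
  have hI : ∀ t, HasDerivAt (fun t => ∫ s in t₀..t, k s) (k t) t := fun t =>
    intervalIntegral.integral_hasDerivAt_right (hk.intervalIntegrable _ _)
      (hk.stronglyMeasurableAtFilter _ _) hk.continuousAt
  have h : ∀ t, HasDerivAt (fun t => Real.exp (-∫ s in t₀..t, k s) * y t) 0 t := fun t => by
    convert! ((hI t).neg.exp.mul (hy t)) using 1; ring
  have := is_const_of_deriv_eq_zero (fun t => (h t).differentiableAt) (fun t => (h t).deriv) t t₀
  simp only [intervalIntegral.integral_same, neg_zero, Real.exp_zero, one_mul] at this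
  rw [← this, ← mul_assoc, ← Real.exp_add]; simp

theorem pos_of_linear_ode {y k : ℝ → ℝ} (hk : Continuous k)
    (hy : ∀ t, HasDerivAt y (k t * y t) t) {t₀ : ℝ} (h : 0 < y t₀) (t : ℝ) : 0 < y t := by
  rw [eq_exp_mul_of_linear_ode hk hy t₀ t]; positivity

/-! ### Completeness and dissipative cones -/

section ODE

variable {E : Type*} [NormedAddCommGroup E] [NormedSpace ℝ E]

open Set in
/-- A bounded Lipschitz vector field is complete. -/
theorem exists_global_solution_of_lipschitz [CompleteSpace E] {f : E → E} {K C : NNReal}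
    (hf : LipschitzWith K f) (hC : ∀ x, ‖f x‖ ≤ C) (x : E) :
    ∃ c : ℝ → E, c 0 = x ∧ ∀ t, HasDerivAt c (f (c t)) t := by
  have key : ∀ n : ℕ, ∃ α : ℝ → E, α 0 = x ∧
      ∀ t ∈ Ioo (-((n : ℝ) + 1)) ((n : ℝ) + 1), HasDerivAt α (f (α t)) t := by
    intro n
    have h0 : (0 : ℝ) ∈ Icc (-((n : ℝ) + 1)) ((n : ℝ) + 1) :=
      ⟨by linarith [n.cast_nonneg (α := ℝ)], by linarith [n.cast_nonneg (α := ℝ)]⟩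
    -- A field bounded by C moves a point by at most C(n + 1) in time n + 1, so the ball of that
    -- radius works on every symmetric interval.
    have hP : IsPicardLindelof (fun _ => f) (⟨0, h0⟩ : Icc (-((n : ℝ) + 1)) ((n : ℝ) + 1)) x
        (C * (n + 1)) 0 C K :=
      { lipschitzOnWith := fun _ _ => hf.lipschitzOnWith
        continuousOn := fun _ _ => continuousOn_const
        norm_le := fun _ _ y _ => hC y
        mul_max_le := by simp }
    obtain ⟨α, h1, h2⟩ := hP.exists_eq_forall_mem_Icc_hasDerivWithinAt₀
    exact ⟨α, h1, fun t ht => (h2 t (Ioo_subset_Icc_self ht)).hasDerivAt (Icc_mem_nhds ht.1 ht.2)⟩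
  choose α h1 h2 using key
  have heq : ∀ n m : ℕ, n ≤ m → EqOn (α n) (α m) (Ioo (-((n : ℝ) + 1)) ((n : ℝ) + 1)) := by
    intro n m hnm
    have hnm' : (n : ℝ) ≤ m := by exact_mod_cast hnm
    refine ODE_solution_unique_of_mem_Ioo (v := fun _ => f) (s := fun _ => univ) (t₀ := 0) (K := K)
      (fun _ _ => hf.lipschitzOnWith)
      ⟨by linarith [n.cast_nonneg (α := ℝ)], by linarith [n.cast_nonneg (α := ℝ)]⟩
      (fun t ht => ⟨h2 n t ht, mem_univ _⟩)
      (fun t ht => ⟨h2 m t ⟨by linarith [ht.1], by linarith [ht.2]⟩, mem_univ _⟩) ?_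
    rw [h1, h1]
  have hmem : ∀ t : ℝ, t ∈ Ioo (-((⌊|t|⌋₊ : ℝ) + 1)) ((⌊|t|⌋₊ : ℝ) + 1) := fun t =>
    abs_lt.1 (Nat.lt_floor_add_one |t|)
  refine ⟨fun t => α ⌊|t|⌋₊ t, by simp [h1], fun t => ?_⟩
  have : (fun t => α ⌊|t|⌋₊ t) =ᶠ[𝓝 t] α ⌊|t|⌋₊ := by
    filter_upwards [Ioo_mem_nhds (hmem t).1 (hmem t).2] with s hs
    refine heq _ _ ?_ (hmem s)
    have := abs_lt.2 hs
    exact Nat.lt_succ_iff.1 ((Nat.floor_lt (abs_nonneg s)).2 (by exact_mod_cast this))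
  exact (h2 _ t (hmem t)).congr_of_eventuallyEq this

/-- If the linearisation of `f` at `p` is strictly dissipative with respect to the bilinear form
`B`, then so are differences of values of `f` near `p`. -/
theorem exists_ball_dissipative {f : E → E} {p : E} {L : E →L[ℝ] E} (hf : HasStrictFDerivAt f L p)
    (B : E →L[ℝ] E →L[ℝ] ℝ) {c : ℝ} (hc : 0 < c) (hB : ∀ v, B v (L v) ≤ -c * ‖v‖ ^ 2) :
    ∃ ρ > 0, ∀ x ∈ Metric.ball p ρ, ∀ y ∈ Metric.ball p ρ, B (x - y) (f x - f y) ≤ 0 := by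
  -- With this tolerance the nonlinear remainder contributes at most c‖x - y‖², exactly what `hB`
  -- provides; the + 1 covers B = 0.
  have h1 : 0 < c / (‖B‖ + 1) := by positivity
  have h2 := hf.isLittleO.def h1
  obtain ⟨ρ, hρ, h3⟩ := Metric.eventually_nhds_iff_ball.1 h2
  refine ⟨ρ, hρ, fun x hx y hy => ?_⟩
  have h4 := h3 (x, y) (by rw [← ball_prod_same]; exact ⟨hx, hy⟩)
  simp only at h4
  have h5 : B (x - y) (f x - f y) = B (x - y) (L (x - y)) + B (x - y) (f x - f y - L (x - y)) := by
    rw [← map_add]; congr 1; abel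
  have h6 : B (x - y) (f x - f y - L (x - y)) ≤ ‖B‖ * ‖x - y‖ * (c / (‖B‖ + 1) * ‖x - y‖) :=
    (le_abs_self _).trans ((B.le_opNorm₂ _ _).trans (by gcongr))
  have h7 : ‖B‖ * ‖x - y‖ * (c / (‖B‖ + 1) * ‖x - y‖) ≤ c * ‖x - y‖ ^ 2 := by
    have : ‖B‖ * (c / (‖B‖ + 1)) ≤ c := by
      rw [mul_div_assoc', div_le_iff₀ (by positivity)]; nlinarith [norm_nonneg B]
    nlinarith [sq_nonneg ‖x - y‖]
  linarith [hB (x - y)]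

theorem hasDerivAt_quadratic {B : E →L[ℝ] E →L[ℝ] ℝ} (hs : ∀ u v, B u v = B v u)
    {z : ℝ → E} {z' : E} {t : ℝ} (hz : HasDerivAt z z' t) :
    HasDerivAt (fun t => B (z t) (z t)) (2 * B (z t) z') t := by
  have h1 : HasDerivAt (fun t => B (z t)) (B z') t := B.hasFDerivAt.comp_hasDerivAt t hz
  convert! h1.clm_apply hz using 1
  rw [hs z']; ring

open Set in
/-- Two solutions which stay in a region of dissipativity for all past times and have the same limit
at `-∞` have a difference in the nonpositive cone of the quadratic form. -/
theorem quadratic_nonpos_of_past {f : E → E} {p : E} {B : E →L[ℝ] E →L[ℝ] ℝ}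
    (hs : ∀ u v, B u v = B v u) {s : Set E} (hB : ∀ x ∈ s, ∀ y ∈ s, B (x - y) (f x - f y) ≤ 0)
    {x y : ℝ → E} {t₀ : ℝ} (hx : ∀ t ≤ t₀, HasDerivAt x (f (x t)) t)
    (hy : ∀ t ≤ t₀, HasDerivAt y (f (y t)) t)
    (hxs : ∀ t ≤ t₀, x t ∈ s) (hys : ∀ t ≤ t₀, y t ∈ s) (hxp : Tendsto x atBot (𝓝 p))
    (hyp : Tendsto y atBot (𝓝 p)) : B (x t₀ - y t₀) (x t₀ - y t₀) ≤ 0 := by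
  have hd : ∀ t ≤ t₀, HasDerivAt (fun t => B (x t - y t) (x t - y t))
      (2 * B (x t - y t) (f (x t) - f (y t))) t := fun t ht =>
    hasDerivAt_quadratic hs ((hx t ht).sub (hy t ht))
  -- The form of the difference never increases and tends to 0 at -∞, so it is nonpositive.
  have hanti : AntitoneOn (fun t => B (x t - y t) (x t - y t)) (Iic t₀) := by
    refine antitoneOn_of_deriv_nonpos (convex_Iic t₀)
      (fun t ht => (hd t ht).continuousAt.continuousWithinAt)
      (fun t ht => (hd t (mem_Iic.1 (interior_subset ht))).differentiableAt.differentiableWithinAt)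
      (fun t ht => ?_)
    have ht' : t ≤ t₀ := mem_Iic.1 (interior_subset ht)
    rw [(hd t ht').deriv]
    linarith [hB _ (hxs t ht') _ (hys t ht')]
  have hlim : Tendsto (fun t => B (x t - y t) (x t - y t)) atBot (𝓝 0) := by
    have h1 : Tendsto (fun t => x t - y t) atBot (𝓝 0) := by simpa using hxp.sub hyp
    have h2 : Continuous fun z : E => B z z := by fun_prop
    have h3 := (h2.tendsto 0).comp h1
    rwa [map_zero] at h3
  refine ge_of_tendsto hlim ?_
  filter_upwards [eventually_le_atBot t₀] with t ht
  exact hanti (mem_Iic.2 ht) (mem_Iic.2 le_rfl) ht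

end ODE

/-! ### Slice charts -/

/-- A set which near `Θ z₀` is the image of a coordinate slice under a map `Θ`, analytic at `z₀` with
invertible derivative, is a submanifold near `Θ z₀`. -/
theorem exists_slice_chart {n k : ℕ} {S : Set (EuclideanSpace ℝ (Fin n))}
    {Θ : EuclideanSpace ℝ (Fin n) → EuclideanSpace ℝ (Fin n)} {z₀ : EuclideanSpace ℝ (Fin n)}
    {Θ' : EuclideanSpace ℝ (Fin n) →L[ℝ] EuclideanSpace ℝ (Fin n)} (hΘ : ContDiffAt ℝ ω Θ z₀)
    (hΘ' : HasFDerivAt Θ Θ' z₀) (hinj : Function.Injective Θ')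
    (hS : ∀ᶠ z in 𝓝 z₀, Θ z ∈ S ↔ ∀ i : Fin n, k ≤ (i : ℕ) → z i = 0) :
    ∃ φ : OpenPartialHomeomorph (EuclideanSpace ℝ (Fin n)) (EuclideanSpace ℝ (Fin n)),
      Θ z₀ ∈ φ.source ∧ ContDiffOn ℝ ∞ φ φ.source ∧ ContDiffOn ℝ ∞ φ.symm φ.target ∧
      ∀ y ∈ φ.source, y ∈ S ↔ ∀ i : Fin n, k ≤ (i : ℕ) → φ y i = 0 := by
  set e : EuclideanSpace ℝ (Fin n) ≃L[ℝ] EuclideanSpace ℝ (Fin n) :=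
    (LinearEquiv.ofInjectiveEndo (Θ' : _ →ₗ[ℝ] _) hinj).toContinuousLinearEquiv
  have he : (e : EuclideanSpace ℝ (Fin n) →L[ℝ] EuclideanSpace ℝ (Fin n)) = Θ' := by
    ext v; rfl
  rw [← he] at hΘ'
  have hω : (ω : WithTop ℕ∞) ≠ 0 := by simp
  set ψ := hΘ.toOpenPartialHomeomorph Θ hΘ' hω
  have hψ : ∀ z, ψ z = Θ z := fun z => rfl
  have hz : z₀ ∈ ψ.source := hΘ.mem_toOpenPartialHomeomorph_source hΘ' hω
  obtain ⟨V, hV, hVo, hzV⟩ := _root_.eventually_nhds_iff.1 hS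
  have hψt : Θ z₀ ∈ ψ.target := ψ.map_source hz
  have hsymm : ψ.symm (Θ z₀) = z₀ := ψ.left_inv hz
  have hsm : ContDiffAt ℝ ω ψ.symm (Θ z₀) := by
    apply ψ.contDiffAt_symm hψt
    · rw [hsymm]; exact hΘ'
    · rw [hsymm]; exact hΘ
  -- Class ω at a point persists on a neighbourhood, whereas for ∞ the neighbourhood may shrink with
  -- the order. This is why analyticity is carried throughout although only smoothness is claimed.
  set χ := (ψ.restrContDiff ℝ ω (by simp)).restrOpen V hVo
  have hχs : χ.source ⊆ (ψ.restrContDiff ℝ ω (by simp)).source := Set.inter_subset_left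
  have hχt : χ.target ⊆ (ψ.restrContDiff ℝ ω (by simp)).target := by
    intro y hy
    have h1 := χ.map_target hy
    have h2 := (ψ.restrContDiff ℝ ω (by simp)).map_source (hχs h1)
    have h3 : (ψ.restrContDiff ℝ ω (by simp)) (χ.symm y) = y := χ.right_inv hy
    rwa [h3] at h2
  have hzχ : z₀ ∈ χ.source := ⟨⟨hz, hΘ, hsm⟩, hzV⟩
  refine ⟨χ.symm, χ.map_source hzχ, ?_, ?_, ?_⟩
  · exact ((ψ.contDiffOn_restrContDiff_target (𝕜 := ℝ) (n := ω) (by simp)).mono hχt).of_le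
      le_top
  · exact ((ψ.contDiffOn_restrContDiff_source (𝕜 := ℝ) (n := ω) (by simp)).mono hχs).of_le
      le_top
  · intro y hy
    have h1 := χ.map_target hy
    have h2 : Θ (χ.symm y) = y := χ.right_inv hy
    rw [← hV _ h1.2, h2]

end BianchiVI0

/-! ### Reduced field, integral operators, and local analyticity of the flow -/

noncomputable section

namespace BianchiVI0

/-- Euclidean space with coordinates `(Σ₊, Σ₋, N₊, N₋)`. -/
abbrev R4 : Type := EuclideanSpace ℝ (Fin 4)

/-- The polynomial right-hand side of the evolution equations after elimination of `Ω`, over an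
arbitrary real algebra. -/
def fieldPoly {A : Type*} [CommRing A] [Algebra ℝ A] (q : ℝ) (w : Fin 4 → A) : Fin 4 → A :=
  ![(q • (1 - w 0 ^ 2 - w 1 ^ 2 - w 3 ^ 2) + 2 * (w 0 ^ 2 + w 1 ^ 2) - 2) * w 0 - 2 * w 3 ^ 2,
    (q • (1 - w 0 ^ 2 - w 1 ^ 2 - w 3 ^ 2) + 2 * (w 0 ^ 2 + w 1 ^ 2) - 2) * w 1
      - (2 * √3) • (w 2 * w 3),
    (q • (1 - w 0 ^ 2 - w 1 ^ 2 - w 3 ^ 2) + 2 * (w 0 ^ 2 + w 1 ^ 2) + 2 * w 0) * w 2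
      + (2 * √3) • (w 1 * w 3),
    (q • (1 - w 0 ^ 2 - w 1 ^ 2 - w 3 ^ 2) + 2 * (w 0 ^ 2 + w 1 ^ 2) + 2 * w 0) * w 3
      + (2 * √3) • (w 1 * w 2)]

/-- The general algebra serves two purposes: A = ℝ gives the field on ℝ⁴, and A = C([0, 1]) gives
its superposition operator on paths. -/
theorem contDiff_fieldPoly {A : Type*} [NormedCommRing A] [NormedAlgebra ℝ A] (q : ℝ)
    {n : WithTop ℕ∞} : ContDiff ℝ n (fieldPoly q : (Fin 4 → A) → Fin 4 → A) := by
  rw [contDiff_pi]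
  intro i
  fin_cases i <;> simp only [fieldPoly, Fin.zero_eta, Fin.mk_one, Fin.reduceFinMk,
    Matrix.cons_val] <;> fun_prop

/-- The evolution equations on `ℝ⁴`. -/
def reducedField (q : ℝ) (x : R4) : R4 := WithLp.toLp 2 (fieldPoly q (fun i => x i))

theorem contDiff_reducedField (q : ℝ) {n : WithTop ℕ∞} : ContDiff ℝ n (reducedField q) := by
  rw [contDiff_euclidean]
  intro i
  exact contDiff_pi.1 ((contDiff_fieldPoly q).comp
    (contDiff_pi.2 fun j => by fun_prop)) i

open unitInterval Set

/-- The operator `g ↦ (s ↦ s ∫₀¹ u ^ κ g (s u) du)` on continuous functions on `[0, 1]`. -/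
def avg (κ : NNReal) : C(I, ℝ) →L[ℝ] C(I, ℝ) :=
  have hcont (g : C(I, ℝ)) (s : I) :
      Continuous fun u : ℝ => u ^ (κ : ℝ) * g (s * projIcc 0 1 zero_le_one u) :=
    (Real.continuous_rpow_const κ.2).mul
      (g.continuous.comp (continuous_const.mul continuous_projIcc))
  LinearMap.mkContinuous
    { toFun := fun g =>
        { toFun := fun s => s * ∫ u in (0 : ℝ)..1, u ^ (κ : ℝ) * g (s * projIcc 0 1 zero_le_one u)
          continuous_toFun := by
            refine continuous_subtype_val.mul
              (intervalIntegral.continuous_parametric_intervalIntegral_of_continuous' ?_ _ _)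
            exact ((Real.continuous_rpow_const κ.2).comp continuous_snd).mul
              (g.continuous.comp (continuous_fst.mul (continuous_projIcc.comp continuous_snd))) }
      map_add' := fun g h => by
        ext s
        simp only [ContinuousMap.coe_mk, ContinuousMap.add_apply, mul_add]
        rw [intervalIntegral.integral_add ((hcont g s).intervalIntegrable _ _)
          ((hcont h s).intervalIntegrable _ _), mul_add]
      map_smul' := fun r g => by
        ext s
        simp only [ContinuousMap.coe_mk, ContinuousMap.smul_apply, smul_eq_mul, RingHom.id_apply]
        simp_rw [mul_left_comm _ r]
        rw [intervalIntegral.integral_const_mul, mul_left_comm] }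
    1 (fun g => by
      rw [ContinuousMap.norm_le _ (by positivity)]
      intro s
      simp only [LinearMap.coe_mk, AddHom.coe_mk, ContinuousMap.coe_mk, one_mul]
      have h1 : ‖∫ u in (0 : ℝ)..1, u ^ (κ : ℝ) * g (s * projIcc 0 1 zero_le_one u)‖
          ≤ ‖g‖ * |1 - 0| := by
        refine intervalIntegral.norm_integral_le_of_norm_le_const fun u hu => ?_
        rw [uIoc_of_le zero_le_one] at hu
        rw [norm_mul, Real.norm_of_nonneg (Real.rpow_nonneg hu.1.le _)]
        have := Real.rpow_le_one hu.1.le hu.2 κ.2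
        have h2 := g.norm_coe_le_norm (s * projIcc 0 1 zero_le_one u)
        calc _ ≤ 1 * ‖g‖ := by gcongr; exact this
          _ = _ := one_mul _
      rw [norm_mul, Real.norm_of_nonneg s.2.1]
      calc _ ≤ 1 * (‖g‖ * |1 - 0|) := by gcongr; exact s.2.2
        _ = _ := by simp)

theorem avg_apply (κ : NNReal) (g : C(I, ℝ)) (s : I) :
    avg κ g s = s * ∫ u in (0 : ℝ)..1, u ^ (κ : ℝ) * g (s * projIcc 0 1 zero_le_one u) := rfl

/-- Substitute v = s u. The defining form is visibly continuous at s = 0; this one can be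
differentiated for s > 0. -/
theorem avg_eq_integral (κ : NNReal) (g : C(I, ℝ)) {s : ℝ} (hs : s ∈ Ioc (0 : ℝ) 1) :
    avg κ g (projIcc 0 1 zero_le_one s) =
      (s ^ (κ : ℝ))⁻¹ * ∫ v in (0 : ℝ)..s, v ^ (κ : ℝ) * g (projIcc 0 1 zero_le_one v) := by
  have h1 : ∫ v in (0 : ℝ)..s, v ^ (κ : ℝ) * g (projIcc 0 1 zero_le_one v) =
      s * ∫ u in (0 : ℝ)..1, (s * u) ^ (κ : ℝ) * g (projIcc 0 1 zero_le_one (s * u)) := by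
    rw [intervalIntegral.mul_integral_comp_mul_left
      (f := fun v => v ^ (κ : ℝ) * g (projIcc 0 1 zero_le_one v))]
    simp
  have h2 : ∫ u in (0 : ℝ)..1, (s * u) ^ (κ : ℝ) * g (projIcc 0 1 zero_le_one (s * u)) =
      s ^ (κ : ℝ) * ∫ u in (0 : ℝ)..1, u ^ (κ : ℝ) *
        g (projIcc 0 1 zero_le_one s * projIcc 0 1 zero_le_one u) := by
    rw [← intervalIntegral.integral_const_mul]
    refine intervalIntegral.integral_congr fun u hu => ?_
    rw [uIcc_of_le zero_le_one] at hu
    have hs' : s ∈ Icc (0 : ℝ) 1 := ⟨hs.1.le, hs.2⟩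
    have h3 : s * u ∈ Icc (0 : ℝ) 1 := unitInterval.mul_mem hs' hu
    rw [Real.mul_rpow hs.1.le hu.1, mul_assoc, projIcc_of_mem _ hs', projIcc_of_mem _ hu,
      projIcc_of_mem _ h3]
    rfl
  have h4 : s ^ (κ : ℝ) ≠ 0 := (Real.rpow_pos_of_pos hs.1 _).ne'
  rw [h1, h2, avg_apply, projIcc_of_mem _ ⟨hs.1.le, hs.2⟩]
  field_simp

/-- So `avg κ g` is the solution of the singular equation y' = g - (κ / s) y that vanishes at s = 0.
-/
theorem hasDerivAt_avg (κ : NNReal) (g : C(I, ℝ)) {s : ℝ} (hs : s ∈ Ioo (0 : ℝ) 1) :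
    HasDerivAt (fun s => avg κ g (projIcc 0 1 zero_le_one s))
      (g (projIcc 0 1 zero_le_one s) - κ / s * avg κ g (projIcc 0 1 zero_le_one s)) s := by
  have hc : Continuous fun v : ℝ => v ^ (κ : ℝ) * g (projIcc 0 1 zero_le_one v) :=
    (Real.continuous_rpow_const κ.2).mul (g.continuous.comp continuous_projIcc)
  have h1 := intervalIntegral.integral_hasDerivAt_right (hc.intervalIntegrable 0 s)
    (hc.stronglyMeasurableAtFilter _ _) hc.continuousAt
  have hp : 0 < s ^ (κ : ℝ) := Real.rpow_pos_of_pos hs.1 _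
  have h2 := ((Real.hasDerivAt_rpow_const (p := (κ : ℝ)) (Or.inl hs.1.ne')).fun_inv hp.ne').mul h1
  have h3 : (fun s => avg κ g (projIcc 0 1 zero_le_one s)) =ᶠ[𝓝 s] (fun s => (s ^ (κ : ℝ))⁻¹ *
      ∫ v in (0 : ℝ)..s, v ^ (κ : ℝ) * g (projIcc 0 1 zero_le_one v)) := by
    filter_upwards [Ioo_mem_nhds hs.1 hs.2] with t ht
    exact avg_eq_integral κ g ⟨ht.1, ht.2.le⟩
  refine (h2.congr_of_eventuallyEq h3).congr_deriv ?_
  rw [avg_eq_integral κ g ⟨hs.1, hs.2.le⟩, Real.rpow_sub_one hs.1.ne']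
  field_simp
  ring

/-- Paths in `ℝ⁴`, by components. -/
abbrev PathSpace : Type := Fin 4 → C(I, ℝ)

/-- Constant paths. -/
def constPath : R4 →L[ℝ] PathSpace :=
  ContinuousLinearMap.pi fun i => (EuclideanSpace.proj i : R4 →L[ℝ] ℝ).smulRight (1 : C(I, ℝ))

@[simp] theorem constPath_apply (x : R4) (i : Fin 4) (s : I) : constPath x i s = x i := by
  simp [constPath]

/-- Evaluation of paths. -/
def evalPath (s : I) : PathSpace →L[ℝ] R4 :=
  (EuclideanSpace.equiv (Fin 4) ℝ).symm.toContinuousLinearMap ∘L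
    ContinuousLinearMap.pi fun i => ContinuousMap.evalCLM ℝ s ∘L ContinuousLinearMap.proj i

@[simp] theorem evalPath_apply (w : PathSpace) (i : Fin 4) (s : I) :
    evalPath s w i = w i s := rfl

theorem fieldPoly_apply (q : ℝ) (w : PathSpace) (s : I) (i : Fin 4) :
    fieldPoly q w i s = reducedField q (evalPath s w) i := by
  have h2 : (2 : C(I, ℝ)) s = 2 := rfl
  fin_cases i <;> simp [fieldPoly, reducedField, h2]

/-- Componentwise `avg 0`. -/
def integrate : PathSpace →L[ℝ] PathSpace :=
  ContinuousLinearMap.pi fun i => avg 0 ∘L ContinuousLinearMap.proj i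

/-- Analyticity of the flow in time and initial point, for small times. -/
theorem contDiffAt_flow_zero {q : ℝ} {c : R4 → ℝ → R4} {U : Set R4} (hU : IsOpen U)
    (h0 : ∀ y ∈ U, c y 0 = y) (hc : ∀ y ∈ U, ∀ t, HasDerivAt (c y) (reducedField q (c y t)) t)
    {C : ℝ} (hC : ∀ y ∈ U, ∀ t, ‖reducedField q (c y t)‖ ≤ C) {x : R4} (hx : x ∈ U) :
    ContDiffAt ℝ ω (fun p : ℝ × R4 => c p.2 p.1) (0, x) := by
  set G : PathSpace → PathSpace := fun w => integrate (fieldPoly q w)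
  have hG : ContDiff ℝ ω G := integrate.contDiff.comp (contDiff_fieldPoly q)
  -- A solution rescaled to w(s) = c(ts), s ∈ [0, 1], satisfies w - t ∫ f(w) = c(0), so T sends (t,
  -- w) to t and a constant path. At t = 0 the derivative of T is a shear, hence invertible.
  set T : ℝ × PathSpace → ℝ × PathSpace := fun p => (p.1, p.2 - p.1 • G p.2)
  have hT : ContDiff ℝ ω T := contDiff_fst.prodMk
    (contDiff_snd.sub (contDiff_fst.smul (hG.comp contDiff_snd)))
  set v := G (constPath x)
  set e : (ℝ × PathSpace) ≃L[ℝ] (ℝ × PathSpace) := ContinuousLinearEquiv.equivOfInverse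
    ((ContinuousLinearMap.fst ℝ ℝ PathSpace).prod (ContinuousLinearMap.snd ℝ ℝ PathSpace
      - (ContinuousLinearMap.fst ℝ ℝ PathSpace).smulRight v))
    ((ContinuousLinearMap.fst ℝ ℝ PathSpace).prod (ContinuousLinearMap.snd ℝ ℝ PathSpace
      + (ContinuousLinearMap.fst ℝ ℝ PathSpace).smulRight v))
    (fun p => by simp) (fun p => by simp)
  have he : HasFDerivAt T (e : (ℝ × PathSpace) →L[ℝ] (ℝ × PathSpace)) (0, constPath x) := by
    have hGd : HasFDerivAt (fun p : ℝ × PathSpace => G p.2) _ (0, constPath x) :=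
      HasFDerivAt.comp (g := G) (f := Prod.snd) ((0 : ℝ), constPath x)
        ((hG.differentiable (by simp)).differentiableAt.hasFDerivAt)
        (hasFDerivAt_snd (p := ((0 : ℝ), constPath x)))
    have h1 := (hasFDerivAt_fst (𝕜 := ℝ) (p := ((0 : ℝ), constPath x))).prodMk
      ((hasFDerivAt_snd (p := ((0 : ℝ), constPath x))).sub
        ((hasFDerivAt_fst (p := ((0 : ℝ), constPath x))).smul hGd))
    refine h1.congr_fderiv ?_
    simp only [e, v, zero_smul, zero_add]
    rfl
  have hω : (ω : WithTop ℕ∞) ≠ 0 := by simp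
  set ψ := (hT.contDiffAt (x := (0, constPath x))).toOpenPartialHomeomorph T he hω
  have hsrc : (0, constPath x) ∈ ψ.source :=
    (hT.contDiffAt (x := (0, constPath x))).mem_toOpenPartialHomeomorph_source he hω
  have hTx : T (0, constPath x) = (0, constPath x) := by simp [T]
  have hψ : ContDiffAt ℝ ω ψ.symm (0, constPath x) := by
    have h1 : (0, constPath x) ∈ ψ.target := by
      have := ψ.map_source hsrc
      rwa [show ψ (0, constPath x) = (0, constPath x) from hTx] at this
    have h2 : ψ.symm (0, constPath x) = (0, constPath x) := by
      have := ψ.left_inv hsrc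
      rwa [show ψ (0, constPath x) = (0, constPath x) from hTx] at this
    apply ψ.contDiffAt_symm h1
    · rw [h2]; exact he
    · rw [h2]; exact hT.contDiffAt
  have hcont : ∀ y ∈ U, Continuous (c y) := fun y hy =>
    continuous_iff_continuousAt.2 fun t => (hc y hy t).continuousAt
  classical
  set path : ℝ × R4 → PathSpace := fun p i => if hy : p.2 ∈ U then
    ⟨fun s => c p.2 (p.1 * s) i, (EuclideanSpace.proj i : R4 →L[ℝ] ℝ).continuous.comp
      ((hcont _ hy).comp (continuous_const.mul continuous_subtype_val))⟩ else 0
  have hpath : ∀ p : ℝ × R4, p.2 ∈ U → ∀ i s, path p i s = c p.2 (p.1 * s) i := by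
    intro p hp i s
    simp only [path, dif_pos hp]
    rfl
  have hlip : ∀ y ∈ U, ∀ t, ‖c y t - y‖ ≤ C * |t| := by
    intro y hy t
    have := convex_univ.norm_image_sub_le_of_norm_hasDerivWithin_le
      (fun s _ => (hc y hy s).hasDerivWithinAt) (fun s _ => hC y hy s) (mem_univ 0) (mem_univ t)
    simpa [h0 y hy] using this
  have hUev : ∀ᶠ p : ℝ × R4 in 𝓝 (0, x), p.2 ∈ U :=
    continuous_snd.continuousAt.eventually (hU.mem_nhds hx)
  have hC0 : 0 ≤ C := (norm_nonneg _).trans (hC x hx 0)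
  -- The local inverse of T recovers the true path only once that path is known to lie in its
  -- domain; the uniform speed bound C ensures this.
  have htend : Tendsto (fun p => (p.1, path p)) (𝓝 (0, x)) (𝓝 ((0 : ℝ), constPath x)) := by
    refine (continuous_fst.tendsto _).prodMk_nhds ?_
    rw [tendsto_iff_dist_tendsto_zero]
    have hb : Tendsto (fun p : ℝ × R4 => C * |p.1| + ‖p.2 - x‖) (𝓝 (0, x)) (𝓝 0) := by
      have : Continuous fun p : ℝ × R4 => C * |p.1| + ‖p.2 - x‖ := by fun_prop
      simpa using this.tendsto (0, x)
    refine squeeze_zero' (Eventually.of_forall fun _ => dist_nonneg) ?_ hb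
    filter_upwards [hUev] with p hp
    rw [dist_pi_le_iff (by positivity)]
    intro i
    rw [ContinuousMap.dist_le (by positivity)]
    intro s
    rw [hpath p hp, constPath_apply, dist_eq_norm, ← PiLp.sub_apply]
    refine (PiLp.norm_apply_le _ i).trans ?_
    calc ‖c p.2 (p.1 * s) - x‖ ≤ ‖c p.2 (p.1 * s) - p.2‖ + ‖p.2 - x‖ := norm_sub_le_norm_sub_add_norm_sub _ _ _
      _ ≤ C * |p.1| + ‖p.2 - x‖ := by
        gcongr
        refine (hlip _ hp _).trans ?_
        rw [abs_mul, abs_of_nonneg s.2.1]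
        gcongr
        exact mul_le_of_le_one_right (abs_nonneg _) s.2.2
  have hTpath : ∀ p : ℝ × R4, p.2 ∈ U → T (p.1, path p) = (p.1, constPath p.2) := by
    intro p hp
    simp only [T]
    congr 1
    funext i
    ext s
    have hd : ∀ u : ℝ, HasDerivAt (fun u => c p.2 (p.1 * s * u) i)
        (p.1 * s * reducedField q (c p.2 (p.1 * s * u)) i) u := by
      intro u
      have h1 := (hc p.2 hp (p.1 * s * u)).scomp u ((hasDerivAt_id u).const_mul (p.1 * (s : ℝ)))
      have h2 := (EuclideanSpace.proj i : R4 →L[ℝ] ℝ).hasFDerivAt.comp_hasDerivAt u h1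
      convert! h2 using 1
      simp
    have hcd : Continuous fun u : ℝ => p.1 * s * reducedField q (c p.2 (p.1 * s * u)) i := by
      refine continuous_const.mul ((EuclideanSpace.proj i : R4 →L[ℝ] ℝ).continuous.comp
        (((contDiff_reducedField q (n := ω)).continuous).comp ((hcont _ hp).comp ?_)))
      fun_prop
    have hint := intervalIntegral.integral_eq_sub_of_hasDerivAt (fun u _ => hd u)
      (hcd.intervalIntegrable 0 1)
    rw [intervalIntegral.integral_const_mul] at hint
    simp only [mul_one, mul_zero, h0 _ hp] at hint
    have hG' : G (path p) i s = s * ∫ u in (0 : ℝ)..1, reducedField q (c p.2 (p.1 * s * u)) i := by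
      simp only [G, integrate, ContinuousLinearMap.pi_apply, ContinuousLinearMap.comp_apply,
        ContinuousLinearMap.proj_apply, avg_apply]
      congr 1
      refine intervalIntegral.integral_congr fun u hu => ?_
      rw [uIcc_of_le zero_le_one] at hu
      have hev : evalPath (s * ⟨u, hu⟩) (path p) = c p.2 (p.1 * s * u) := by
        ext j
        rw [evalPath_apply, hpath p hp]
        simp [mul_assoc]
      simp only [NNReal.coe_zero, Real.rpow_zero, one_mul, projIcc_of_mem _ hu, fieldPoly_apply,
        hev]
    simp only [Pi.sub_apply, Pi.smul_apply, ContinuousMap.sub_apply, ContinuousMap.smul_apply,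
      smul_eq_mul, hG', hpath p hp, constPath_apply]
    linarith
  have hfin : (fun p : ℝ × R4 => c p.2 p.1) =ᶠ[𝓝 (0, x)]
      fun p => evalPath 1 (ψ.symm (p.1, constPath p.2)).2 := by
    filter_upwards [hUev, htend.eventually (ψ.open_source.mem_nhds hsrc)] with p hp hps
    have h1 := ψ.left_inv hps
    rw [show ψ (p.1, path p) = (p.1, constPath p.2) from hTpath p hp] at h1
    rw [h1]
    ext i
    simp [hpath p hp]
  refine ContDiffAt.congr_of_eventuallyEq ?_ hfin
  have h1 : ContDiffAt ℝ ω (fun p : ℝ × R4 => (p.1, constPath p.2)) (0, x) := by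
    fun_prop
  exact (evalPath 1).contDiff.contDiffAt.comp _ (contDiff_snd.contDiffAt.comp _
    (ContDiffAt.comp (0, x) (g := ψ.symm) (by simpa using hψ) h1))

end BianchiVI0

end

/-! ### The global flow on the region and the reduction to ℝ⁴ -/

noncomputable section

namespace BianchiVI0

/-- The density parameter `Ω` as a function on `ℝ⁴`. -/
def density (x : R4) : ℝ := 1 - x 0 ^ 2 - x 1 ^ 2 - x 3 ^ 2

/-- The deceleration parameter as a function on `ℝ⁴`. -/
def dec (q : ℝ) (x : R4) : ℝ := q * density x + 2 * (x 0 ^ 2 + x 1 ^ 2)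

theorem reducedField_zero (q : ℝ) (x : R4) :
    reducedField q x 0 = -(2 - dec q x) * x 0 - 2 * x 3 ^ 2 := by
  simp [reducedField, fieldPoly, dec, density]

theorem reducedField_one (q : ℝ) (x : R4) :
    reducedField q x 1 = -(2 - dec q x) * x 1 - 2 * √3 * x 2 * x 3 := by
  simp [reducedField, fieldPoly, dec, density]; ring

theorem reducedField_two (q : ℝ) (x : R4) :
    reducedField q x 2 = (dec q x + 2 * x 0) * x 2 + 2 * √3 * x 1 * x 3 := by
  simp [reducedField, fieldPoly, dec, density]; ring

theorem reducedField_three (q : ℝ) (x : R4) :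
    reducedField q x 3 = (dec q x + 2 * x 0) * x 3 + 2 * √3 * x 1 * x 2 := by
  simp [reducedField, fieldPoly, dec, density]; ring

theorem hasDerivAt_coord {n : ℕ} {c : ℝ → EuclideanSpace ℝ (Fin n)} {c' : EuclideanSpace ℝ (Fin n)}
    {t : ℝ} (hc : HasDerivAt c c' t) (i : Fin n) : HasDerivAt (fun t => c t i) (c' i) t :=
  (EuclideanSpace.proj i : EuclideanSpace ℝ (Fin n) →L[ℝ] ℝ).hasFDerivAt.comp_hasDerivAt t hc

theorem hasDerivAt_of_coord {n : ℕ} {c : ℝ → EuclideanSpace ℝ (Fin n)}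
    {c' : EuclideanSpace ℝ (Fin n)} {t : ℝ} (hc : ∀ i, HasDerivAt (fun t => c t i) (c' i) t) :
    HasDerivAt c c' t :=
  (EuclideanSpace.equiv (Fin n) ℝ).symm.toContinuousLinearMap.hasFDerivAt.comp_hasDerivAt t
    (hasDerivAt_pi.2 hc)

/-- The open part `Ω > 0`, `N₋ > |N₊|` of the phase space. -/
def region : Set R4 := {x | 0 < density x ∧ |x 2| < x 3}

theorem continuous_density : Continuous density := by unfold density; fun_prop

theorem isOpen_region : IsOpen region :=
  (isOpen_lt continuous_const continuous_density).inter
    (isOpen_lt (f := fun x : R4 => |x 2|) (g := fun x : R4 => x 3) (by fun_prop) (by fun_prop))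

theorem norm_sq_eq (x : R4) : ‖x‖ ^ 2 = x 0 ^ 2 + x 1 ^ 2 + x 2 ^ 2 + x 3 ^ 2 := by
  rw [EuclideanSpace.norm_sq_eq]; simp [Fin.sum_univ_four]

theorem norm_lt_two {x : R4} (hx : x ∈ region) : ‖x‖ < 2 := by
  have h1 := hx.1
  have h2 := sq_lt_sq' (abs_lt.1 hx.2).1 (abs_lt.1 hx.2).2
  unfold density at h1
  refine lt_of_pow_lt_pow_left₀ 2 (by norm_num) ?_
  rw [norm_sq_eq]; nlinarith [sq_nonneg (x 0), sq_nonneg (x 1)]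

theorem hasDerivAt_density {q χ : ℝ} {c : ℝ → R4} {t : ℝ}
    (hc : HasDerivAt c (χ • reducedField q (c t)) t) :
    HasDerivAt (fun t => density (c t)) (χ * (2 * (dec q (c t) - q)) * density (c t)) t := by
  have h0 := hasDerivAt_coord hc 0
  have h1 := hasDerivAt_coord hc 1
  have h3 := hasDerivAt_coord hc 3
  refine ((((h0.pow 2).const_sub 1).sub (h1.pow 2)).sub (h3.pow 2)).congr_deriv ?_
  simp only [PiLp.smul_apply, smul_eq_mul, reducedField_zero, reducedField_one, reducedField_three]
  simp only [dec, density]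
  ring

/-- Ω and N₋ ± N₊ each solve a homogeneous linear equation. The factor χ lets the argument apply to
the cut-off field, before completeness of the original one is known. -/
theorem mem_region_of_scaled_solution {q : ℝ} {χ : ℝ → ℝ} (hχ : Continuous χ) {c : ℝ → R4}
    (hc : ∀ t, HasDerivAt c (χ t • reducedField q (c t)) t) {t₀ : ℝ} (h0 : c t₀ ∈ region) (t : ℝ) :
    c t ∈ region := by
  have hcc : Continuous c := continuous_iff_continuousAt.2 fun t => (hc t).continuousAt
  have hdec : Continuous fun t => dec q (c t) := by
    unfold dec
    have := continuous_density.comp hcc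
    simp only [Function.comp_def] at this
    fun_prop
  have h1 := pos_of_linear_ode (k := fun t => χ t * (2 * (dec q (c t) - q))) (by fun_prop)
    (fun t => hasDerivAt_density (hc t)) h0.1 t
  have h2 := pos_of_linear_ode (y := fun t => c t 3 - c t 2)
    (k := fun t => χ t * (dec q (c t) + 2 * c t 0 - 2 * √3 * c t 1)) (by fun_prop)
    (fun t => ((hasDerivAt_coord (hc t) 3).sub (hasDerivAt_coord (hc t) 2)).congr_deriv (by
      simp only [PiLp.smul_apply, smul_eq_mul, reducedField_two, reducedField_three]; ring))
    (by have := (abs_lt.1 h0.2).2; linarith) t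
  have h3 := pos_of_linear_ode (y := fun t => c t 3 + c t 2)
    (k := fun t => χ t * (dec q (c t) + 2 * c t 0 + 2 * √3 * c t 1)) (by fun_prop)
    (fun t => ((hasDerivAt_coord (hc t) 3).add (hasDerivAt_coord (hc t) 2)).congr_deriv (by
      simp only [PiLp.smul_apply, smul_eq_mul, reducedField_two, reducedField_three]; ring))
    (by have := (abs_lt.1 h0.2).1; linarith) t
  exact ⟨h1, abs_lt.2 ⟨by linarith, by linarith⟩⟩

theorem exists_cutoff_field (q : ℝ) : ∃ (χ : R4 → ℝ) (K C : NNReal), Continuous χ ∧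
    (∀ x, ‖x‖ ≤ 2 → χ x = 1) ∧ LipschitzWith K (fun x => χ x • reducedField q x) ∧
    ∀ x, ‖χ x • reducedField q x‖ ≤ C := by
  let b : ContDiffBump (0 : R4) := ⟨3, 4, by norm_num, by norm_num⟩
  have hsm : ContDiff ℝ 1 (fun x => b x • reducedField q x) :=
    b.contDiff.smul (contDiff_reducedField q)
  have hcs : HasCompactSupport (fun x => b x • reducedField q x) :=
    b.hasCompactSupport.smul_right
  obtain ⟨K, hK⟩ := hsm.lipschitzWith_of_hasCompactSupport hcs (by simp)
  obtain ⟨C, hC⟩ := hcs.exists_bound_of_continuous hsm.continuous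
  exact ⟨b, K, C.toNNReal, b.continuous, fun x hx => b.one_of_mem_closedBall (by
    simp only [Metric.mem_closedBall, dist_zero_right, b]; linarith), hK,
    fun x => (hC x).trans (Real.le_coe_toNNReal C)⟩

theorem exists_lipschitzOnWith (q : ℝ) :
    ∃ K : NNReal, LipschitzOnWith K (reducedField q) (Metric.closedBall 0 2) := by
  obtain ⟨χ, K, C, -, h1, h2, -⟩ := exists_cutoff_field q
  refine ⟨K, fun x hx y hy => ?_⟩
  have := h2 x y
  simpa only [h1 x (by simpa using hx), h1 y (by simpa using hy), one_smul] using this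

theorem exists_bound (q : ℝ) : ∃ C : ℝ, ∀ x ∈ region, ‖reducedField q x‖ ≤ C := by
  obtain ⟨χ, K, C, -, h1, -, h2⟩ := exists_cutoff_field q
  refine ⟨C, fun x hx => ?_⟩
  have := h2 x
  rwa [h1 x (norm_lt_two hx).le, one_smul] at this

/-- The cut-off field is complete, its solutions stay in the region, and the region lies in the ball
of radius 2, where the cut-off is 1. -/
theorem exists_solution (q : ℝ) {x : R4} (hx : x ∈ region) : ∃ c : ℝ → R4, c 0 = x ∧
    (∀ t, HasDerivAt c (reducedField q (c t)) t) ∧ ∀ t, c t ∈ region := by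
  obtain ⟨χ, K, C, hχ, h1, h2, h3⟩ := exists_cutoff_field q
  obtain ⟨c, h4, h5⟩ := exists_global_solution_of_lipschitz h2 h3 x
  have hcc : Continuous c := continuous_iff_continuousAt.2 fun t => (h5 t).continuousAt
  have h6 := mem_region_of_scaled_solution (hχ.comp hcc) h5 (t₀ := 0) (h4 ▸ hx)
  refine ⟨c, h4, fun t => ?_, h6⟩
  have := h5 t
  rwa [h1 _ (norm_lt_two (h6 t)).le, one_smul] at this

open Classical in
/-- The flow of the evolution equations. -/
def flow (q : ℝ) (x : R4) : ℝ → R4 :=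
  if hx : x ∈ region then (exists_solution q hx).choose else fun _ => x

variable {q : ℝ} {x : R4}

theorem flow_zero (hx : x ∈ region) : flow q x 0 = x := by
  rw [flow, dif_pos hx]; exact (exists_solution q hx).choose_spec.1

theorem hasDerivAt_flow (hx : x ∈ region) (t : ℝ) :
    HasDerivAt (flow q x) (reducedField q (flow q x t)) t := by
  rw [flow, dif_pos hx]; exact (exists_solution q hx).choose_spec.2.1 t

theorem flow_mem (hx : x ∈ region) (t : ℝ) : flow q x t ∈ region := by
  rw [flow, dif_pos hx]; exact (exists_solution q hx).choose_spec.2.2 t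

theorem continuous_flow (hx : x ∈ region) : Continuous (flow q x) :=
  continuous_iff_continuousAt.2 fun t => (hasDerivAt_flow hx t).continuousAt

theorem mem_closedBall_of_mem_region (hx : x ∈ region) : x ∈ Metric.closedBall (0 : R4) 2 := by
  simpa using (norm_lt_two hx).le

theorem eqOn_of_solution {c d : ℝ → R4} {a b t₀ : ℝ} (ht : t₀ ∈ Set.Ioo a b)
    (hc : ∀ t ∈ Set.Ioo a b, HasDerivAt c (reducedField q (c t)) t)
    (hcs : ∀ t ∈ Set.Ioo a b, c t ∈ Metric.closedBall (0 : R4) 2)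
    (hd : ∀ t ∈ Set.Ioo a b, HasDerivAt d (reducedField q (d t)) t)
    (hds : ∀ t ∈ Set.Ioo a b, d t ∈ Metric.closedBall (0 : R4) 2) (h : c t₀ = d t₀) :
    Set.EqOn c d (Set.Ioo a b) := by
  obtain ⟨K, hK⟩ := exists_lipschitzOnWith q
  exact ODE_solution_unique_of_mem_Ioo (v := fun _ => reducedField q)
    (s := fun _ => Metric.closedBall 0 2) (fun _ _ => hK) ht (fun t ht => ⟨hc t ht, hcs t ht⟩)
    (fun t ht => ⟨hd t ht, hds t ht⟩) h

theorem eq_flow {c : ℝ → R4} (hc : ∀ t, HasDerivAt c (reducedField q (c t)) t)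
    {t₀ : ℝ} (h : c t₀ ∈ region) (t : ℝ) : c t = flow q (c t₀) (t - t₀) := by
  have hmem : ∀ t, c t ∈ region := mem_region_of_scaled_solution (χ := fun _ => 1)
    continuous_const (by simpa using hc) h
  have hd : ∀ t, HasDerivAt (fun t => flow q (c t₀) (t - t₀))
      (reducedField q (flow q (c t₀) (t - t₀))) t := fun t =>
    (hasDerivAt_flow h (t - t₀)).comp_sub_const t t₀
  refine eqOn_of_solution (q := q) (a := min t t₀ - 1) (b := max t t₀ + 1) (t₀ := t₀) ?_
    (fun t _ => hc t) (fun t _ => mem_closedBall_of_mem_region (hmem t)) (fun t _ => hd t)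
    (fun t _ => mem_closedBall_of_mem_region (flow_mem h _)) (by simp [flow_zero h]) ?_ <;> grind

theorem flow_flow (hx : x ∈ region) (s t : ℝ) : flow q (flow q x s) t = flow q x (s + t) := by
  have := eq_flow (q := q) (hasDerivAt_flow hx) (flow_mem hx s) (s + t)
  rw [this]; simp

theorem flow_flow_neg (hx : x ∈ region) (t : ℝ) : flow q (flow q x t) (-t) = x := by
  rw [flow_flow hx, add_neg_cancel, flow_zero hx]

theorem contDiffAt_flow_zero_time (hx : x ∈ region) :
    ContDiffAt ℝ ω (fun p : ℝ × R4 => flow q p.2 p.1) (0, x) := by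
  obtain ⟨C, hC⟩ := exists_bound q
  exact contDiffAt_flow_zero isOpen_region (fun y hy => flow_zero hy)
    (fun y hy => hasDerivAt_flow hy) (fun y hy t => hC _ (flow_mem hy t)) hx

theorem contDiffAt_flow_time (hx : x ∈ region) (t : ℝ) : ContDiffAt ℝ ω (flow q x) t := by
  have h1 := contDiffAt_flow_zero_time (q := q) (flow_mem (q := q) hx t)
  have h2 : ContDiffAt ℝ ω (fun s : ℝ => (s - t, flow q x t)) t := by fun_prop
  have h3 := ContDiffAt.comp t (g := fun p : ℝ × R4 => flow q p.2 p.1) (by simpa using h1) h2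
  refine h3.congr_of_eventuallyEq (Eventually.of_forall fun s => ?_)
  simp [flow_flow hx]

/-- Connectedness of ℝ: by the group law and small-time analyticity, near any t analyticity at one
time passes to every other, so the set of good times is open and closed. -/
theorem contDiffAt_flow (hx : x ∈ region) (t : ℝ) : ContDiffAt ℝ ω (fun y => flow q y t) x := by
  set A : Set ℝ := {t | ContDiffAt ℝ ω (fun y => flow q y t) x}
  have key : ∀ t, ∀ᶠ s in 𝓝 t, ∀ᶠ r in 𝓝 t, s ∈ A → r ∈ A := by
    intro t
    have h1 : ∀ᶠ p in 𝓝 ((0 : ℝ), flow q x t), ContDiffAt ℝ ω (fun p : ℝ × R4 => flow q p.2 p.1) p :=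
      (contDiffAt_flow_zero_time (flow_mem hx t)).eventually (by simp)
    have h2 : Tendsto (fun p : ℝ × ℝ => (p.2 - p.1, flow q x p.1)) (𝓝 (t, t))
        (𝓝 ((0 : ℝ), flow q x t)) := by
      have : Continuous (fun p : ℝ × ℝ => (p.2 - p.1, flow q x p.1)) :=
        (continuous_snd.sub continuous_fst).prodMk ((continuous_flow hx).comp continuous_fst)
      simpa using this.tendsto (t, t)
    have h3 := h2.eventually h1
    rw [nhds_prod_eq] at h3
    filter_upwards [h3.curry] with s hs
    filter_upwards [hs] with r hr hsA
    have h4 : ContDiffAt ℝ ω (fun y : R4 => (r - s, flow q y s)) x :=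
      contDiffAt_const.prodMk hsA
    have h5 := ContDiffAt.comp x (g := fun p : ℝ × R4 => flow q p.2 p.1) hr h4
    refine h5.congr_of_eventuallyEq ?_
    filter_upwards [isOpen_region.mem_nhds hx] with y hy
    simp [flow_flow hy]
  have hopen : IsOpen A := by
    rw [isOpen_iff_mem_nhds]
    intro t ht
    filter_upwards [(key t).self_of_nhds] with r hr using hr ht
  have hclosed : IsClosed A := by
    rw [← isOpen_compl_iff, isOpen_iff_mem_nhds]
    intro t ht
    filter_upwards [key t] with s hs hsA
    exact ht (hs.self_of_nhds hsA)
  have h0 : (0 : ℝ) ∈ A := by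
    refine (contDiffAt_id (𝕜 := ℝ) (n := ω) (x := x)).congr_of_eventuallyEq ?_
    filter_upwards [isOpen_region.mem_nhds hx] with y hy using flow_zero hy
  have hA : A = Set.univ := IsClopen.eq_univ ⟨hclosed, hopen⟩ ⟨0, h0⟩
  exact hA.symm.subset (Set.mem_univ t)

/-- The past unstable set of `p` within the region `Ω > 0`, `N₋ > |N₊|`. -/
def unstable (q : ℝ) (p : R4) : Set R4 := {x | x ∈ region ∧ Tendsto (flow q x) atBot (𝓝 p)}

theorem flow_mem_unstable {p : R4} (hx : x ∈ unstable q p) (t : ℝ) : flow q x t ∈ unstable q p := by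
  refine ⟨flow_mem hx.1 t, ?_⟩
  have := hx.2.comp (tendsto_atBot_add_const_left atBot t tendsto_id)
  refine this.congr fun s => ?_
  simp [flow_flow hx.1]

theorem flow_mem_unstable_iff {p : R4} (hx : x ∈ region) (t : ℝ) :
    flow q x t ∈ unstable q p ↔ x ∈ unstable q p :=
  ⟨fun h => by simpa [flow_flow_neg hx] using flow_mem_unstable h (-t), fun h =>
    flow_mem_unstable h t⟩

/-- The section of `toR4` given by the constraint. -/
def lift (x : R4) : State := !₂[x 0, x 1, x 2, x 3, density x]

theorem continuous_toR4 : Continuous toR4 := by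
  unfold toR4
  refine (PiLp.continuous_toLp 2 _).comp (continuous_pi fun i => ?_)
  fin_cases i <;> simp <;> fun_prop

theorem continuous_lift : Continuous lift := by
  unfold lift
  have := continuous_density
  refine (PiLp.continuous_toLp 2 _).comp (continuous_pi fun i => ?_)
  fin_cases i <;> simp <;> fun_prop

theorem toR4_lift (x : R4) : toR4 (lift x) = x := by
  ext i; fin_cases i <;> simp [toR4, lift]

theorem reducedField_toR4 {γ : ℝ} {x : State} (hx : x 4 = density (toR4 x)) (i : Fin 4) :
    reducedField (qStar γ) (toR4 x) i = vectorField γ x i.castSucc := by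
  have h : decel γ x = dec (qStar γ) (toR4 x) := by
    rw [decel, dec, hx]; simp [toR4]
  fin_cases i
  · exact (reducedField_zero _ _).trans (by simp [vectorField, h, toR4])
  · exact (reducedField_one _ _).trans (by simp [vectorField, h, toR4])
  · exact (reducedField_two _ _).trans (by simp [vectorField, h, toR4])
  · exact (reducedField_three _ _).trans (by simp [vectorField, h, toR4])

/-- The defect of the constraint solves a linear equation with coefficient twice the deceleration
parameter. -/
theorem constraint_of_isSolution {γ : ℝ} {c : ℝ → State} (hc : IsSolution γ c)
    (h0 : c 0 4 + c 0 0 ^ 2 + c 0 1 ^ 2 + c 0 3 ^ 2 = 1) (t : ℝ) :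
    c t 4 = density (toR4 (c t)) := by
  have hcc : Continuous c := continuous_iff_continuousAt.2 fun t => (hc t).continuousAt
  have hdec : Continuous fun t => decel γ (c t) := by unfold decel; fun_prop
  have h : ∀ t, HasDerivAt (fun t => c t 4 + c t 0 ^ 2 + c t 1 ^ 2 + c t 3 ^ 2 - 1)
      (2 * decel γ (c t) * (c t 4 + c t 0 ^ 2 + c t 1 ^ 2 + c t 3 ^ 2 - 1)) t := by
    intro t
    refine (((((hasDerivAt_coord (hc t) 4).add ((hasDerivAt_coord (hc t) 0).pow 2)).add
      ((hasDerivAt_coord (hc t) 1).pow 2)).add ((hasDerivAt_coord (hc t) 3).pow 2)).sub_const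
      1).congr_deriv ?_
    simp [vectorField, decel]
    ring
  have h1 := eq_exp_mul_of_linear_ode (k := fun t => 2 * decel γ (c t)) (by fun_prop) h 0 t
  rw [h0, sub_self, mul_zero] at h1
  simp only [density, toR4, Matrix.cons_val]
  linarith

/-- The phase space allows Ω = 0, but an orbit with Ω = 0 at one time keeps it and cannot converge
to p. Hence only the open region matters. -/
theorem toR4_image_unstableSet {γ : ℝ} {p : State} (hp : 0 < p 4) (hp' : lift (toR4 p) = p) :
    toR4 '' unstableSet γ p = unstable (qStar γ) (toR4 p) := by
  ext y
  constructor
  · rintro ⟨x, ⟨⟨hx1, hx2, hx3⟩, c, hc, rfl, hlim⟩, rfl⟩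
    have hcon := constraint_of_isSolution hc hx1
    have hcc : Continuous c := continuous_iff_continuousAt.2 fun t => (hc t).continuousAt
    have hred : ∀ t, HasDerivAt (fun t => toR4 (c t)) (reducedField (qStar γ) (toR4 (c t))) t := by
      refine fun t => hasDerivAt_of_coord fun i => ?_
      rw [reducedField_toR4 (hcon t)]
      have := hasDerivAt_coord (hc t) i.castSucc
      refine this.congr_of_eventuallyEq (Eventually.of_forall fun s => ?_)
      fin_cases i <;> simp [toR4]
    have hpos : 0 < c 0 4 := by
      refine lt_of_le_of_ne hx2 fun h0 => ?_
      have hdec : Continuous fun t => decel γ (c t) := by unfold decel; fun_prop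
      have hz : ∀ t, c t 4 = 0 := fun t => by
        have := eq_exp_mul_of_linear_ode (y := fun t => c t 4)
          (k := fun t => 2 * (decel γ (c t) - qStar γ)) (by fun_prop)
          (fun t => (hasDerivAt_coord (hc t) 4).congr_deriv (by simp [vectorField])) 0 t
        rw [this, ← h0, mul_zero]
      have h4 : Tendsto (fun t => c t 4) atBot (𝓝 (p 4)) :=
        ((EuclideanSpace.proj 4 : State →L[ℝ] ℝ).continuous.tendsto p).comp hlim
      simp only [hz] at h4
      exact hp.ne (tendsto_nhds_unique tendsto_const_nhds h4)
    have hreg : toR4 (c 0) ∈ region := ⟨by rwa [← hcon], by simpa [toR4] using hx3⟩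
    refine ⟨hreg, ?_⟩
    have h5 := (continuous_toR4.tendsto p).comp hlim
    refine h5.congr fun t => ?_
    have := eq_flow hred (t₀ := 0) hreg t
    simpa using this
  · rintro ⟨hy, hlim⟩
    refine ⟨lift y, ⟨⟨?_, ?_, ?_⟩, fun t => lift (flow (qStar γ) y t), fun t => ?_, ?_, ?_⟩,
      toR4_lift y⟩
    · simp [lift, density]; ring
    · simpa [lift] using hy.1.le
    · simpa [lift] using hy.2
    · have hd := hasDerivAt_flow (q := qStar γ) hy t
      refine hasDerivAt_of_coord fun i => ?_
      have hl : lift (flow (qStar γ) y t) 4 = density (toR4 (lift (flow (qStar γ) y t))) := by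
        rw [toR4_lift]; simp [lift]
      induction i using Fin.lastCases with
      | last =>
        have h1 := hasDerivAt_density (χ := 1) (by simpa using hd)
        refine (h1.congr_deriv ?_ : HasDerivAt (fun t => density (flow (qStar γ) y t)) _ t)
        have h : decel γ (lift (flow (qStar γ) y t)) = dec (qStar γ) (flow (qStar γ) y t) := by
          simp [decel, dec, lift]
        have h2 : vectorField γ (lift (flow (qStar γ) y t)) 4 =
          2 * (dec (qStar γ) (flow (qStar γ) y t) - qStar γ) * density (flow (qStar γ) y t) := by
          simp [vectorField, h]; left; simp [lift]
        rw [one_mul]; exact h2.symm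
      | cast i =>
        rw [← reducedField_toR4 hl, toR4_lift]
        refine (hasDerivAt_coord hd i).congr_of_eventuallyEq (Eventually.of_forall fun s => ?_)
        fin_cases i <;> simp [lift]
    · simp [flow_zero hy]
    · rw [← hp']
      exact (continuous_lift.tendsto _).comp hlim

end BianchiVI0

end

/-! ### The monotone function, and embeddedness of a single orbit -/

noncomputable section

namespace BianchiVI0

variable {q : ℝ} {x p : R4}

/-- The logarithm of the monotone function `(N₋² - N₊²)ᵐ Ω¹⁻ᵐ / (1 + q Σ₊ / 2)²`,
`m = q / (2 + q)`. -/
def lyap (q : ℝ) (x : R4) : ℝ :=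
  q / (2 + q) * Real.log (x 3 ^ 2 - x 2 ^ 2) + (1 - q / (2 + q)) * Real.log (density x)
    - 2 * Real.log (1 + q / 2 * x 0)

theorem sq_sub_sq_pos_of_mem_region (hx : x ∈ region) : 0 < x 3 ^ 2 - x 2 ^ 2 := by
  have := sq_lt_sq' (abs_lt.1 hx.2).1 (abs_lt.1 hx.2).2
  linarith

theorem neg_one_lt_of_mem_region (hx : x ∈ region) : -1 < x 0 := by
  have := hx.1
  unfold density at this
  nlinarith [sq_nonneg (x 1), sq_nonneg (x 3), sq_nonneg (x 0 - 1)]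

theorem lyap_denominator_pos (hq : 0 < q) (hq2 : q < 2) (hx : x ∈ region) :
    0 < 1 + q / 2 * x 0 := by
  nlinarith [neg_one_lt_of_mem_region hx]

theorem continuousAt_lyap (hq : 0 < q) (hq2 : q < 2) (hx : x ∈ region) :
    ContinuousAt (lyap q) x := by
  have h1 : ContinuousAt (fun x : R4 => Real.log (x 3 ^ 2 - x 2 ^ 2)) x :=
    ContinuousAt.log (by fun_prop) (sq_sub_sq_pos_of_mem_region hx).ne'
  have h2 : ContinuousAt (fun x : R4 => Real.log (density x)) x :=
    continuous_density.continuousAt.log hx.1.ne'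
  have h3 : ContinuousAt (fun x : R4 => Real.log (1 + q / 2 * x 0)) x :=
    ContinuousAt.log (by fun_prop) (lyap_denominator_pos hq hq2 hx).ne'
  exact ((h1.const_mul _).add (h2.const_mul _)).sub (h3.const_mul _)

/-- With this exponent and denominator the derivative collects into a nonnegative sum of squares,
zero only where Σ₋ = 0 and Σ₊ = -q/2. -/
theorem hasDerivAt_lyap (hq : 0 < q) (hq2 : q < 2) {c : ℝ → R4} {t : ℝ} (hx : c t ∈ region)
    (hc : HasDerivAt c (reducedField q (c t)) t) :
    HasDerivAt (fun t => lyap q (c t)) (2 * ((2 - q) * c t 1 ^ 2 +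
      4 / (2 + q) * (c t 0 + q / 2) ^ 2) / (1 + q / 2 * c t 0)) t := by
  have hd := hasDerivAt_density (χ := 1) (by simpa using hc)
  have h1 := sq_sub_sq_pos_of_mem_region hx
  have h3 := lyap_denominator_pos hq hq2 hx
  have h2 := hx.1
  have hs : HasDerivAt (fun t => c t 3 ^ 2 - c t 2 ^ 2)
      (2 * (dec q (c t) + 2 * c t 0) * (c t 3 ^ 2 - c t 2 ^ 2)) t := by
    refine (((hasDerivAt_coord hc 3).pow 2).sub ((hasDerivAt_coord hc 2).pow 2)).congr_deriv ?_
    rw [reducedField_two, reducedField_three]; push_cast; ring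
  have hdd := ((hs.log h1.ne').const_mul (q / (2 + q))).add
    ((hd.log h2.ne').const_mul (1 - q / (2 + q)))
  have hdd' := hdd.sub (((((hasDerivAt_coord hc 0).const_mul (q / 2)).const_add 1).log
    h3.ne').const_mul 2)
  refine hdd'.congr_deriv ?_
  rw [mul_div_assoc, mul_div_assoc, mul_div_assoc, div_self h1.ne', div_self h2.ne',
    reducedField_zero]
  have h4 : 2 + q ≠ 0 := by positivity
  have h5 : 2 + q * c t 0 ≠ 0 := by linarith
  field_simp
  simp only [dec, density]
  ring

theorem flow_eq_const (hx : x ∈ region) {t₀ : ℝ} (h : reducedField q (flow q x t₀) = 0) (t : ℝ) :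
    flow q x t = flow q x t₀ := by
  have h1 := eq_flow (q := q) (c := fun _ => flow q x t₀)
    (fun t => by rw [h]; exact hasDerivAt_const _ _) (t₀ := t₀) (flow_mem hx t₀) t
  rw [h1, flow_flow hx]; simp

/-- Otherwise the orbit would be constant and its limit p would lie in the region. -/
theorem reducedField_ne_zero_of_mem_unstable (hp : p ∉ region) (hx : x ∈ unstable q p) (t : ℝ) :
    reducedField q (flow q x t) ≠ 0 := by
  intro h
  have h1 := hx.2
  rw [funext (flow_eq_const hx.1 h)] at h1
  exact hp (tendsto_nhds_unique tendsto_const_nhds h1 ▸ flow_mem hx.1 t)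

-- LaSalle's argument: constancy on an interval forces Σ₋ = 0 and Σ₊ = -q/2 there, the equations for
-- Σ₋ and Σ₊ then give N₊ = 0 and N₋² = q(2 - q)/4, and this point is an equilibrium.
open Set in
theorem strictMono_lyap (hq : 0 < q) (hq2 : q < 2) (hp : p ∉ region) (hx : x ∈ unstable q p) :
    StrictMono fun t => lyap q (flow q x t) := by
  have hd := fun t => hasDerivAt_lyap hq hq2 (flow_mem (q := q) hx.1 t) (hasDerivAt_flow hx.1 t)
  have hden := fun t => lyap_denominator_pos hq hq2 (flow_mem (q := q) hx.1 t)
  have hP : 0 < 2 - q := by linarith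
  have hmono : Monotone fun t => lyap q (flow q x t) :=
    monotone_of_deriv_nonneg (fun t => (hd t).differentiableAt) fun t => by
      rw [(hd t).deriv]
      have := hden t
      positivity
  refine hmono.strictMono_of_injective ?_
  have main : ∀ t₁ t₂, t₁ < t₂ → lyap q (flow q x t₁) ≠ lyap q (flow q x t₂) := by
    intro t₁ t₂ h12 heq
    have hconst : ∀ t ∈ Ioo t₁ t₂, flow q x t 1 = 0 ∧ flow q x t 0 = -(q / 2) := by
      intro t ht
      have h1 : (fun t => lyap q (flow q x t)) =ᶠ[𝓝 t] fun _ => lyap q (flow q x t₁) := by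
        filter_upwards [Ioo_mem_nhds ht.1 ht.2] with s hs
        exact le_antisymm ((hmono hs.2.le).trans heq.ge) (hmono hs.1.le)
      have h2 := ((hd t).congr_of_eventuallyEq h1.symm).unique (hasDerivAt_const _ _)
      have h3 : (2 - q) * flow q x t 1 ^ 2 + 4 / (2 + q) * (flow q x t 0 + q / 2) ^ 2 = 0 := by
        rcases div_eq_zero_iff.1 h2 with h | h
        · linarith
        · exact absurd h (hden t).ne'
      have h4 : 0 ≤ (2 - q) * flow q x t 1 ^ 2 := by positivity
      have h5 : 0 ≤ 4 / (2 + q) * (flow q x t 0 + q / 2) ^ 2 := by positivity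
      have h6 : (2 - q) * flow q x t 1 ^ 2 = 0 := by linarith
      have h7 : 4 / (2 + q) * (flow q x t 0 + q / 2) ^ 2 = 0 := by linarith
      have h8 : 4 / (2 + q) ≠ 0 := by positivity
      refine ⟨by simpa [hP.ne'] using h6, ?_⟩
      have := pow_eq_zero_iff (two_ne_zero) |>.1 ((mul_eq_zero.1 h7).resolve_left h8)
      linarith
    set t := (t₁ + t₂) / 2
    have ht : t ∈ Ioo t₁ t₂ := ⟨by simp only [t]; linarith, by simp only [t]; linarith⟩
    have hz0 : reducedField q (flow q x t) 0 = 0 := by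
      refine ((hasDerivAt_coord (hasDerivAt_flow hx.1 t) 0).congr_of_eventuallyEq ?_).unique
        (hasDerivAt_const t (-(q / 2)))
      filter_upwards [Ioo_mem_nhds ht.1 ht.2] with s hs using (hconst s hs).2.symm
    have hz1 : reducedField q (flow q x t) 1 = 0 := by
      refine ((hasDerivAt_coord (hasDerivAt_flow hx.1 t) 1).congr_of_eventuallyEq ?_).unique
        (hasDerivAt_const t 0)
      filter_upwards [Ioo_mem_nhds ht.1 ht.2] with s hs using (hconst s hs).1.symm
    obtain ⟨e1, e0⟩ := hconst t ht
    have h3 : 0 < flow q x t 3 := (abs_nonneg _).trans_lt (flow_mem hx.1 t).2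
    have e2 : flow q x t 2 = 0 := by
      rw [reducedField_one, e1] at hz1
      have : √3 ≠ 0 := by positivity
      simpa [this, h3.ne'] using hz1
    have e3 : flow q x t 3 ^ 2 = q * (2 - q) / 4 := by
      rw [reducedField_zero, dec, density, e1, e0] at hz0
      have : (4 - q ^ 2) * (flow q x t 3 ^ 2 - q * (2 - q) / 4) = 0 := by
        linear_combination (-2) * hz0
      have h4 : 4 - q ^ 2 ≠ 0 := by nlinarith
      have := (mul_eq_zero.1 this).resolve_left h4
      linarith
    refine reducedField_ne_zero_of_mem_unstable hp hx t ?_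
    ext i
    fin_cases i
    · exact hz0
    · exact hz1
    · exact (reducedField_two _ _).trans (by simp [e1, e2])
    · refine (reducedField_three _ _).trans ?_
      rw [dec, density, e1, e2, e0, e3]
      simp
      left; ring
  intro t₁ t₂ h
  rcases lt_trichotomy t₁ t₂ with h12 | h12 | h12
  · exact absurd h (main _ _ h12)
  · exact h12
  · exact absurd h.symm (main _ _ h12)

/-- The orbit does not return near x: at times of modulus at least η the monotone function stays a
fixed distance from its value at x. -/
theorem eventually_time_lt (hq : 0 < q) (hq2 : q < 2) (hp : p ∉ region) (hx : x ∈ unstable q p)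
    {η : ℝ} (hη : 0 < η) : ∀ᶠ y in 𝓝 x, ∀ t, y = flow q x t → |t| < η := by
  have hmono := strictMono_lyap hq hq2 hp hx
  have h1 : lyap q x < lyap q (flow q x η) := by
    have := hmono hη
    simpa [flow_zero hx.1] using this
  have h2 : lyap q (flow q x (-η)) < lyap q x := by
    have := hmono (neg_lt_zero.2 hη)
    simpa [flow_zero hx.1] using this
  have hc := continuousAt_lyap hq hq2 hx.1
  filter_upwards [hc.eventually_lt_const h1, hc.eventually_const_lt h2] with y hy1 hy2 t ht
  rw [ht] at hy1 hy2
  exact abs_lt.2 ⟨hmono.lt_iff_lt.1 hy2, hmono.lt_iff_lt.1 hy1⟩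

/-- An unstable set which consists of a single orbit is an embedded curve. -/
theorem isEmbeddedSubmanifold_one_of_single_orbit (hq : 0 < q) (hq2 : q < 2) (hp : p ∉ region)
    (h : ∀ x ∈ unstable q p, ∀ y ∈ unstable q p, ∃ t, y = flow q x t) :
    IsEmbeddedSubmanifold 1 (unstable q p) := by
  refine ⟨by norm_num, fun x hx => ?_⟩
  set v := reducedField q x
  have hv : v ≠ 0 := by
    simpa [flow_zero hx.1] using reducedField_ne_zero_of_mem_unstable hp hx 0
  set e₀ : R4 := EuclideanSpace.single 0 1
  have he₀ : e₀ ≠ 0 := by simp [e₀]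
  obtain ⟨L, hL⟩ := SeparatingDual.exists_continuousLinearEquiv_apply_eq (R := ℝ) he₀ hv
  -- The first axis parametrises the orbit by time. Since L sends e₀ to the velocity v, the
  -- derivative at 0 is L itself.
  set Θ : R4 → R4 := fun z => flow q x (z 0) + L (z - z 0 • e₀)
  have hpr : ContDiff ℝ ω (fun z : R4 => z 0) := by fun_prop
  have hΘ0 : Θ 0 = x := by simp [Θ, flow_zero hx.1]
  have hsm : ContDiffAt ℝ ω Θ 0 := by
    refine ContDiffAt.add ?_ ?_
    · exact ContDiffAt.comp (0 : R4) (contDiffAt_flow_time hx.1 _) hpr.contDiffAt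
    · exact L.contDiff.contDiffAt.comp _ (by fun_prop)
  have hd : HasFDerivAt Θ (L : R4 →L[ℝ] R4) 0 := by
    have hp0 : HasFDerivAt (fun z : R4 => z 0) (EuclideanSpace.proj 0 : R4 →L[ℝ] ℝ) 0 :=
      (EuclideanSpace.proj 0 : R4 →L[ℝ] ℝ).hasFDerivAt
    have hfl : HasDerivAt (flow q x) v ((0 : R4) 0) := by
      have := hasDerivAt_flow (q := q) hx.1 0
      rwa [flow_zero hx.1] at this
    have h1 := hfl.hasFDerivAt.comp (0 : R4) hp0
    have h2 := (L : R4 →L[ℝ] R4).hasFDerivAt.comp (0 : R4)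
      ((hasFDerivAt_id (0 : R4)).sub (hp0.smul_const e₀))
    refine (h1.add h2).congr_fderiv ?_
    ext1 z
    simp [hL]
  have hinj : Function.Injective (L : R4 →L[ℝ] R4) := L.injective
  have hS : ∀ᶠ z in 𝓝 (0 : R4), Θ z ∈ unstable q p ↔ ∀ i : Fin 4, 1 ≤ (i : ℕ) → z i = 0 := by
    have hstrict : HasStrictFDerivAt Θ (L : R4 →L[ℝ] R4) 0 :=
      hsm.hasStrictFDerivAt' hd (by simp)
    set ψ := hstrict.toOpenPartialHomeomorph Θ
    have hV : ψ.source ∈ 𝓝 (0 : R4) :=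
      ψ.open_source.mem_nhds hstrict.mem_toOpenPartialHomeomorph_source
    have hc : Continuous fun s : ℝ => s • e₀ := by fun_prop
    have hV' : ∀ᶠ s : ℝ in 𝓝 0, s • e₀ ∈ ψ.source := by
      refine hc.continuousAt.eventually ?_
      simpa using hV
    obtain ⟨η, hη, hηV⟩ := Metric.eventually_nhds_iff.1 hV'
    -- Local injectivity of Θ says nothing about a later passage of the same orbit; this is what
    -- excludes one.
    have hnear : ∀ᶠ z in 𝓝 (0 : R4), ∀ t, Θ z = flow q x t → |t| < η := by
      refine hsm.continuousAt.eventually (p := fun y => ∀ t, y = flow q x t → |t| < η) ?_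
      rw [hΘ0]
      exact eventually_time_lt hq hq2 hp hx hη
    have hse : ∀ s : ℝ, Θ (s • e₀) = flow q x s := by
      intro s
      simp [Θ, e₀]
    filter_upwards [hV, hnear] with z hz hzn
    constructor
    · intro hzS i hi
      obtain ⟨s, hs⟩ := h x hx _ hzS
      have h1 : |s| < η := hzn s hs
      have h2 : s • e₀ ∈ ψ.source := hηV (by simpa using h1)
      have h3 : z = s • e₀ := ψ.injOn hz h2 (show Θ z = Θ (s • e₀) by rw [hse, hs])
      have h4 : i ≠ 0 := fun h => by simp [h] at hi
      simp [h3, e₀, h4]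
    · intro hz0
      have h1 : z = z 0 • e₀ := by
        ext i
        by_cases hi : i = 0
        · subst hi; simp [e₀]
        · have := hz0 i (Nat.one_le_iff_ne_zero.2 fun h => hi (Fin.ext h))
          simp [this, e₀, hi]
      rw [h1, hse]
      exact flow_mem_unstable hx _
  obtain ⟨φ, h1, h2⟩ := exists_slice_chart hsm hd hinj hS
  exact ⟨φ, hΘ0 ▸ h1, h2⟩

end BianchiVI0

end

/-! ### Linearisation, and coordinates adapted to the type II boundary -/

noncomputable section

namespace BianchiVI0

variable {q : ℝ} {x p : R4}

/-- The derivative of `dec q` at `x` in direction `v`. -/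
def decDeriv (q : ℝ) (x v : R4) : ℝ :=
  q * (-2 * x 0 * v 0 - 2 * x 1 * v 1 - 2 * x 3 * v 3) + 4 * x 0 * v 0 + 4 * x 1 * v 1

theorem hasStrictFDerivAt_reducedField (q : ℝ) (x : R4) :
    HasStrictFDerivAt (reducedField q) (fderiv ℝ (reducedField q) x) x :=
  (contDiff_reducedField q (n := 1)).contDiffAt.hasStrictFDerivAt (by simp)

theorem fderiv_reducedField_eq_of_hasDerivAt {i : Fin 4} {v : R4} {d : ℝ}
    (h : HasDerivAt (fun t : ℝ => reducedField q (x + t • v) i) d 0) :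
    fderiv ℝ (reducedField q) x v i = d := by
  have h1 : HasDerivAt (fun t : ℝ => x + t • v) v 0 := by
    simpa using ((hasDerivAt_id (0 : ℝ)).smul_const v).const_add x
  have h2 : HasDerivAt (fun t : ℝ => reducedField q (x + t • v)) (fderiv ℝ (reducedField q) x v) 0 :=
    HasFDerivAt.comp_hasDerivAt (0 : ℝ) (f := fun t : ℝ => x + t • v) (l := reducedField q)
      (by simpa using (hasStrictFDerivAt_reducedField q x).hasFDerivAt) h1
  exact (hasDerivAt_coord h2 i).unique h

theorem hasDerivAt_line (x v : R4) (i : Fin 4) :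
    HasDerivAt (fun t : ℝ => (x + t • v) i) (v i) 0 := by
  have h1 : HasDerivAt (fun t : ℝ => x + t • v) v 0 := by
    simpa using ((hasDerivAt_id (0 : ℝ)).smul_const v).const_add x
  exact hasDerivAt_coord h1 i

theorem hasDerivAt_dec_line (q : ℝ) (x v : R4) :
    HasDerivAt (fun t : ℝ => dec q (x + t • v)) (decDeriv q x v) 0 := by
  have h := hasDerivAt_line x v
  unfold dec density
  refine ((((((h 0).fun_pow 2).const_sub 1).fun_sub ((h 1).fun_pow 2)).fun_sub
    ((h 3).fun_pow 2)).const_mul q |>.fun_add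
    ((((h 0).fun_pow 2).fun_add ((h 1).fun_pow 2)).const_mul 2)).congr_deriv ?_
  simp [decDeriv]; ring

theorem fderiv_reducedField_zero (q : ℝ) (x v : R4) : fderiv ℝ (reducedField q) x v 0 =
    -(2 - dec q x) * v 0 + decDeriv q x v * x 0 - 4 * x 3 * v 3 := by
  have h := hasDerivAt_line x v
  apply fderiv_reducedField_eq_of_hasDerivAt
  simp only [reducedField_zero]
  refine (((((hasDerivAt_dec_line q x v).const_sub 2).fun_neg).fun_mul (h 0)).fun_sub
    (((h 3).fun_pow 2).const_mul 2)).congr_deriv ?_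
  simp; ring

theorem fderiv_reducedField_one (q : ℝ) (x v : R4) : fderiv ℝ (reducedField q) x v 1 =
    -(2 - dec q x) * v 1 + decDeriv q x v * x 1 - 2 * √3 * (v 2 * x 3 + x 2 * v 3) := by
  have h := hasDerivAt_line x v
  apply fderiv_reducedField_eq_of_hasDerivAt
  simp only [reducedField_one]
  refine (((((hasDerivAt_dec_line q x v).const_sub 2).fun_neg).fun_mul (h 1)).fun_sub
    (((h 2).const_mul (2 * √3)).fun_mul (h 3))).congr_deriv ?_
  simp; ring

theorem fderiv_reducedField_two (q : ℝ) (x v : R4) : fderiv ℝ (reducedField q) x v 2 =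
    (decDeriv q x v + 2 * v 0) * x 2 + (dec q x + 2 * x 0) * v 2
      + 2 * √3 * (v 1 * x 3 + x 1 * v 3) := by
  have h := hasDerivAt_line x v
  apply fderiv_reducedField_eq_of_hasDerivAt
  simp only [reducedField_two]
  refine ((((hasDerivAt_dec_line q x v).fun_add ((h 0).const_mul 2)).fun_mul (h 2)).fun_add
    (((h 1).const_mul (2 * √3)).fun_mul (h 3))).congr_deriv ?_
  simp; ring

theorem fderiv_reducedField_three (q : ℝ) (x v : R4) : fderiv ℝ (reducedField q) x v 3 =
    (decDeriv q x v + 2 * v 0) * x 3 + (dec q x + 2 * x 0) * v 3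
      + 2 * √3 * (v 1 * x 2 + x 1 * v 2) := by
  have h := hasDerivAt_line x v
  apply fderiv_reducedField_eq_of_hasDerivAt
  simp only [reducedField_three]
  refine ((((hasDerivAt_dec_line q x v).fun_add ((h 0).const_mul 2)).fun_mul (h 3)).fun_add
    (((h 1).const_mul (2 * √3)).fun_mul (h 2))).congr_deriv ?_
  simp; ring

/-- A diagonal quadratic form in terms of linear functionals. -/
def diagForm (k : Fin 4 → ℝ) (ℓ : Fin 4 → R4 →L[ℝ] ℝ) : R4 →L[ℝ] R4 →L[ℝ] ℝ :=
  ∑ i, (ℓ i).smulRight (k i • ℓ i)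

theorem diagForm_apply (k : Fin 4 → ℝ) (ℓ : Fin 4 → R4 →L[ℝ] ℝ) (u v : R4) :
    diagForm k ℓ u v = k 0 * ℓ 0 u * ℓ 0 v + k 1 * ℓ 1 u * ℓ 1 v + k 2 * ℓ 2 u * ℓ 2 v
      + k 3 * ℓ 3 u * ℓ 3 v := by
  simp [diagForm, Fin.sum_univ_four]; ring

theorem diagForm_comm (k : Fin 4 → ℝ) (ℓ : Fin 4 → R4 →L[ℝ] ℝ) (u v : R4) :
    diagForm k ℓ u v = diagForm k ℓ v u := by
  rw [diagForm_apply, diagForm_apply]; ring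

/-- The coordinates `S`, `W`, `(N₋ + N₊) / 2`, `(N₋ - N₊) / 2` adapted to the type II boundary. -/
def typeIICoord : Fin 4 → R4 →L[ℝ] ℝ :=
  let π (i : Fin 4) : R4 →L[ℝ] ℝ := EuclideanSpace.proj i
  ![(1 / 2 : ℝ) • π 0 + (√3 / 2) • π 1, (1 / 2 : ℝ) • π 1 - (√3 / 2) • π 0,
    (1 / 2 : ℝ) • π 3 + (1 / 2 : ℝ) • π 2, (1 / 2 : ℝ) • π 3 - (1 / 2 : ℝ) • π 2]

theorem typeIICoord_zero (v : R4) : typeIICoord 0 v = v 0 / 2 + √3 / 2 * v 1 := by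
  simp [typeIICoord]; ring

theorem typeIICoord_one (v : R4) : typeIICoord 1 v = v 1 / 2 - √3 / 2 * v 0 := by
  simp [typeIICoord]; ring

theorem typeIICoord_two (v : R4) : typeIICoord 2 v = (v 3 + v 2) / 2 := by
  simp [typeIICoord]; ring

theorem typeIICoord_three (v : R4) : typeIICoord 3 v = (v 3 - v 2) / 2 := by
  simp [typeIICoord]; ring

theorem norm_sq_eq_typeII (v : R4) : ‖v‖ ^ 2 = typeIICoord 0 v ^ 2 + typeIICoord 1 v ^ 2
    + 2 * typeIICoord 2 v ^ 2 + 2 * typeIICoord 3 v ^ 2 := by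
  have h3 : √3 ^ 2 = 3 := Real.sq_sqrt (by norm_num)
  rw [norm_sq_eq, typeIICoord_zero, typeIICoord_one, typeIICoord_two, typeIICoord_three]
  linear_combination (-(v 1 ^ 2 / 4) - v 0 ^ 2 / 4) * h3

/-- The equilibrium `P₂⁺(II)` in `ℝ⁴`. -/
def reducedP2 (q : ℝ) : R4 :=
  !₂[-(q / 8), -(√3 * q / 8), √(q * (2 - q)) / 4, √(q * (2 - q)) / 4]

theorem dec_reducedP2 (hq : 0 < q) (hq2 : q < 2) : dec q (reducedP2 q) = q := by
  have h3 : √3 ^ 2 = 3 := Real.sq_sqrt (by norm_num)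
  have hν : √(q * (2 - q)) ^ 2 = q * (2 - q) := Real.sq_sqrt (by nlinarith)
  simp only [dec, density, reducedP2, Matrix.cons_val]
  linear_combination (2 - q) * q ^ 2 / 64 * h3 - q / 16 * hν

theorem density_reducedP2 (hq : 0 < q) (hq2 : q < 2) : density (reducedP2 q) = 1 - q / 8 := by
  have h3 : √3 ^ 2 = 3 := Real.sq_sqrt (by norm_num)
  have hν : √(q * (2 - q)) ^ 2 = q * (2 - q) := Real.sq_sqrt (by nlinarith)
  simp only [density, reducedP2, Matrix.cons_val]
  linear_combination (- q ^ 2 / 64) * h3 - 1 / 16 * hν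

theorem reducedField_reducedP2 (hq : 0 < q) (hq2 : q < 2) : reducedField q (reducedP2 q) = 0 := by
  have h3 : √3 ^ 2 = 3 := Real.sq_sqrt (by norm_num)
  have hν : √(q * (2 - q)) ^ 2 = q * (2 - q) := Real.sq_sqrt (by nlinarith)
  have hd := dec_reducedP2 hq hq2
  ext i
  fin_cases i
  · refine (reducedField_zero _ _).trans ?_
    rw [hd]; simp only [reducedP2, Matrix.cons_val]
    simp only [PiLp.zero_apply]
    linear_combination (-1 / 8) * hν
  · refine (reducedField_one _ _).trans ?_
    rw [hd]; simp only [reducedP2, Matrix.cons_val]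
    simp only [PiLp.zero_apply]
    linear_combination (-√3 / 8) * hν
  · refine (reducedField_two _ _).trans ?_
    rw [hd]; simp only [reducedP2, Matrix.cons_val]
    simp only [PiLp.zero_apply]
    linear_combination (-q * √(q * (2 - q)) / 16) * h3
  · refine (reducedField_three _ _).trans ?_
    rw [hd]; simp only [reducedP2, Matrix.cons_val]
    simp only [PiLp.zero_apply]
    linear_combination (-q * √(q * (2 - q)) / 16) * h3

/-- The linearisation is block triangular: the transverse coordinate evolves alone with rate 3q/2
and feeds into the three others, which are damped. The coupling between coordinates 0 and 2 has
opposite signs. -/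
theorem typeIICoord_fderiv (hq : 0 < q) (hq2 : q < 2) (v : R4) : let ν := √(q * (2 - q)) / 4
    typeIICoord 0 (fderiv ℝ (reducedField q) (reducedP2 q) v) =
      (-(2 - q) + (2 - q) * q ^ 2 / 8) * typeIICoord 0 v + (q ^ 2 / 2 - 8) * ν * typeIICoord 2 v
        + (q ^ 2 / 2 - 2) * ν * typeIICoord 3 v ∧
    typeIICoord 1 (fderiv ℝ (reducedField q) (reducedP2 q) v) =
      -(2 - q) * typeIICoord 1 v + 2 * √3 * ν * typeIICoord 3 v ∧
    typeIICoord 2 (fderiv ℝ (reducedField q) (reducedP2 q) v) =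
      ν * ((4 - (2 - q) * q / 2) * typeIICoord 0 v - 2 * q * ν * typeIICoord 2 v
        - 2 * q * ν * typeIICoord 3 v) ∧
    typeIICoord 3 (fderiv ℝ (reducedField q) (reducedP2 q) v) = 3 * q / 2 * typeIICoord 3 v := by
  have h3 : √3 ^ 2 = 3 := Real.sq_sqrt (by norm_num)
  intro ν
  have hν : ν ^ 2 = q * (2 - q) / 16 := by
    simp only [ν, div_pow]; rw [Real.sq_sqrt (by nlinarith)]; norm_num
  have hd := dec_reducedP2 hq hq2
  have e0 : reducedP2 q 0 = -(q / 8) := rfl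
  have e1 : reducedP2 q 1 = -(√3 * q / 8) := rfl
  have e2 : reducedP2 q 2 = ν := rfl
  have e3 : reducedP2 q 3 = ν := rfl
  simp only [typeIICoord_zero, typeIICoord_one, typeIICoord_two, typeIICoord_three,
    fderiv_reducedField_zero, fderiv_reducedField_one, fderiv_reducedField_two,
    fderiv_reducedField_three, hd, decDeriv, e0, e1, e2, e3]
  clear_value ν
  refine ⟨?_, ?_, ?_, ?_⟩ <;> grind

end BianchiVI0

end

/-! ### Uniqueness of the orbit emanating from P₂ -/

noncomputable section

namespace BianchiVI0

variable {q : ℝ} {x p : R4}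

theorem mul_le_add_sq_div {A : ℝ} (hA : 0 < A) (C b s : ℝ) :
    b * (C * s) ≤ A / 2 * s ^ 2 + C ^ 2 / (2 * A) * b ^ 2 := by
  have : A / 2 * s ^ 2 + C ^ 2 / (2 * A) * b ^ 2 - b * (C * s) = (A * s - C * b) ^ 2 / (2 * A) := by
    field_simp; ring
  have h2 : 0 ≤ (A * s - C * b) ^ 2 / (2 * A) := by positivity
  linarith

/-- A stable diagonal block dominates its coupling to an unstable direction of large weight. -/
theorem exists_weight {A₁ A₂ A₃ D : ℝ} (h₁ : 0 < A₁) (h₂ : 0 < A₂) (h₃ : 0 < A₃) (hD : 0 < D)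
    (C₁ C₂ C₃ : ℝ) : ∃ M > 0, ∃ c > 0, ∀ s w a b : ℝ,
      -A₁ * s ^ 2 - A₂ * w ^ 2 - A₃ * a ^ 2 - M * D * b ^ 2 + b * (C₁ * s) + b * (C₂ * w)
        + b * (C₃ * a) ≤ -c * (s ^ 2 + w ^ 2 + 2 * a ^ 2 + 2 * b ^ 2) := by
  set K := C₁ ^ 2 / (2 * A₁) + C₂ ^ 2 / (2 * A₂) + C₃ ^ 2 / (2 * A₃)
  have hK : 0 ≤ K := by positivity
  -- Each cross term costs half of its stable square plus a share of K b². The extra 2 pays for -2c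
  -- b² with c ≤ 1, and A₃ is divided by 4 because a² counts twice.
  refine ⟨(K + 2) / D, by positivity, min (min (A₁ / 2) (A₂ / 2)) (min (A₃ / 4) 1),
    by positivity, fun s w a b => ?_⟩
  set c := min (min (A₁ / 2) (A₂ / 2)) (min (A₃ / 4) 1)
  have c1 : c ≤ A₁ / 2 := (min_le_left _ _).trans (min_le_left _ _)
  have c2 : c ≤ A₂ / 2 := (min_le_left _ _).trans (min_le_right _ _)
  have c3 : c ≤ A₃ / 4 := (min_le_right _ _).trans (min_le_left _ _)
  have c4 : c ≤ 1 := (min_le_right _ _).trans (min_le_right _ _)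
  have e : (K + 2) / D * D = K + 2 := by field_simp
  rw [e]
  have m1 := mul_le_add_sq_div h₁ C₁ b s
  have m2 := mul_le_add_sq_div h₂ C₂ b w
  have m3 := mul_le_add_sq_div h₃ C₃ b a
  have n1 := mul_le_mul_of_nonneg_right c1 (sq_nonneg s)
  have n2 := mul_le_mul_of_nonneg_right c2 (sq_nonneg w)
  have n3 := mul_le_mul_of_nonneg_right c3 (sq_nonneg a)
  have n4 := mul_le_mul_of_nonneg_right c4 (sq_nonneg b)
  have e2 : K * b ^ 2 = C₁ ^ 2 / (2 * A₁) * b ^ 2 + C₂ ^ 2 / (2 * A₂) * b ^ 2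
      + C₃ ^ 2 / (2 * A₃) * b ^ 2 := by simp only [K]; ring
  nlinarith

/-- The weights of the quadratic form adapted to `P₂⁺(II)`. -/
def weightsP2 (q M : ℝ) : Fin 4 → ℝ := ![4 - (2 - q) * q / 2, 1, 8 - q ^ 2 / 2, -M]

theorem weightsP2_pos (hq : 0 < q) (hq2 : q < 2) :
    0 < 4 - (2 - q) * q / 2 ∧ 0 < 8 - q ^ 2 / 2 := by constructor <;> nlinarith

/-- The positive weights make the cross terms between coordinates 0 and 2 cancel; a large M absorbs
the coupling to the unstable coordinate. -/
theorem exists_dissipative_reducedP2 (hq : 0 < q) (hq2 : q < 2) : ∃ M > 0, ∃ ρ > 0,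
    ∀ x ∈ Metric.ball (reducedP2 q) ρ, ∀ y ∈ Metric.ball (reducedP2 q) ρ,
      diagForm (weightsP2 q M) typeIICoord (x - y) (reducedField q x - reducedField q y) ≤ 0 := by
  obtain ⟨k1, k2⟩ := weightsP2_pos hq hq2
  have hP : 0 < 2 - q := by linarith
  set ν := √(q * (2 - q)) / 4 with hνdef
  have hν : 0 < ν := by positivity
  obtain ⟨M, hM, c, hc, h⟩ := exists_weight
    (A₁ := (4 - (2 - q) * q / 2) * ((2 - q) * (1 - q ^ 2 / 8))) (A₂ := 2 - q)
    (A₃ := (8 - q ^ 2 / 2) * (2 * q * ν ^ 2)) (D := 3 * q / 2)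
    (mul_pos k1 (mul_pos hP (by nlinarith))) hP (by positivity) (by positivity)
    ((4 - (2 - q) * q / 2) * ((q ^ 2 / 2 - 2) * ν)) (2 * √3 * ν)
    (-((8 - q ^ 2 / 2) * (2 * q * ν ^ 2)))
  refine ⟨M, hM, exists_ball_dissipative (hasStrictFDerivAt_reducedField q _) _ hc fun v => ?_⟩
  obtain ⟨e0, e1, e2, e3⟩ := typeIICoord_fderiv hq hq2 v
  rw [diagForm_apply, e0, e1, e2, e3, norm_sq_eq_typeII]
  refine le_of_eq_of_le ?_ (h (typeIICoord 0 v) (typeIICoord 1 v) (typeIICoord 2 v)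
    (typeIICoord 3 v))
  simp only [weightsP2, Matrix.cons_val, ← hνdef]
  ring

theorem norm_le_of_diagForm_nonpos (hq : 0 < q) (hq2 : q < 2) {M : ℝ} (hM : 0 < M) :
    ∃ C > 0, ∀ v : R4, diagForm (weightsP2 q M) typeIICoord v v ≤ 0 →
      ‖v‖ ≤ C * |typeIICoord 3 v| := by
  obtain ⟨k1, k2⟩ := weightsP2_pos hq hq2
  refine ⟨√(M / (4 - (2 - q) * q / 2) + M + 2 * (M / (8 - q ^ 2 / 2)) + 2), by positivity,
    fun v hv => ?_⟩
  rw [diagForm_apply] at hv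
  simp only [weightsP2, Matrix.cons_val] at hv
  set s := typeIICoord 0 v
  set w := typeIICoord 1 v
  set a := typeIICoord 2 v
  set b := typeIICoord 3 v
  have h0 : 0 ≤ (4 - (2 - q) * q / 2) * s ^ 2 := by positivity
  have h1 : 0 ≤ (8 - q ^ 2 / 2) * a ^ 2 := by positivity
  have h2 := sq_nonneg w
  have m1 : s ^ 2 ≤ M / (4 - (2 - q) * q / 2) * b ^ 2 := by
    rw [div_mul_eq_mul_div, le_div_iff₀ k1]; nlinarith
  have m2 : a ^ 2 ≤ M / (8 - q ^ 2 / 2) * b ^ 2 := by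
    rw [div_mul_eq_mul_div, le_div_iff₀ k2]; nlinarith
  refine abs_le_of_sq_le_sq' ?_ (by positivity) |>.2
  rw [mul_pow, Real.sq_sqrt (by positivity), sq_abs, norm_sq_eq_typeII]
  nlinarith

theorem reducedP2_notMem_region (q : ℝ) : reducedP2 q ∉ region := by
  intro h
  have := h.2
  simp only [reducedP2, Matrix.cons_val] at this
  exact absurd ((le_abs_self _).trans_lt this) (lt_irrefl _)

theorem typeIICoord_three_reducedP2 (q : ℝ) : typeIICoord 3 (reducedP2 q) = 0 := by
  rw [typeIICoord_three]; simp [reducedP2]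

theorem typeIICoord_three_pos (hx : x ∈ region) : 0 < typeIICoord 3 x := by
  rw [typeIICoord_three]; linarith [(abs_lt.1 hx.2).2]

open Set in
theorem exists_time_eq {c : ℝ → ℝ} (hc : Continuous c) (h0 : Tendsto c atBot (𝓝 0)) {T β : ℝ}
    (hβ : 0 < β) (hT : β ≤ c T) : ∃ t ≤ T, c t = β := by
  obtain ⟨s, hs, hsT⟩ := ((h0.eventually_lt_const hβ).and (eventually_le_atBot T)).exists
  obtain ⟨t, ht, rfl⟩ := intermediate_value_Icc hsT hc.continuousOn ⟨hs.le, hT⟩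
  exact ⟨t, ht.2, rfl⟩

/-- The unstable set of `P₂⁺(II)` consists of at most one orbit. -/
theorem unstable_reducedP2_single_orbit (hq : 0 < q) (hq2 : q < 2) :
    ∀ x ∈ unstable q (reducedP2 q), ∀ y ∈ unstable q (reducedP2 q), ∃ t, y = flow q x t := by
  intro x hx y hy
  obtain ⟨M, hM, ρ, hρ, hB⟩ := exists_dissipative_reducedP2 hq hq2
  have hball := Metric.ball_mem_nhds (reducedP2 q) hρ
  obtain ⟨T, hT⟩ := eventually_atBot.1 ((hx.2.eventually hball).and (hy.2.eventually hball))
  have hlim : ∀ z ∈ unstable q (reducedP2 q),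
      Tendsto (fun t => typeIICoord 3 (flow q z t)) atBot (𝓝 0) := by
    intro z hz
    have := ((typeIICoord 3).continuous.tendsto _).comp hz.2
    rwa [typeIICoord_three_reducedP2] at this
  have hcont : ∀ z ∈ unstable q (reducedP2 q),
      Continuous (fun t => typeIICoord 3 (flow q z t)) := fun z hz =>
    (typeIICoord 3).continuous.comp (continuous_flow hz.1)
  have hpos : ∀ z ∈ unstable q (reducedP2 q), 0 < typeIICoord 3 (flow q z T) := fun z hz =>
    typeIICoord_three_pos (flow_mem hz.1 T)
  -- Both orbits attain this transverse height at or before T. Shifted to meet it at time 0, their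
  -- difference lies in the cone and has height 0, so it vanishes.
  set β := min (typeIICoord 3 (flow q x T)) (typeIICoord 3 (flow q y T))
  have hβ : 0 < β := lt_min (hpos x hx) (hpos y hy)
  obtain ⟨s, hs, hsβ⟩ := exists_time_eq (hcont x hx) (hlim x hx) hβ (min_le_left _ _)
  obtain ⟨r, hr, hrβ⟩ := exists_time_eq (hcont y hy) (hlim y hy) hβ (min_le_right _ _)
  have hx' := flow_mem_unstable hx s
  have hy' := flow_mem_unstable hy r
  have key := quadratic_nonpos_of_past (diagForm_comm (weightsP2 q M) typeIICoord) hB (t₀ := 0)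
    (fun t _ => hasDerivAt_flow hx'.1 t) (fun t _ => hasDerivAt_flow hy'.1 t)
    (fun t ht => by rw [flow_flow hx.1]; exact (hT _ (by linarith)).1)
    (fun t ht => by rw [flow_flow hy.1]; exact (hT _ (by linarith)).2) hx'.2 hy'.2
  rw [flow_zero hx'.1, flow_zero hy'.1] at key
  obtain ⟨C, -, hC⟩ := norm_le_of_diagForm_nonpos hq hq2 hM
  have h1 := hC _ key
  rw [map_sub, hsβ, hrβ, sub_self, abs_zero, mul_zero, norm_le_zero_iff, sub_eq_zero] at h1
  refine ⟨s + -r, ?_⟩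
  rw [← flow_flow hx.1, h1, flow_flow_neg hy.1]

end BianchiVI0

end

/-! ### Existence of an orbit emanating from P₂ -/

noncomputable section

namespace BianchiVI0

variable {q : ℝ} {x p : R4}

theorem typeIICoord_three_reducedField (q : ℝ) (x : R4) : typeIICoord 3 (reducedField q x) =
    (dec q x + 2 * x 0 - 2 * √3 * x 1) * typeIICoord 3 x := by
  rw [typeIICoord_three, typeIICoord_three, reducedField_two, reducedField_three]; ring

theorem continuous_dec (q : ℝ) : Continuous (dec q) := by
  unfold dec
  have := continuous_density
  fun_prop

theorem hasDerivAt_typeIICoord_three_flow (hx : x ∈ region) (t : ℝ) :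
    HasDerivAt (fun t => typeIICoord 3 (flow q x t))
      ((dec q (flow q x t) + 2 * flow q x t 0 - 2 * √3 * flow q x t 1)
        * typeIICoord 3 (flow q x t)) t := by
  rw [← typeIICoord_three_reducedField]
  exact (typeIICoord 3).hasFDerivAt.comp_hasDerivAt t (hasDerivAt_flow hx t)

open Set in
/-- If `k₁ u ≤ u' ≤ k₂ u` on `[a, b]`, then `u b` lies between the corresponding exponentials. -/
theorem exp_bounds {u u' : ℝ → ℝ} {k a b : ℝ} (hab : a ≤ b) (hu : ∀ t, HasDerivAt u (u' t) t)
    (h : ∀ t ∈ Icc a b, k * u t ≤ u' t) : u a ≤ u b * Real.exp (-(k * (b - a))) := by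
  have hd : ∀ t, HasDerivAt (fun t => u t * Real.exp (-(k * (t - a))))
      ((u' t - k * u t) * Real.exp (-(k * (t - a)))) t := fun t => by
    refine ((hu t).mul ((((hasDerivAt_id t).sub_const a).const_mul k).fun_neg.exp)).congr_deriv ?_
    simp; ring
  have hm : MonotoneOn (fun t => u t * Real.exp (-(k * (t - a)))) (Icc a b) := by
    refine monotoneOn_of_deriv_nonneg (convex_Icc a b)
      (fun t _ => (hd t).continuousAt.continuousWithinAt)
      (fun t _ => (hd t).differentiableAt.differentiableWithinAt) fun t ht => ?_
    rw [(hd t).deriv]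
    have := h t (interior_subset ht)
    exact mul_nonneg (by linarith) (Real.exp_pos _).le
  simpa using hm ⟨le_rfl, hab⟩ ⟨hab, le_rfl⟩ hab

/-- The quadratic cone of the dissipative form is preserved as long as the orbit stays close to the
equilibrium. -/
theorem cone_preserved {f : R4 → R4} {B : R4 →L[ℝ] R4 →L[ℝ] ℝ} (hs : ∀ u v, B u v = B v u) {ρ : ℝ}
    (hρ : 0 < ρ) (hB : ∀ x ∈ Metric.ball p ρ, ∀ y ∈ Metric.ball p ρ, B (x - y) (f x - f y) ≤ 0)
    (hp : f p = 0) {c : ℝ → R4} (hc : ∀ t, HasDerivAt c (f (c t)) t) {t : ℝ}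
    (h0 : B (c 0 - p) (c 0 - p) ≤ 0)
    (hnear : ∀ s ∈ Set.Icc 0 t, B (c s - p) (c s - p) ≤ 0 → c s ∈ Metric.ball p ρ) :
    ∀ s ∈ Set.Icc 0 t, B (c s - p) (c s - p) ≤ 0 := by
  have hcc : Continuous c := continuous_iff_continuousAt.2 fun t => (hc t).continuousAt
  set φ : ℝ → ℝ := fun s => B (c s - p) (c s - p)
  have hd : ∀ s, HasDerivAt φ (2 * B (c s - p) (f (c s))) s := fun s =>
    hasDerivAt_quadratic hs ((hc s).sub_const p)
  have hφ : Continuous φ := continuous_iff_continuousAt.2 fun s => (hd s).continuousAt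
  have hclosed : IsClosed ({s | φ s ≤ 0} ∩ Set.Icc 0 t) :=
    (isClosed_le hφ continuous_const).inter isClosed_Icc
  refine fun s hs => hclosed.Icc_subset_of_forall_exists_gt h0 (fun s hs r hr => ?_) hs
  have h1 : c s ∈ Metric.ball p ρ := hnear s ⟨hs.2.1, hs.2.2.le⟩ hs.1
  have h2 : ∀ᶠ u in 𝓝 s, c u ∈ Metric.ball p ρ :=
    hcc.continuousAt.eventually (Metric.isOpen_ball.mem_nhds h1)
  obtain ⟨η, hη, h3⟩ := Metric.eventually_nhds_iff_ball.1 h2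
  set u := min r (s + η / 2)
  have hsu : s < u := lt_min hr (by linarith)
  have hu : u ≤ s + η / 2 := min_le_right _ _
  refine ⟨u, ?_, hsu, min_le_left _ _⟩
  have hanti : AntitoneOn φ (Set.Icc s u) := by
    refine antitoneOn_of_deriv_nonpos (convex_Icc s u) hφ.continuousOn
      (fun v _ => (hd v).differentiableAt.differentiableWithinAt) fun v hv => ?_
    have hv' := interior_subset hv
    rw [(hd v).deriv]
    have h4 := hB (c v) (h3 v (by
      rw [Real.ball_eq_Ioo]; exact ⟨by linarith [hv'.1], by linarith [hv'.2]⟩)) p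
      (Metric.mem_ball_self hρ)
    rw [hp, sub_zero] at h4
    linarith
  exact (hanti ⟨le_rfl, hsu.le⟩ ⟨hsu.le, le_rfl⟩ hsu.le).trans hs.1

open Set in
theorem exists_first_time {u : ℝ → ℝ} (hu : Continuous u) {ε : ℝ} (h0 : u 0 ≤ ε)
    (h : ∃ s ≥ 0, ε ≤ u s) : ∃ T ≥ 0, u T = ε ∧ ∀ s ∈ Icc 0 T, u s ≤ ε := by
  obtain ⟨s, hs, hsε⟩ := h
  have hK : IsCompact (Icc 0 s ∩ u ⁻¹' Ici ε) :=
    isCompact_Icc.inter_right (isClosed_Ici.preimage hu)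
  obtain ⟨T, ⟨⟨hT0, hTs⟩, hTε⟩, hmin⟩ := hK.exists_isLeast ⟨s, ⟨hs, le_rfl⟩, hsε⟩
  have hlt : ∀ r, 0 ≤ r → r < T → u r < ε := fun r hr hrT => by
    by_contra! hge
    exact absurd (hmin ⟨⟨hr, hrT.le.trans hTs⟩, hge⟩) (not_le.2 hrT)
  have hTeq : u T = ε := by
    obtain ⟨r, hr, hrε⟩ := intermediate_value_Icc hT0 hu.continuousOn ⟨h0, hTε⟩
    rcases hr.2.lt_or_eq with hlt' | rfl
    · exact absurd hrε (hlt r hr.1 hlt').ne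
    · exact hrε
  refine ⟨T, hT0, hTeq, fun r hr => ?_⟩
  rcases hr.2.lt_or_eq with hlt' | rfl
  · exact (hlt r hr.1 hlt').le
  · exact hTeq.le

/-- `P₂⁺(II)` has an orbit in its unstable set. -/
theorem unstable_reducedP2_nonempty (hq : 0 < q) (hq2 : q < 2) :
    (unstable q (reducedP2 q)).Nonempty := by
  obtain ⟨M, hM, ρ₁, hρ₁, hB₁⟩ := exists_dissipative_reducedP2 hq hq2
  obtain ⟨C, hC0, hC⟩ := norm_le_of_diagForm_nonpos hq hq2 hM
  set p := reducedP2 q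
  set B := diagForm (weightsP2 q M) typeIICoord
  have h3 : √3 ^ 2 = 3 := Real.sq_sqrt (by norm_num)
  have hrate : dec q p + 2 * p 0 - 2 * √3 * p 1 = 3 * q / 2 := by
    rw [dec_reducedP2 hq hq2]
    simp only [p, reducedP2, Matrix.cons_val]
    linear_combination q / 4 * h3
  have hratec : Continuous fun x : R4 => dec q x + 2 * x 0 - 2 * √3 * x 1 := by
    have := continuous_dec q
    fun_prop
  -- The growth rate of the transverse coordinate is 3q/2 at p, so nearby it lies between q and 2q.
  have hev : ∀ᶠ x in 𝓝 p, x ∈ Metric.ball p ρ₁ ∧ q < dec q x + 2 * x 0 - 2 * √3 * x 1 ∧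
      dec q x + 2 * x 0 - 2 * √3 * x 1 < 2 * q ∧ 0 < density x ∧ 0 < typeIICoord 2 x := by
    refine Eventually.and (Metric.ball_mem_nhds p hρ₁) ?_
    refine (hratec.continuousAt.eventually_const_lt (by beta_reduce; rw [hrate]; linarith)).and ?_
    refine (hratec.continuousAt.eventually_lt_const (by beta_reduce; rw [hrate]; linarith)).and ?_
    refine (continuous_density.continuousAt.eventually_const_lt (by
      rw [density_reducedP2 hq hq2]; linarith)).and ?_
    refine (typeIICoord 2).continuous.continuousAt.eventually_const_lt ?_
    rw [typeIICoord_two]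
    have : 0 < √(q * (2 - q)) := Real.sqrt_pos.2 (mul_pos hq (by linarith))
    simp only [p, reducedP2, Matrix.cons_val]
    linarith
  obtain ⟨ρ, hρ, hball⟩ := Metric.eventually_nhds_iff_ball.1 hev
  have hB : ∀ x ∈ Metric.ball p ρ, ∀ y ∈ Metric.ball p ρ,
      B (x - y) (reducedField q x - reducedField q y) ≤ 0 := fun x hx y hy =>
    hB₁ x (hball x hx).1 y (hball y hy).1
  have hreg : ∀ x ∈ Metric.ball p ρ, 0 < typeIICoord 3 x → x ∈ region := by
    intro x hx hb
    obtain ⟨-, -, -, h1, h2⟩ := hball x hx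
    rw [typeIICoord_two] at h2
    rw [typeIICoord_three] at hb
    exact ⟨h1, abs_lt.2 ⟨by linarith, by linarith⟩⟩
  set ε := ρ / (2 * C)
  have hε : 0 < ε := by positivity
  have hCε : C * ε < ρ := by
    have : C * ε = ρ / 2 := by simp only [ε]; field_simp
    linarith
  -- orbits starting in the cone leave through `typeIICoord 3 = ε`
  have orbit : ∀ y ∈ region, B (y - p) (y - p) ≤ 0 → typeIICoord 3 y ≤ ε → ∃ T ≥ 0,
      typeIICoord 3 (flow q y T) = ε ∧ ε ≤ typeIICoord 3 y * Real.exp (2 * q * T) ∧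
      ∀ s ∈ Set.Icc 0 T, ‖flow q y s - p‖ ≤ C * (ε * Real.exp (-(q * (T - s)))) := by
    intro y hy hyB hyε
    have hd := hasDerivAt_typeIICoord_three_flow (q := q) hy
    have hpos : ∀ s, 0 < typeIICoord 3 (flow q y s) := fun s => typeIICoord_three_pos (flow_mem hy s)
    have hcone : ∀ t, (∀ s ∈ Set.Icc 0 t, typeIICoord 3 (flow q y s) ≤ ε) → ∀ s ∈ Set.Icc 0 t,
        ‖flow q y s - p‖ ≤ C * typeIICoord 3 (flow q y s) ∧ flow q y s ∈ Metric.ball p ρ := by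
      intro t ht
      have hn : ∀ s ∈ Set.Icc 0 t, B (flow q y s - p) (flow q y s - p) ≤ 0 →
          ‖flow q y s - p‖ ≤ C * typeIICoord 3 (flow q y s) ∧ flow q y s ∈ Metric.ball p ρ := by
        intro s hs hsB
        have h1 := hC _ hsB
        rw [map_sub, typeIICoord_three_reducedP2, sub_zero, abs_of_pos (hpos s)] at h1
        refine ⟨h1, ?_⟩
        rw [mem_ball_iff_norm]
        exact h1.trans_lt ((mul_le_mul_of_nonneg_left (ht s hs) hC0.le).trans_lt hCε)
      intro s hs
      exact hn s hs (cone_preserved (diagForm_comm _ _) hρ hB (reducedField_reducedP2 hq hq2)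
        (hasDerivAt_flow hy) (by rwa [flow_zero hy]) (fun s hs h => (hn s hs h).2) s hs)
    -- Below ε the orbit would stay in the ball and grow at rate at least q forever, forcing its
    -- initial height to be ≤ 0.
    have hex : ∃ s ≥ 0, ε ≤ typeIICoord 3 (flow q y s) := by
      by_contra! hlt
      have h1 : ∀ t ≥ 0, typeIICoord 3 y ≤ ε * Real.exp (-(q * (t - 0))) := by
        intro t ht
        have h2 := exp_bounds ht hd (k := q) fun s hs => by
          have h4 := hball _ (hcone t (fun s hs => (hlt s hs.1).le) s hs).2
          exact mul_le_mul_of_nonneg_right h4.2.1.le (hpos s).le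
        rw [flow_zero hy] at h2
        exact h2.trans (mul_le_mul_of_nonneg_right (hlt t ht).le (Real.exp_pos _).le)
      have h2 : Tendsto (fun t : ℝ => ε * Real.exp (-(q * (t - 0)))) atTop (𝓝 0) := by
        have : Tendsto (fun t : ℝ => q * (t - 0)) atTop atTop := by
          simpa using tendsto_id.const_mul_atTop hq
        simpa using (Real.tendsto_exp_neg_atTop_nhds_zero.comp this).const_mul ε
      have h3 := ge_of_tendsto h2 ((eventually_ge_atTop 0).mono h1)
      exact absurd (typeIICoord_three_pos hy) (not_lt.2 h3)
    obtain ⟨T, hT0, hTε, hTle⟩ := exists_first_time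
      (continuous_iff_continuousAt.2 fun t => (hd t).continuousAt) (by rwa [flow_zero hy]) hex
    have hco := hcone T hTle
    refine ⟨T, hT0, hTε, ?_, fun s hs => ?_⟩
    · have h1 := exp_bounds (u := fun t => -typeIICoord 3 (flow q y t)) (k := 2 * q) hT0
        (fun t => (hd t).fun_neg) fun s hs => by
          have h4 := hball _ (hco s hs).2
          have := mul_le_mul_of_nonneg_right h4.2.2.1.le (hpos s).le
          linarith
      simp only [flow_zero hy, hTε, sub_zero] at h1
      have h2 := Real.exp_pos (2 * q * T)
      rw [Real.exp_neg] at h1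
      have h3 : ε * (Real.exp (2 * q * T))⁻¹ ≤ typeIICoord 3 y := by linarith
      rwa [← div_eq_mul_inv, div_le_iff₀ h2] at h3
    · refine (hco s hs).1.trans (mul_le_mul_of_nonneg_left ?_ hC0.le)
      have h1 := exp_bounds hs.2 hd (k := q) fun r hr => by
        have h4 := hball _ (hco r ⟨hs.1.trans hr.1, hr.2⟩).2
        exact mul_le_mul_of_nonneg_right h4.2.1.le (hpos r).le
      rwa [hTε] at h1
  -- starting points converging to `p`
  set e : R4 := !₂[0, 0, -1, 1]
  have he0 : typeIICoord 0 e = 0 := by rw [typeIICoord_zero]; simp [e]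
  have he1 : typeIICoord 1 e = 0 := by rw [typeIICoord_one]; simp [e]
  have he2 : typeIICoord 2 e = 0 := by rw [typeIICoord_two]; simp [e]
  have he3 : typeIICoord 3 e = 1 := by rw [typeIICoord_three]; simp [e]
  set δ : ℕ → ℝ := fun n => 1 / ((n : ℝ) + 1)
  have hδ : Tendsto δ atTop (𝓝 0) := tendsto_one_div_add_atTop_nhds_zero_nat
  have hδpos : ∀ n, 0 < δ n := fun n => by positivity
  have hstart : ∀ᶠ n in atTop, p + δ n • e ∈ Metric.ball p ρ ∧ δ n < ε := by
    refine Eventually.and ?_ (hδ.eventually_lt_const hε)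
    have : Tendsto (fun n => p + δ n • e) atTop (𝓝 p) := by
      simpa using (hδ.smul_const e).const_add p
    exact this.eventually (Metric.ball_mem_nhds p hρ)
  obtain ⟨N, hN⟩ := eventually_atTop.1 hstart
  have hb : ∀ n, typeIICoord 3 (p + δ n • e) = δ n := fun n => by
    rw [map_add, map_smul, he3, typeIICoord_three_reducedP2]; simp
  have hyreg : ∀ n, p + δ (n + N) • e ∈ region := fun n =>
    hreg _ (hN _ (by omega)).1 (by rw [hb]; exact hδpos _)
  have hyB : ∀ n, B (p + δ (n + N) • e - p) (p + δ (n + N) • e - p) ≤ 0 := fun n => by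
    rw [add_sub_cancel_left, diagForm_apply]
    simp only [map_smul, he0, he1, he2, he3, weightsP2, Matrix.cons_val, smul_eq_mul]
    nlinarith [mul_pos hM (sq_pos_of_pos (hδpos (n + N)))]
  choose T hT0 hTε hTexp hTdist using fun n =>
    orbit _ (hyreg n) (hyB n) (by rw [hb]; exact (hN _ (by omega)).2.le)
  set z : ℕ → R4 := fun n => flow q (p + δ (n + N) • e) (T n)
  have hzreg : ∀ n, z n ∈ region := fun n => flow_mem (hyreg n) _
  have hzball : ∀ n, z n ∈ Metric.closedBall p (C * ε) := fun n => by
    rw [mem_closedBall_iff_norm]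
    simpa using hTdist n (T n) ⟨hT0 n, le_rfl⟩
  obtain ⟨w, hw, φ, hφ, hlim⟩ := (isCompact_closedBall p (C * ε)).tendsto_subseq hzball
  have hwε : typeIICoord 3 w = ε := by
    have h1 := ((typeIICoord 3).continuous.tendsto w).comp hlim
    refine tendsto_nhds_unique h1 (tendsto_const_nhds.congr fun n => ?_)
    exact (hTε (φ n)).symm
  have hwreg : w ∈ region := hreg w
    (Metric.closedBall_subset_ball hCε hw) (by rw [hwε]; exact hε)
  -- The initial heights tend to 0 and grow at rate at most 2q, so reaching ε takes ever longer.
  have hTlim : Tendsto T atTop atTop := by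
    rw [tendsto_atTop]
    intro R
    have h1 : ∀ᶠ n in atTop, δ (n + N) * Real.exp (2 * q * R) < ε := by
      have h2 : Tendsto (fun n => δ (n + N) * Real.exp (2 * q * R)) atTop (𝓝 0) := by
        simpa using (hδ.comp (tendsto_add_atTop_nat N)).mul_const (Real.exp (2 * q * R))
      exact h2.eventually_lt_const hε
    filter_upwards [h1] with n hn
    by_contra! hlt
    have h2 := hTexp n
    rw [hb] at h2
    have h3 : Real.exp (2 * q * T n) ≤ Real.exp (2 * q * R) := Real.exp_le_exp.2 (by nlinarith)
    exact absurd (h2.trans (mul_le_mul_of_nonneg_left h3 (hδpos _).le)) (not_le.2 hn)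
  -- For fixed t the exit estimate covers time t before the exit once T n ≥ -t; it passes to the
  -- limit by continuity of the flow in its initial point.
  have hbound : ∀ t ≤ 0, ‖flow q w t - p‖ ≤ C * (ε * Real.exp (q * t)) := by
    intro t ht
    have h1 : Tendsto (fun n => flow q (z (φ n)) t) atTop (𝓝 (flow q w t)) :=
      (contDiffAt_flow hwreg t).continuousAt.tendsto.comp hlim
    refine le_of_tendsto (h1.sub_const p).norm ?_
    filter_upwards [(hTlim.comp hφ.tendsto_atTop).eventually_ge_atTop (-t)] with n hn
    have hn' : -t ≤ T (φ n) := hn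
    have h2 := hTdist (φ n) (T (φ n) + t) ⟨by linarith, by linarith⟩
    rw [flow_flow (hyreg _)]
    refine h2.trans_eq ?_
    congr 3
    ring
  refine ⟨w, hwreg, ?_⟩
  rw [tendsto_iff_norm_sub_tendsto_zero]
  have hexp : Tendsto (fun t : ℝ => C * (ε * Real.exp (q * t))) atBot (𝓝 0) := by
    have : Tendsto (fun t : ℝ => q * t) atBot atBot := tendsto_id.const_mul_atBot hq
    simpa using ((Real.tendsto_exp_atBot.comp this).const_mul ε).const_mul C
  exact squeeze_zero' (Eventually.of_forall fun _ => norm_nonneg _)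
    ((eventually_le_atBot 0).mono hbound) hexp

end BianchiVI0

end

/-! ### A priori bounds on the unstable set of F -/

noncomputable section

namespace BianchiVI0

variable {q : ℝ} {x p : R4}

theorem two_sub_dec (q : ℝ) (x : R4) : 2 - dec q x = (2 - q) * density x + 2 * x 3 ^ 2 := by
  simp only [dec, density]; ring

theorem reducedField_origin (q : ℝ) : reducedField q 0 = 0 := by
  ext i
  fin_cases i
  · exact (reducedField_zero _ _).trans (by simp)
  · exact (reducedField_one _ _).trans (by simp)
  · exact (reducedField_two _ _).trans (by simp)
  · exact (reducedField_three _ _).trans (by simp)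

theorem density_origin : density 0 = 1 := by simp [density]

theorem dec_origin (q : ℝ) : dec q 0 = q := by simp [dec, density]

theorem density_le_one (x : R4) : density x ≤ 1 := by
  unfold density; nlinarith [sq_nonneg (x 0), sq_nonneg (x 1), sq_nonneg (x 3)]

/-- The coordinate functionals. -/
def coord (i : Fin 4) : R4 →L[ℝ] ℝ := EuclideanSpace.proj i

@[simp] theorem coord_apply (i : Fin 4) (v : R4) : coord i v = v i := rfl

/-- The form `|Σ|² - |N|²`. -/
def formF : R4 →L[ℝ] R4 →L[ℝ] ℝ := diagForm ![1, 1, -1, -1] coord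

theorem formF_apply (v : R4) : formF v v = v 0 ^ 2 + v 1 ^ 2 - v 2 ^ 2 - v 3 ^ 2 := by
  rw [formF, diagForm_apply]; simp; ring

/-- At F the linearisation is -(2 - q) on the Σ plane and q on the N plane. -/
theorem exists_dissipative_origin (hq : 0 < q) (hq2 : q < 2) : ∃ ρ > 0,
    ∀ x ∈ Metric.ball (0 : R4) ρ, ∀ y ∈ Metric.ball (0 : R4) ρ,
      formF (x - y) (reducedField q x - reducedField q y) ≤ 0 := by
  have hP : 0 < 2 - q := by linarith
  refine exists_ball_dissipative (hasStrictFDerivAt_reducedField q _) _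
    (c := min (2 - q) q) (lt_min hP hq) fun v => ?_
  have hd : decDeriv q 0 v = 0 := by simp [decDeriv]
  rw [formF, diagForm_apply, norm_sq_eq]
  simp only [coord_apply, fderiv_reducedField_zero, fderiv_reducedField_one,
    fderiv_reducedField_two, fderiv_reducedField_three, hd, dec_origin, Matrix.cons_val,
    PiLp.zero_apply]
  have h1 := mul_le_mul_of_nonneg_right (min_le_left (2 - q) q)
    (add_nonneg (sq_nonneg (v 0)) (sq_nonneg (v 1)))
  have h2 := mul_le_mul_of_nonneg_right (min_le_right (2 - q) q)
    (add_nonneg (sq_nonneg (v 2)) (sq_nonneg (v 3)))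
  nlinarith

theorem tendsto_coord (hx : x ∈ unstable q p) (i : Fin 4) :
    Tendsto (fun t => flow q x t i) atBot (𝓝 (p i)) :=
  ((coord i).continuous.tendsto _).comp hx.2

theorem tendsto_density (hx : x ∈ unstable q p) :
    Tendsto (fun t => density (flow q x t)) atBot (𝓝 (density p)) :=
  (continuous_density.tendsto _).comp hx.2

theorem hasDerivAt_density_flow (hx : x ∈ region) (t : ℝ) :
    HasDerivAt (fun t => density (flow q x t))
      (2 * (dec q (flow q x t) - q) * density (flow q x t)) t := by
  simpa using hasDerivAt_density (χ := 1) (by simpa using hasDerivAt_flow hx t)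

theorem coord_zero_nonpos (hq2 : q < 2) (hx : x ∈ unstable q 0) (t : ℝ) :
    flow q x t 0 ≤ 0 := by
  refine le_of_deriv_nonpos_above_of_tendsto
    (fun t => hasDerivAt_coord (hasDerivAt_flow hx.1 t) 0) (fun t ht => ?_)
    (tendsto_coord hx 0) (by simp) t
  have h1 := (flow_mem (q := q) hx.1 t).1
  have hP : 0 < 2 - q := by linarith
  rw [reducedField_zero, two_sub_dec]
  nlinarith [sq_nonneg (flow q x t 3), mul_pos hP h1,
    mul_nonneg (add_nonneg (mul_pos hP h1).le (mul_nonneg two_pos.le (sq_nonneg (flow q x t 3))))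
      ht.le]

/-- The constraint removes Σ₋ and N₋, leaving a linear equation for the quotient forced by 1 + Σ₊
alone. -/
theorem hasDerivAt_sq_div_density (hx : x ∈ region) (t : ℝ) :
    HasDerivAt (fun t => (1 + flow q x t 0) ^ 2 / density (flow q x t))
      (-2 * (2 - q) * ((1 + flow q x t 0) ^ 2 / density (flow q x t))
        + 2 * (2 - q) * (1 + flow q x t 0)) t := by
  have h1 := (flow_mem (q := q) hx t).1
  refine ((((hasDerivAt_coord (hasDerivAt_flow (q := q) hx t) 0).const_add 1).fun_pow 2).fun_div
    (hasDerivAt_density_flow hx t) h1.ne').congr_deriv ?_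
  rw [reducedField_zero]
  have h2 : density (flow q x t) = 1 - flow q x t 0 ^ 2 - flow q x t 1 ^ 2 - flow q x t 3 ^ 2 := rfl
  field_simp
  rw [dec, h2]
  push_cast
  ring

/-- The quotient is 1 at F and, as Σ₊ ≤ 0, decreases whenever it exceeds 1. Thus Ω ≥ (1 + Σ₊)², and
bounding Ω below reduces to keeping Σ₊ away from -1. -/
theorem sq_div_density_le_one (hq2 : q < 2) (hx : x ∈ unstable q 0) (t : ℝ) :
    (1 + flow q x t 0) ^ 2 / density (flow q x t) ≤ 1 := by
  refine le_of_deriv_nonpos_above_of_tendsto (hasDerivAt_sq_div_density hx.1) (fun t ht => ?_)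
    ((((tendsto_coord hx 0).const_add 1).pow 2).div (tendsto_density hx) (by simp [density_origin]))
    (by simp [density_origin]) t
  have := coord_zero_nonpos hq2 hx t
  have hP : 0 < 2 - q := by linarith
  nlinarith

/-- The two positive terms are at most 4 each. K = 16/P² makes the negative ones at least 8 by the
arithmetic-geometric mean inequality for P/(2G) and 32G/P, whatever G is. -/
theorem inv_bound_aux {P y G N K : ℝ} (hP : 0 < P) (hP2 : P ≤ 2) (hy : 0 < y) (hyP : y < P / 8)
    (hG : 0 < G) (hN : N ≤ 2 * y) (hK : K = 16 / P ^ 2) :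
    2 * N / y - P * (1 - y) / G + K * (-2 * P * G + 2 * P * y) ≤ 0 := by
  have h1 : 2 * N / y ≤ 4 := by rw [div_le_iff₀ hy]; linarith
  have h2 : K * (2 * P * y) ≤ 4 := by
    rw [hK, div_mul_eq_mul_div, div_le_iff₀ (by positivity)]; nlinarith
  have h3 : 8 ≤ P * (1 - y) / G + K * (2 * P * G) := by
    have h4 : P / (2 * G) ≤ P * (1 - y) / G := by
      rw [div_le_div_iff₀ (by positivity) hG]; nlinarith [mul_pos hP hG]
    have h5 : 8 ≤ P / (2 * G) + K * (2 * P * G) := by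
      have : P / (2 * G) + K * (2 * P * G) - 8 = (P - 8 * G) ^ 2 / (2 * P * G) := by
        rw [hK]; field_simp; ring
      have h6 : 0 ≤ (P - 8 * G) ^ 2 / (2 * P * G) := by positivity
      linarith
    linarith
  nlinarith

/-- Along the unstable set of `F`, the density parameter is bounded below. -/
theorem exists_density_lower_bound (hq : 0 < q) (hq2 : q < 2) : ∃ ω₀ > 0,
    ∀ x ∈ unstable q 0, ∀ t, ω₀ ≤ density (flow q x t) := by
  have hP : 0 < 2 - q := by linarith
  set P := 2 - q with hPdef
  set K := 16 / P ^ 2 with hK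
  have hK0 : 0 < K := by positivity
  refine ⟨(1 / (8 / P + K)) ^ 2, by positivity, fun x hx t => ?_⟩
  have hy : ∀ t, 0 < 1 + flow q x t 0 := fun t => by
    linarith [neg_one_lt_of_mem_region (flow_mem (q := q) hx.1 t)]
  have hG1 := sq_div_density_le_one hq2 hx
  have hΩ := fun t => (flow_mem (q := q) hx.1 t).1
  -- The inverse alone need not decrease when large; the quotient compensates. As the quotient is at
  -- most 1, exceeding 8/P + K forces 1 + Σ₊ < P/8.
  have hV : (1 + flow q x t 0)⁻¹ + K * ((1 + flow q x t 0) ^ 2 / density (flow q x t))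
      ≤ 8 / P + K := by
    refine le_of_deriv_nonpos_above_of_tendsto (L := 1 + K) (fun t =>
      ((((hasDerivAt_coord (hasDerivAt_flow (q := q) hx.1 t) 0).const_add 1).fun_inv
        (hy t).ne').fun_add ((hasDerivAt_sq_div_density hx.1 t).const_mul K))) (fun t ht => ?_)
      ?_ ?_ t
    · have h1 : 8 / P < (1 + flow q x t 0)⁻¹ := by nlinarith [hG1 t]
      have h2 : 1 + flow q x t 0 < P / 8 := by
        rw [lt_inv_comm₀ (by positivity) (hy t)] at h1
        rwa [inv_div] at h1
      have hN : flow q x t 3 ^ 2 ≤ 2 * (1 + flow q x t 0) := by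
        have := hΩ t
        unfold density at this
        nlinarith [sq_nonneg (flow q x t 1), sq_nonneg (flow q x t 0)]
      refine le_of_eq_of_le ?_ (inv_bound_aux hP (by linarith) (hy t) h2
        (div_pos (pow_pos (hy t) 2) (hΩ t)) hN hK)
      have h3 : -reducedField q (flow q x t) 0 / (1 + flow q x t 0) ^ 2 =
          2 * flow q x t 3 ^ 2 / (1 + flow q x t 0) - P * (1 - (1 + flow q x t 0)) /
            ((1 + flow q x t 0) ^ 2 / density (flow q x t)) := by
        have e1 := (hy t).ne'
        have e2 := (hΩ t).ne'
        rw [reducedField_zero, two_sub_dec]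
        field_simp
        ring
      rw [h3, hPdef]
    · have h1 := (((tendsto_coord hx 0).const_add 1).inv₀ (by simp)).add
        (((((tendsto_coord hx 0).const_add 1).pow 2).div (tendsto_density hx)
          (by simp [density_origin])).const_mul K)
      simpa [density_origin] using h1
    · have : 1 ≤ 8 / P := by rw [le_div_iff₀ hP]; linarith
      linarith
  have h1 : (1 + flow q x t 0)⁻¹ ≤ 8 / P + K := by
    have : 0 ≤ K * ((1 + flow q x t 0) ^ 2 / density (flow q x t)) := by
      have := hΩ t; positivity
    linarith
  have h2 : 1 / (8 / P + K) ≤ 1 + flow q x t 0 := by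
    rw [one_div]; exact inv_le_of_inv_le₀ (hy t) h1
  calc (1 / (8 / P + K)) ^ 2 ≤ (1 + flow q x t 0) ^ 2 := by gcongr
    _ ≤ density (flow q x t) := by simpa using (div_le_iff₀ (hΩ t)).1 (hG1 t)

/-- A = 16/P is chosen so that the bound becomes -4r(1 - 2σ)². -/
theorem shear_ratio_aux {P q r s σ A a : ℝ} (hP : 0 < P) (hA : A = 16 / P) (hs : s = σ ^ 2)
    (hσ : 0 ≤ σ) (hr : 1 ≤ r) (hrq : 2 * q ≤ P * r) (ha : -(2 * σ) ≤ a) :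
    -4 * r - 4 * (1 + r) * a - A * (2 * s * (P * r - q)) ≤ 0 := by
  have hA0 : 0 < A := by rw [hA]; positivity
  have hAP : A * P = 16 := by rw [hA]; field_simp
  have h1 : A * (s * (P * r)) ≤ A * (2 * s * (P * r - q)) := by
    apply mul_le_mul_of_nonneg_left _ hA0.le
    have : 0 ≤ s := by rw [hs]; positivity
    nlinarith
  have h2 : A * (s * (P * r)) = 16 * σ ^ 2 * r := by
    rw [hs, ← hAP]; ring
  have h3 : -4 * (1 + r) * a ≤ 16 * r * σ := by nlinarith
  nlinarith [mul_nonneg (by linarith : (0 : ℝ) ≤ r) (sq_nonneg (1 - 2 * σ))]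

theorem hasDerivAt_shear_ratio (hx : x ∈ region) (t : ℝ) :
    HasDerivAt (fun t => (flow q x t 0 ^ 2 + flow q x t 1 ^ 2) / flow q x t 3 ^ 2)
      (-4 * ((flow q x t 0 ^ 2 + flow q x t 1 ^ 2) / flow q x t 3 ^ 2)
        - 4 * (1 + (flow q x t 0 ^ 2 + flow q x t 1 ^ 2) / flow q x t 3 ^ 2)
          * (flow q x t 0 + √3 * (flow q x t 2 / flow q x t 3) * flow q x t 1)) t := by
  have h3 : 0 < flow q x t 3 := (abs_nonneg _).trans_lt (flow_mem hx t).2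
  have hc := hasDerivAt_flow (q := q) hx t
  refine ((((hasDerivAt_coord hc 0).fun_pow 2).fun_add ((hasDerivAt_coord hc 1).fun_pow 2)).fun_div
    ((hasDerivAt_coord hc 3).fun_pow 2) (by positivity)).congr_deriv ?_
  rw [reducedField_zero, reducedField_one, reducedField_three]
  field_simp
  ring

/-- Along the unstable set of `F`, the shear is controlled by `N₋`. -/
theorem exists_shear_bound (hq : 0 < q) (hq2 : q < 2) : ∃ M > 0, ∀ x ∈ unstable q 0,
    x 0 ^ 2 + x 1 ^ 2 ≤ M * x 3 ^ 2 := by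
  have hP : 0 < 2 - q := by linarith
  obtain ⟨ω₀, hω₀, hΩ⟩ := exists_density_lower_bound hq hq2
  obtain ⟨ρ, hρ, hB⟩ := exists_dissipative_origin hq hq2
  set P := 2 - q with hPdef
  set A := 16 / P with hA
  have hA0 : 0 < A := by positivity
  -- R ≥ 2 covers the start, where the cone gives |Σ|² ≤ N₊² + N₋² < 2N₋²; PR ≥ 2q is needed in the
  -- barrier.
  set R := 2 + 2 * q / P
  have hR : 2 ≤ R := by simp only [R]; linarith [show 0 ≤ 2 * q / P by positivity]
  have hRq : 2 * q ≤ P * R := by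
    have : P * (2 * q / P) = 2 * q := by field_simp
    simp only [R]; nlinarith
  set e := Real.exp (-A * Real.log ω₀)
  have he : 0 < e := Real.exp_pos _
  refine ⟨R * e, by positivity, fun x hx => ?_⟩
  set r : ℝ → ℝ := fun t => (flow q x t 0 ^ 2 + flow q x t 1 ^ 2) / flow q x t 3 ^ 2
  -- E = Ω^(-A) lies between 1 and e by the density bound. The ratio r may grow where it is large,
  -- but r E cannot.
  set E : ℝ → ℝ := fun t => Real.exp (-A * Real.log (density (flow q x t)))
  have h3 : ∀ t, 0 < flow q x t 3 := fun t => (abs_nonneg _).trans_lt (flow_mem hx.1 t).2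
  have hpos : ∀ t, 0 < density (flow q x t) := fun t => (flow_mem hx.1 t).1
  have hEe : ∀ t, E t ≤ e := fun t => Real.exp_le_exp.2 (by
    nlinarith [Real.log_le_log hω₀ (hΩ x hx t)])
  have hE1 : ∀ t, 1 ≤ E t := fun t => Real.one_le_exp (by
    nlinarith [Real.log_nonpos (hpos t).le (density_le_one _)])
  have hEd : ∀ t, HasDerivAt E (E t * (-A * (2 * (dec q (flow q x t) - q)))) t := fun t => by
    refine (((hasDerivAt_density_flow hx.1 t).log (hpos t).ne').const_mul (-A)).exp.congr_deriv ?_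
    rw [mul_div_assoc, div_self (hpos t).ne', mul_one]
  have hr0 : ∀ t, 0 ≤ r t := fun t => by positivity
  obtain ⟨T, hT⟩ := eventually_atBot.1 (hx.2.eventually (Metric.ball_mem_nhds 0 hρ))
  have hstart : ∀ t ≤ T, r t ≤ R := by
    intro t ht
    have h1 := quadratic_nonpos_of_past (diagForm_comm _ _) hB (t₀ := t)
      (fun s _ => hasDerivAt_flow hx.1 s) (y := fun _ => 0)
      (fun s _ => by rw [reducedField_origin]; exact hasDerivAt_const _ _)
      (fun s hs => hT s (hs.trans ht)) (fun s _ => Metric.mem_ball_self hρ) hx.2 tendsto_const_nhds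
    rw [sub_zero] at h1
    have h1' : formF (flow q x t) (flow q x t) ≤ 0 := h1
    rw [formF_apply] at h1'
    have h2 := sq_lt_sq' (abs_lt.1 (flow_mem (q := q) hx.1 t).2).1
      (abs_lt.1 (flow_mem (q := q) hx.1 t).2).2
    refine le_trans ?_ hR
    simp only [r]
    rw [div_le_iff₀ (pow_pos (h3 t) 2)]
    linarith
  have hbar : ∀ t, r t * E t ≤ R * e := by
    intro t
    refine le_of_deriv_nonpos_above (t₁ := min t T) (t₀ := t) (fun t =>
      (hasDerivAt_shear_ratio hx.1 t).fun_mul (hEd t)) (fun t ht => ?_) ?_ (min_le_left _ _)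
    · have hrR : R < r t := by
        have h4 : r t * E t ≤ r t * e := mul_le_mul_of_nonneg_left (hEe t) (hr0 t)
        exact lt_of_mul_lt_mul_right (ht.trans_le h4) he.le
      set s := flow q x t 0 ^ 2 + flow q x t 1 ^ 2 with hs
      have hs0 : 0 ≤ s := by positivity
      have hν : (flow q x t 2 / flow q x t 3) ^ 2 ≤ 1 := by
        rw [div_pow, div_le_one (pow_pos (h3 t) 2)]
        exact (sq_lt_sq' (abs_lt.1 (flow_mem (q := q) hx.1 t).2).1
          (abs_lt.1 (flow_mem (q := q) hx.1 t).2).2).le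
      have ha : -(2 * √s) ≤ flow q x t 0 + √3 * (flow q x t 2 / flow q x t 3) * flow q x t 1 := by
        set ν := flow q x t 2 / flow q x t 3
        refine (abs_le.1 (abs_le_of_sq_le_sq ?_ (by positivity))).1
        rw [mul_pow, Real.sq_sqrt hs0, hs]
        have h33 : √3 ^ 2 = 3 := Real.sq_sqrt (by norm_num)
        have h4 : (flow q x t 0 + √3 * ν * flow q x t 1) ^ 2 ≤
            (1 + 3 * ν ^ 2) * (flow q x t 0 ^ 2 + flow q x t 1 ^ 2) := by
          nlinarith [sq_nonneg (flow q x t 1 - √3 * ν * flow q x t 0)]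
        refine h4.trans ?_
        have : 1 + 3 * ν ^ 2 ≤ 2 ^ 2 := by linarith
        exact mul_le_mul_of_nonneg_right this hs0
      have haux := shear_ratio_aux (q := q) (r := r t) hP hA (Real.sq_sqrt hs0).symm
        (Real.sqrt_nonneg s) (by linarith) (hRq.trans (by nlinarith)) ha
      have hdec : r t * (dec q (flow q x t) - q) = s * (P * r t - q) := by
        have h5 : r t * flow q x t 3 ^ 2 = s := by
          simp only [r]; rw [div_mul_cancel₀ _ (pow_pos (h3 t) 2).ne']
        have h6 : dec q (flow q x t) - q = P * s - q * flow q x t 3 ^ 2 := by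
          simp only [dec, density, hs, hPdef]; ring
        rw [h6]
        linear_combination (-q) * h5
      have hE0 : 0 ≤ E t := (Real.exp_pos _).le
      refine le_of_eq_of_le ?_ (mul_nonpos_of_nonneg_of_nonpos hE0 haux)
      simp only [r] at hdec ⊢
      linear_combination (-2 * A * E t) * hdec
    · exact mul_le_mul (hstart _ (min_le_right _ _)) (hEe _) (Real.exp_pos _).le (by linarith)
  have hfin := hbar 0
  have h4 : r 0 ≤ R * e := (le_mul_of_one_le_right (hr0 0) (hE1 0)).trans hfin
  simp only [r, flow_zero hx.1] at h4
  have h5 := h3 0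
  rw [flow_zero hx.1] at h5
  rwa [div_le_iff₀ (pow_pos h5 2)] at h4

/-- Points of the unstable set of `F` which are close to `F` stay close for all past times. -/
theorem exists_past_bound (hq : 0 < q) (hq2 : q < 2) : ∃ C > 0, ∃ ε > 0, ∀ x ∈ unstable q 0,
    x 3 < ε → ∀ t ≤ 0, ‖flow q x t‖ ≤ C * x 3 := by
  obtain ⟨M, hM, hb⟩ := exists_shear_bound hq hq2
  have hnorm : ∀ x ∈ unstable q 0, ‖x‖ ≤ √(M + 2) * x 3 := by
    intro x hx
    have h1 := hb x hx
    have h2 := sq_lt_sq' (abs_lt.1 hx.1.2).1 (abs_lt.1 hx.1.2).2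
    have h3 : 0 < x 3 := (abs_nonneg _).trans_lt hx.1.2
    refine abs_le_of_sq_le_sq' ?_ (by positivity) |>.2
    rw [mul_pow, Real.sq_sqrt (by positivity), norm_sq_eq]
    linarith
  have hcont : Continuous fun x : R4 => dec q x + 2 * x 0 - 2 * √3 * |x 1| := by
    have := continuous_dec q
    fun_prop
  have hev : ∀ᶠ x in 𝓝 (0 : R4), 0 < dec q x + 2 * x 0 - 2 * √3 * |x 1| :=
    hcont.continuousAt.eventually_const_lt (by simpa [dec_origin] using hq)
  obtain ⟨η, hη, hball⟩ := Metric.eventually_nhds_iff_ball.1 hev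
  have hC : 0 < √(M + 2) := by positivity
  refine ⟨√(M + 2), hC, η / √(M + 2), by positivity, fun x hx hxε t ht => ?_⟩
  refine (hnorm _ (flow_mem_unstable hx t)).trans (mul_le_mul_of_nonneg_left ?_ hC.le)
  -- If N₋ was larger in the past, pick a level m strictly between its present value and ε and at
  -- most that past value. Below m the shear bound puts the orbit near F, where N₋ increases, so N₋
  -- could not have dropped below m.
  by_contra! hlt
  set ε := η / √(M + 2)
  set m := min (flow q x t 3) ((x 3 + ε) / 2)
  have hm1 : x 3 < m := lt_min hlt (by linarith)
  have hm2 : m < ε := (min_le_right _ _).trans_lt (by linarith)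
  have h := le_of_deriv_nonpos_above (M := -m) (t₁ := t) (t₀ := 0)
    (fun t => (hasDerivAt_coord (hasDerivAt_flow (q := q) hx.1 t) 3).fun_neg) (fun s hs => ?_)
    (neg_le_neg (min_le_left _ _)) ht
  · rw [flow_zero hx.1] at h; linarith
  · have h1 : flow q x s 3 < ε := by linarith
    have h2 : flow q x s ∈ Metric.ball (0 : R4) η := by
      rw [mem_ball_zero_iff]
      refine (hnorm _ (flow_mem_unstable hx s)).trans_lt ?_
      rw [mul_comm]; exact (lt_div_iff₀ hC).1 h1
    have h3 := hball _ h2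
    have h4 := (flow_mem (q := q) hx.1 s).2
    have h5 : 0 < flow q x s 3 := (abs_nonneg _).trans_lt h4
    rw [reducedField_three]
    have h6 : -(|flow q x s 1| * flow q x s 3) ≤ flow q x s 1 * flow q x s 2 := by
      have : |flow q x s 1 * flow q x s 2| ≤ |flow q x s 1| * flow q x s 3 := by
        rw [abs_mul]; exact mul_le_mul_of_nonneg_left h4.le (abs_nonneg _)
      exact (abs_le.1 this).1
    have h7 : 0 ≤ 2 * √3 := by positivity
    have h8 := mul_le_mul_of_nonneg_left h6 h7
    nlinarith [mul_pos h3 h5]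

end BianchiVI0

end

/-! ### Orbits emanating from F via a singular integral equation -/

noncomputable section

namespace BianchiVI0

variable {q : ℝ} {x p : R4}

open unitInterval Set

/-- The identity of `[0, 1]` as a continuous function. -/
def idI : C(I, ℝ) := ⟨Subtype.val, continuous_subtype_val⟩

/-- `(dec q - q) / s²` in the rescaled variables `w = x / s`. -/
def scaledDec (q : ℝ) (w : PathSpace) : C(I, ℝ) :=
  (2 - q) • (w 0 ^ 2 + w 1 ^ 2) - q • w 3 ^ 2

/-- The nonlinearity of the evolution equations in the variables `w = x / s`, `s = exp (q τ)`. -/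
def scaledField (q : ℝ) (w : PathSpace) : PathSpace :=
  ![q⁻¹ • ((idI * scaledDec q w) * w 0 - ((2 : ℝ) • w 3) * w 3),
    q⁻¹ • ((idI * scaledDec q w) * w 1 - ((2 * √3) • w 2) * w 3),
    q⁻¹ • ((idI * scaledDec q w + (2 : ℝ) • w 0) * w 2 + ((2 * √3) • w 1) * w 3),
    q⁻¹ • ((idI * scaledDec q w + (2 : ℝ) • w 0) * w 3 + ((2 * √3) • w 1) * w 2)]

/-- The exponents of the integral operators: the ratios of the stable rate shifted by `q` to `q`. -/
def exponents (q : ℝ) : Fin 4 → NNReal := ![(2 / q).toNNReal, (2 / q).toNNReal, 0, 0]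

/-- The integral operator of the unstable manifold of `F`. -/
def scaledIntegral (q : ℝ) : PathSpace →L[ℝ] PathSpace :=
  ContinuousLinearMap.pi fun i => avg (exponents q i) ∘L ContinuousLinearMap.proj i

/-- The map whose fibres over constant paths are the orbits emanating from `F`. -/
def orbitMap (q : ℝ) (w : PathSpace) : PathSpace := w - scaledIntegral q (scaledField q w)

theorem contDiff_scaledDec (q : ℝ) {n : WithTop ℕ∞} : ContDiff ℝ n (scaledDec q) := by
  unfold scaledDec; fun_prop

theorem contDiff_scaledField (q : ℝ) {n : WithTop ℕ∞} : ContDiff ℝ n (scaledField q) := by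
  have := contDiff_scaledDec q (n := n)
  rw [contDiff_pi]
  intro i
  fin_cases i <;> simp only [scaledField, Fin.zero_eta, Fin.mk_one, Fin.reduceFinMk,
    Matrix.cons_val] <;> fun_prop

theorem contDiff_orbitMap (q : ℝ) {n : WithTop ℕ∞} : ContDiff ℝ n (orbitMap q) :=
  contDiff_id.sub ((scaledIntegral q).contDiff.comp (contDiff_scaledField q))

theorem hasFDerivAt_mul_of_eq_zero {F A : Type*} [NormedAddCommGroup F] [NormedSpace ℝ F]
    [NormedCommRing A] [NormedAlgebra ℝ A] {a b : F → A} {y : F} (ha : DifferentiableAt ℝ a y)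
    (hb : DifferentiableAt ℝ b y) (ha0 : a y = 0) (hb0 : b y = 0) :
    HasFDerivAt (fun z => a z * b z) (0 : F →L[ℝ] A) y := by
  refine (ha.hasFDerivAt.mul hb.hasFDerivAt).congr_fderiv ?_
  ext1 z
  simp [ha0, hb0]

/-- Every term is a product of two factors vanishing at 0. Hence the orbit map has identity
derivative there and is locally invertible. -/
theorem hasFDerivAt_scaledField (q : ℝ) :
    HasFDerivAt (scaledField q) (0 : PathSpace →L[ℝ] PathSpace) 0 := by
  have hw : ∀ i, DifferentiableAt ℝ (fun w : PathSpace => w i) 0 := fun i => by fun_prop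
  have hs : DifferentiableAt ℝ (scaledDec q) 0 :=
    ((contDiff_scaledDec q (n := 1)).differentiable (by simp)).differentiableAt
  have hs0 : scaledDec q 0 = 0 := by simp [scaledDec]
  rw [hasFDerivAt_pi']
  intro i
  have e : (ContinuousLinearMap.proj i : PathSpace →L[ℝ] C(I, ℝ)) ∘L
      (0 : PathSpace →L[ℝ] PathSpace) = 0 := by simp
  rw [e]
  fin_cases i
  · have h := ((hasFDerivAt_mul_of_eq_zero (hs.const_mul idI) (hw 0) (by simp [hs0]) (by simp)).sub
      (hasFDerivAt_mul_of_eq_zero ((hw 3).const_smul (2 : ℝ)) (hw 3) (by simp) (by simp))).const_smul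
        q⁻¹
    rw [sub_zero, smul_zero] at h
    exact h
  · have h := ((hasFDerivAt_mul_of_eq_zero (hs.const_mul idI) (hw 1) (by simp [hs0]) (by simp)).sub
      (hasFDerivAt_mul_of_eq_zero ((hw 2).const_smul (2 * √3)) (hw 3) (by simp) (by simp))).const_smul
        q⁻¹
    rw [sub_zero, smul_zero] at h
    exact h
  · have h := ((hasFDerivAt_mul_of_eq_zero ((hs.const_mul idI).add ((hw 0).const_smul (2 : ℝ)))
      (hw 2) (by simp [hs0]) (by simp)).add (hasFDerivAt_mul_of_eq_zero
        ((hw 1).const_smul (2 * √3)) (hw 3) (by simp) (by simp))).const_smul q⁻¹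
    rw [add_zero, smul_zero] at h
    exact h
  · have h := ((hasFDerivAt_mul_of_eq_zero ((hs.const_mul idI).add ((hw 0).const_smul (2 : ℝ)))
      (hw 3) (by simp [hs0]) (by simp)).add (hasFDerivAt_mul_of_eq_zero
        ((hw 1).const_smul (2 * √3)) (hw 2) (by simp) (by simp))).const_smul q⁻¹
    rw [add_zero, smul_zero] at h
    exact h

theorem hasFDerivAt_orbitMap (q : ℝ) :
    HasFDerivAt (orbitMap q) ((ContinuousLinearEquiv.refl ℝ PathSpace : PathSpace →L[ℝ] PathSpace))
      0 := by
  refine ((hasFDerivAt_id (0 : PathSpace)).sub ((scaledIntegral q).hasFDerivAt.comp 0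
    (hasFDerivAt_scaledField q))).congr_fderiv ?_
  ext1 w
  simp

/-- The curve in `ℝ⁴` described by a path in the rescaled variables. -/
def unscale (q : ℝ) (w : PathSpace) (τ : ℝ) : R4 :=
  Real.exp (q * τ) • evalPath (projIcc 0 1 zero_le_one (Real.exp (q * τ))) w

theorem norm_evalPath_le (w : PathSpace) (s : I) : ‖evalPath s w‖ ≤ 2 * ‖w‖ := by
  have h : ∀ i, evalPath s w i ^ 2 ≤ ‖w‖ ^ 2 := fun i => by
    rw [evalPath_apply, ← sq_abs, ← Real.norm_eq_abs]
    exact pow_le_pow_left₀ (norm_nonneg _) (((w i).norm_coe_le_norm s).trans (norm_le_pi_norm w i)) 2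
  refine abs_le_of_sq_le_sq' ?_ (by positivity) |>.2
  rw [norm_sq_eq]
  linarith [h 0, h 1, h 2, h 3]

theorem norm_unscale_le (q : ℝ) (w : PathSpace) (τ : ℝ) :
    ‖unscale q w τ‖ ≤ Real.exp (q * τ) * (2 * ‖w‖) := by
  rw [unscale, norm_smul, Real.norm_of_nonneg (Real.exp_pos _).le]
  exact mul_le_mul_of_nonneg_left (norm_evalPath_le _ _) (Real.exp_pos _).le

theorem hasDerivAt_path_coord {w : PathSpace} {i : Fin 4} {a : ℝ}
    (hw : ∀ s : I, orbitMap q w i s = a) {s : ℝ} (hs : s ∈ Ioo (0 : ℝ) 1) :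
    HasDerivAt (fun s => w i (projIcc 0 1 zero_le_one s))
      (scaledField q w i (projIcc 0 1 zero_le_one s)
        - exponents q i / s * (w i (projIcc 0 1 zero_le_one s) - a)) s := by
  have h : ∀ s : I, w i s = a + avg (exponents q i) (scaledField q w i) s := fun s => by
    have : w i s - avg (exponents q i) (scaledField q w i) s = a := hw s
    linarith
  have h1 := (hasDerivAt_avg (exponents q i) (scaledField q w i) hs).const_add a
  simp only [h]
  refine h1.congr_deriv ?_
  ring

/-- Put x = s w(s), s = exp(qτ). The linear part cancels for N and becomes -(2/q) w/s for Σ, where a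
nonzero constant would leave a term of order 1/s; hence a has only N components. -/
theorem hasDerivAt_unscale (hq : 0 < q) {w : PathSpace} {a : R4} (ha0 : a 0 = 0) (ha1 : a 1 = 0)
    (hw : orbitMap q w = constPath a) {τ : ℝ} (hτ : τ < 0) :
    HasDerivAt (unscale q w) (reducedField q (unscale q w τ)) τ := by
  have hs : Real.exp (q * τ) ∈ Ioo (0 : ℝ) 1 :=
    ⟨Real.exp_pos _, Real.exp_lt_one_iff.2 (mul_neg_of_pos_of_neg hq hτ)⟩
  have hexp : HasDerivAt (fun τ => Real.exp (q * τ)) (Real.exp (q * τ) * q) τ := by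
    simpa using ((hasDerivAt_id τ).const_mul q).exp
  set s := Real.exp (q * τ) with hsdef
  set s' : I := projIcc 0 1 zero_le_one s with hs'
  have hs'v : (s' : ℝ) = s := by rw [hs', projIcc_of_mem _ ⟨hs.1.le, hs.2.le⟩]
  have hx : ∀ i, unscale q w τ i = s * w i s' := fun i => by
    simp [unscale, hsdef, hs']
  have hd : ∀ i, HasDerivAt (fun τ => unscale q w τ i)
      (s * q * w i s' + s * ((scaledField q w i s' - exponents q i / s * (w i s' - a i)) * (s * q)))
      τ := fun i => by
    have h1 := hasDerivAt_path_coord (q := q) (w := w) (i := i) (a := a i)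
      (fun s => by rw [hw, constPath_apply]) hs
    have h2 := hexp.fun_mul (h1.comp τ hexp)
    exact h2
  have hs0 : s ≠ 0 := hs.1.ne'
  have hQ : dec q (unscale q w τ) = q + s ^ 2 * scaledDec q w s' := by
    simp only [dec, density, hx, scaledDec, ContinuousMap.sub_apply, ContinuousMap.smul_apply,
      ContinuousMap.add_apply, ContinuousMap.pow_apply, smul_eq_mul]
    ring
  have hκ : ((2 / q).toNNReal : ℝ) = 2 / q := Real.coe_toNNReal _ (by positivity)
  refine hasDerivAt_of_coord fun i => (hd i).congr_deriv ?_
  fin_cases i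
  · refine Eq.trans ?_ (reducedField_zero _ _).symm
    rw [hQ, hx, hx]
    simp [scaledField, exponents, idI, ha0, hκ, hs'v]
    field_simp
    ring
  · refine Eq.trans ?_ (reducedField_one _ _).symm
    rw [hQ, hx, hx, hx]
    simp [scaledField, exponents, idI, ha1, hκ, hs'v]
    field_simp
    ring
  · refine Eq.trans ?_ (reducedField_two _ _).symm
    rw [hQ, hx, hx, hx, hx]
    simp [scaledField, exponents, idI, hs'v]
    field_simp
    ring
  · refine Eq.trans ?_ (reducedField_three _ _).symm
    rw [hQ, hx, hx, hx, hx]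
    simp [scaledField, exponents, idI, hs'v]
    field_simp
    ring

/-- The midpoint of `[0, 1]`. -/
def midI : I := ⟨1 / 2, by norm_num, by norm_num⟩

/-- Starting at s = 1/2 rather than s = 1 leaves room on both sides of time 0, as uniqueness on an
open interval requires. The shift log 2 / q is the time from s = 1/2 to s = 1. -/
theorem flow_midpoint (hq : 0 < q) {w : PathSpace} {a : R4} (ha0 : a 0 = 0) (ha1 : a 1 = 0)
    (hw : orbitMap q w = constPath a) (hw1 : ‖w‖ ≤ 1)
    (hy : (1 / 2 : ℝ) • evalPath midI w ∈ region) {t : ℝ} (ht : t ≤ 0) :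
    flow q ((1 / 2 : ℝ) • evalPath midI w) t = unscale q w (t - Real.log 2 / q) := by
  set y := (1 / 2 : ℝ) • evalPath midI w
  set τ := Real.log 2 / q
  have hτ : 0 < τ := div_pos (Real.log_pos (by norm_num)) hq
  have hball : ∀ r ≤ (0 : ℝ), unscale q w r ∈ Metric.closedBall (0 : R4) 2 := fun r hr => by
    rw [mem_closedBall_zero_iff]
    refine (norm_unscale_le q w r).trans ?_
    have h1 : Real.exp (q * r) ≤ 1 := Real.exp_le_one_iff.2 (mul_nonpos_of_nonneg_of_nonpos hq.le hr)
    calc Real.exp (q * r) * (2 * ‖w‖) ≤ 1 * (2 * 1) := by gcongr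
      _ = 2 := by norm_num
  have h0 : unscale q w (0 - τ) = y := by
    have h1 : Real.exp (q * (0 - τ)) = 1 / 2 := by
      have : q * (0 - τ) = -Real.log 2 := by simp only [τ]; field_simp; ring
      rw [this, Real.exp_neg, Real.exp_log (by norm_num)]; norm_num
    rw [unscale, h1, projIcc_of_mem _ (⟨by norm_num, by norm_num⟩ : (1 / 2 : ℝ) ∈ Icc (0 : ℝ) 1)]
    rfl
  refine eqOn_of_solution (q := q) (a := t - 1) (b := τ) (t₀ := 0)
    (c := flow q y) (d := fun t => unscale q w (t - τ)) ⟨by linarith, hτ⟩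
    (fun r _ => hasDerivAt_flow hy r) (fun r _ => mem_closedBall_of_mem_region (flow_mem hy r))
    (fun r hr => ?_) (fun r hr => hball _ (by linarith [hr.2])) ?_ ⟨by linarith, by linarith⟩
  · exact (hasDerivAt_unscale hq ha0 ha1 hw (by linarith [hr.2] : r - τ < 0)).comp_sub_const r τ
  · rw [flow_zero hy]; exact h0.symm

theorem norm_flow_midpoint_le (hq : 0 < q) {w : PathSpace} {a : R4} (ha0 : a 0 = 0) (ha1 : a 1 = 0)
    (hw : orbitMap q w = constPath a) (hw1 : ‖w‖ ≤ 1)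
    (hy : (1 / 2 : ℝ) • evalPath midI w ∈ region) {t : ℝ} (ht : t ≤ 0) :
    ‖flow q ((1 / 2 : ℝ) • evalPath midI w) t‖ ≤ Real.exp (q * t) * (2 * ‖w‖) := by
  rw [flow_midpoint hq ha0 ha1 hw hw1 hy ht]
  refine (norm_unscale_le q w _).trans (mul_le_mul_of_nonneg_right ?_ (by positivity))
  have : 0 ≤ Real.log 2 / q := (div_pos (Real.log_pos (by norm_num)) hq).le
  exact Real.exp_le_exp.2 (mul_le_mul_of_nonneg_left (by linarith) hq.le)

theorem midpoint_mem_unstable (hq : 0 < q) {w : PathSpace} {a : R4} (ha0 : a 0 = 0) (ha1 : a 1 = 0)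
    (hw : orbitMap q w = constPath a) (hw1 : ‖w‖ ≤ 1)
    (hy : (1 / 2 : ℝ) • evalPath midI w ∈ region) :
    (1 / 2 : ℝ) • evalPath midI w ∈ unstable q 0 := by
  refine ⟨hy, ?_⟩
  rw [tendsto_zero_iff_norm_tendsto_zero]
  have hexp : Tendsto (fun t : ℝ => Real.exp (q * t) * (2 * ‖w‖)) atBot (𝓝 0) := by
    have : Tendsto (fun t : ℝ => q * t) atBot atBot := tendsto_id.const_mul_atBot hq
    simpa using (Real.tendsto_exp_atBot.comp this).mul_const (2 * ‖w‖)
  exact squeeze_zero' (Eventually.of_forall fun _ => norm_nonneg _)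
    ((eventually_le_atBot 0).mono fun t ht => norm_flow_midpoint_le hq ha0 ha1 hw hw1 hy ht) hexp

end BianchiVI0

end

/-! ### The chart at F and embeddedness of its unstable set -/

noncomputable section

namespace BianchiVI0

variable {q : ℝ} {x p : R4}

/-- The exchange of the `Σ` and `N` coordinates. -/
def swapCoord : R4 ≃L[ℝ] R4 :=
  (LinearIsometryEquiv.piLpCongrLeft 2 ℝ ℝ (Equiv.addRight (2 : Fin 4))).toContinuousLinearEquiv

theorem swapCoord_apply (z : R4) (i : Fin 4) : swapCoord z i = z (i + 2) := by
  fin_cases i <;> rfl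

/-- The projection to the `N` coordinates. -/
def projN : R4 →L[ℝ] R4 :=
  (coord 2).smulRight (EuclideanSpace.single 2 1) + (coord 3).smulRight (EuclideanSpace.single 3 1)

theorem projN_apply (z : R4) (i : Fin 4) : projN z i = if i = 2 ∨ i = 3 then z i else 0 := by
  fin_cases i <;> simp [projN]

open Set in
/-- A chart near `F` in which the unstable set of `F` is a coordinate plane. -/
theorem exists_chart_origin (hq : 0 < q) (hq2 : q < 2) : ∃ Θ : R4 → R4,
    ContDiffAt ℝ ω Θ 0 ∧ Θ 0 = 0 ∧ HasFDerivAt Θ (swapCoord : R4 →L[ℝ] R4) 0 ∧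
    ∀ᶠ z in 𝓝 (0 : R4), Θ z ∈ region → (Θ z ∈ unstable q 0 ↔ z 2 = 0 ∧ z 3 = 0) := by
  have hω : (ω : WithTop ℕ∞) ≠ 0 := by simp
  have hT := (contDiff_orbitMap q (n := ω)).contDiffAt (x := 0)
  have hT' := hasFDerivAt_orbitMap q
  have hT0 : orbitMap q 0 = 0 := by
    have : scaledField q 0 = 0 := by
      funext i; fin_cases i <;> simp [scaledField]
    simp [orbitMap, this]
  set inv := hT.localInverse hT' hω
  have hinv0 : inv 0 = 0 := by
    have := hT.localInverse_apply_image hT' hω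
    rwa [hT0] at this
  have hinv : ContDiffAt ℝ ω inv 0 := by
    have := hT.to_localInverse hT' hω
    rwa [hT0] at this
  have hstrict := hT.hasStrictFDerivAt' hT' hω
  have hinvd : HasFDerivAt inv (ContinuousLinearMap.id ℝ PathSpace) 0 := by
    have h1 := hstrict.to_localInverse.hasFDerivAt
    rw [hT0] at h1
    exact h1
  have hright : ∀ᶠ u in 𝓝 (0 : PathSpace), orbitMap q (inv u) = u := by
    have := hstrict.eventually_right_inverse
    rwa [hT0] at this
  -- the data of the chart
  set J : R4 →L[ℝ] R4 := (2 : ℝ) • (projN ∘L (swapCoord : R4 →L[ℝ] R4))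
  set D : R4 →L[ℝ] R4 := (swapCoord : R4 →L[ℝ] R4) - projN ∘L (swapCoord : R4 →L[ℝ] R4)
  have hJ0 : ∀ z, J z 0 = 0 := fun z => by simp [J, projN_apply]
  have hJ1 : ∀ z, J z 1 = 0 := fun z => by simp [J, projN_apply]
  have hD0 : ∀ z, D z 0 = z 2 := fun z => by simp [D, projN_apply, swapCoord_apply]
  have hD1 : ∀ z, D z 1 = z 3 := fun z => by simp [D, projN_apply, swapCoord_apply]
  have hD2 : ∀ z, D z 2 = 0 := fun z => by simp [D, projN_apply, swapCoord_apply]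
  have hD3 : ∀ z, D z 3 = 0 := fun z => by simp [D, projN_apply, swapCoord_apply]
  set w : R4 → PathSpace := fun z => inv (constPath (J z))
  have hw0 : w 0 = 0 := by simp [w, hinv0]
  have hwsm : ContDiffAt ℝ ω w 0 := by
    refine ContDiffAt.comp (0 : R4) (g := inv) (by simpa using hinv) ?_
    exact (constPath.contDiff.comp J.contDiff).contDiffAt
  set Y : R4 → R4 := fun z => (1 / 2 : ℝ) • evalPath midI (w z)
  have hYsm : ContDiffAt ℝ ω Y 0 :=
    (((evalPath midI).contDiff.contDiffAt.comp (0 : R4) hwsm)).const_smul _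
  have hY0 : Y 0 = 0 := by simp [Y, hw0]
  have hwd : HasFDerivAt w (constPath ∘L J) 0 := by
    have h1 : HasFDerivAt inv (ContinuousLinearMap.id ℝ PathSpace) ((constPath ∘L J) 0) := by
      simpa using hinvd
    have h2 := h1.comp (0 : R4) (constPath ∘L J).hasFDerivAt
    rwa [ContinuousLinearMap.id_comp] at h2
  have hYd := ((evalPath midI).hasFDerivAt.comp (0 : R4) hwd).const_smul (1 / 2 : ℝ)
  refine ⟨fun z => D z + Y z, D.contDiff.contDiffAt.add hYsm, by simp [hY0], ?_, ?_⟩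
  · refine (D.hasFDerivAt.add hYd).congr_fderiv ?_
    ext1 z
    ext i
    simp [D, J]
  obtain ⟨ρ, hρ, hB⟩ := exists_dissipative_origin hq hq2
  obtain ⟨C, hC, ε, hε, hpast⟩ := exists_past_bound hq hq2
  have hYc : Tendsto Y (𝓝 0) (𝓝 0) := by simpa [hY0] using hYsm.continuousAt.tendsto
  have hΘc : Tendsto (fun z => D z + Y z) (𝓝 0) (𝓝 0) := by
    simpa using (D.continuous.tendsto 0).add hYc
  have hwc : Tendsto w (𝓝 0) (𝓝 0) := by simpa [hw0] using hwsm.continuousAt.tendsto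
  have ev1 : ∀ᶠ z in 𝓝 (0 : R4), ‖w z‖ < min 1 (ρ / 2) := by
    have := hwc.norm
    rw [norm_zero] at this
    exact this.eventually_lt_const (by positivity)
  have ev2 : ∀ᶠ z in 𝓝 (0 : R4), orbitMap q (w z) = constPath (J z) := by
    have h1 : Tendsto (fun z => constPath (J z)) (𝓝 0) (𝓝 0) := by
      have h := (constPath.continuous.comp J.continuous).tendsto 0
      rw [Function.comp_apply, map_zero, map_zero] at h
      exact h
    exact h1.eventually hright
  have ev3 : ∀ᶠ z in 𝓝 (0 : R4), 0 < density (Y z) :=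
    ((continuous_density.tendsto 0).comp hYc).eventually_const_lt (by simp [density_origin])
  have ev4 : ∀ᶠ z in 𝓝 (0 : R4), (D z + Y z) 3 < min ε (ρ / C) :=
    (((coord 3).continuous.tendsto 0).comp hΘc).eventually_lt_const (lt_min hε (div_pos hρ hC))
  filter_upwards [ev1, ev2, ev3, ev4] with z h1 h2 h3 h4 hreg
  have hw1 : ‖w z‖ ≤ 1 := h1.le.trans (min_le_left _ _)
  have hwρ : 2 * ‖w z‖ < ρ := by linarith [h1.trans_le (min_le_right 1 (ρ / 2))]
  have hYreg : Y z ∈ region := by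
    refine ⟨h3, ?_⟩
    have := hreg.2
    simpa [hD2, hD3] using this
  have hYun : Y z ∈ unstable q 0 := midpoint_mem_unstable hq (hJ0 z) (hJ1 z) h2 hw1 hYreg
  constructor
  · intro hun
    -- Both Θ z and Y z were near F for all past times, the former by the global past bound. Their
    -- difference D z is a pure Σ vector in the cone, hence zero.
    have key := quadratic_nonpos_of_past (diagForm_comm _ _) hB (t₀ := 0)
      (fun t _ => hasDerivAt_flow hun.1 t) (fun t _ => hasDerivAt_flow hYun.1 t)
      (fun t ht => ?_) (fun t ht => ?_) hun.2 hYun.2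
    · rw [flow_zero hun.1, flow_zero hYun.1, add_sub_cancel_right] at key
      have key' : formF (D z) (D z) ≤ 0 := key
      rw [formF_apply, hD0, hD1, hD2, hD3] at key'
      constructor <;> nlinarith [sq_nonneg (z 2), sq_nonneg (z 3)]
    · rw [mem_ball_zero_iff]
      refine (hpast _ hun (h4.trans_le (min_le_left _ _)) t ht).trans_lt ?_
      have := (lt_div_iff₀ hC).1 (h4.trans_le (min_le_right _ _))
      linarith
    · rw [mem_ball_zero_iff]
      refine (norm_flow_midpoint_le hq (hJ0 z) (hJ1 z) h2 hw1 hYreg ht).trans_lt ?_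
      have h5 : Real.exp (q * t) ≤ 1 :=
        Real.exp_le_one_iff.2 (mul_nonpos_of_nonneg_of_nonpos hq.le ht)
      exact (mul_le_of_le_one_left (by positivity) h5).trans_lt hwρ
  · rintro ⟨hz2, hz3⟩
    have hDz : D z = 0 := by
      ext i
      fin_cases i
      · exact (hD0 z).trans hz2
      · exact (hD1 z).trans hz3
      · exact hD2 z
      · exact hD3 z
    rw [hDz, zero_add]
    exact hYun

theorem eventually_pos_of_hasDerivAt {φ : ℝ → ℝ} (h0 : φ 0 = 0) (h : HasDerivAt φ 1 0) :
    ∀ᶠ t in 𝓝[>] 0, 0 < φ t := by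
  have h1 := (hasDerivAt_iff_tendsto_slope.1 h).mono_left
    (nhdsWithin_mono 0 fun t (ht : 0 < t) => ht.ne')
  filter_upwards [h1.eventually_const_lt one_pos, self_mem_nhdsWithin] with t ht htpos
  rw [slope_def_field, h0, sub_zero, sub_zero] at ht
  exact (div_pos_iff_of_pos_right htpos).1 ht

/-- The chart maps the second axis to a curve leaving F in the N₋ direction, so it enters the region
for small positive parameters. -/
theorem unstable_origin_nonempty (hq : 0 < q) (hq2 : q < 2) : (unstable q 0).Nonempty := by
  obtain ⟨Θ, -, h0, hd, hev⟩ := exists_chart_origin hq hq2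
  set e : R4 := EuclideanSpace.single 1 1
  have hline : HasDerivAt (fun t : ℝ => t • e) e 0 := by
    simpa using (hasDerivAt_id (0 : ℝ)).smul_const e
  have hg : HasDerivAt (fun t : ℝ => Θ (t • e)) (swapCoord e) 0 :=
    HasFDerivAt.comp_hasDerivAt (0 : ℝ) (f := fun t : ℝ => t • e) (l := Θ)
      (by rw [zero_smul]; exact hd) hline
  have e2 : swapCoord e 2 = 0 := by rw [swapCoord_apply]; simp [e]
  have e3 : swapCoord e 3 = 1 := by rw [swapCoord_apply]; simp [e]
  have h1 := eventually_pos_of_hasDerivAt (by simp [h0]) (((hasDerivAt_coord hg 3).fun_sub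
    (hasDerivAt_coord hg 2)).congr_deriv (by rw [e2, e3, sub_zero]))
  have h2 := eventually_pos_of_hasDerivAt (by simp [h0]) (((hasDerivAt_coord hg 3).fun_add
    (hasDerivAt_coord hg 2)).congr_deriv (by rw [e2, e3, add_zero]))
  have h3 : ∀ᶠ t : ℝ in 𝓝[>] 0, 0 < density (Θ (t • e)) := by
    refine Eventually.filter_mono nhdsWithin_le_nhds ?_
    have := (continuous_density.continuousAt (x := Θ ((0 : ℝ) • e))).comp
      (f := fun t : ℝ => Θ (t • e)) hg.continuousAt
    exact this.eventually_const_lt (by simp [h0, density_origin])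
  have h4 := (hline.continuousAt.eventually (by simpa using hev)).filter_mono
    (nhdsWithin_le_nhds (s := Set.Ioi (0 : ℝ)))
  obtain ⟨t, ht1, ht2, ht3, ht4⟩ := (h1.and (h2.and (h3.and h4))).exists
  exact ⟨_, (ht4 ⟨ht3, abs_lt.2 ⟨by linarith, by linarith⟩⟩).2 (by simp [e])⟩

theorem injective_fderiv_flow (hx : x ∈ region) (t : ℝ) :
    Function.Injective (fderiv ℝ (fun y => flow q y t) x) := by
  have h1 := ((contDiffAt_flow (q := q) hx t).differentiableAt (by simp)).hasFDerivAt
  have h2 := ((contDiffAt_flow (q := q) (flow_mem (q := q) hx t) (-t)).differentiableAt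
    (by simp)).hasFDerivAt
  have h3 := HasFDerivAt.comp x (g := fun y => flow q y (-t)) h2 h1
  have h4 : ((fun y => flow q y (-t)) ∘ fun y => flow q y t) =ᶠ[𝓝 x] id := by
    filter_upwards [isOpen_region.mem_nhds hx] with y hy using flow_flow_neg hy t
  have h5 := (h3.congr_of_eventuallyEq h4.symm).unique (hasFDerivAt_id x)
  refine Function.LeftInverse.injective
    (g := fderiv ℝ (fun y => flow q y (-t)) (flow q x t)) fun v => ?_
  exact DFunLike.congr_fun h5 v

/-- The unstable set of `F` is an embedded surface. -/
theorem isEmbeddedSubmanifold_unstable_origin (hq : 0 < q) (hq2 : q < 2) :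
    IsEmbeddedSubmanifold 2 (unstable q 0) := by
  refine ⟨by norm_num, fun x hx => ?_⟩
  obtain ⟨Θ, hsm, h0, hd, hev⟩ := exists_chart_origin hq hq2
  have hstrict : HasStrictFDerivAt Θ (swapCoord : R4 →L[ℝ] R4) 0 :=
    hsm.hasStrictFDerivAt' hd (by simp)
  have hunit : ∀ᶠ z in 𝓝 (0 : R4), Function.Injective (fderiv ℝ Θ z) := by
    have hc : ContinuousAt (fderiv ℝ Θ) 0 :=
      (hsm.fderiv_right (m := 0) (by simp)).continuousAt
    have h1 := hc.eventually (hd.fderiv.symm ▸ swapCoord.nhds :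
      Set.range ((↑) : (R4 ≃L[ℝ] R4) → R4 →L[ℝ] R4) ∈ 𝓝 (fderiv ℝ Θ 0))
    filter_upwards [h1] with z ⟨e, he⟩
    rw [← he]
    exact e.injective
  have hgood := (hsm.eventually (by simp)).and (hunit.and hev.eventually_nhds)
  have hmap : Θ '' {z | ContDiffAt ℝ ω Θ z ∧ Function.Injective (fderiv ℝ Θ z) ∧
      ∀ᶠ u in 𝓝 z, Θ u ∈ region → (Θ u ∈ unstable q 0 ↔ u 2 = 0 ∧ u 3 = 0)} ∈ 𝓝 (0 : R4) := by
    have := Filter.image_mem_map (m := Θ) hgood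
    rwa [hstrict.map_nhds_eq_of_equiv, h0] at this
  -- The orbit of x passes through the good part of the chart's image in the past; flowing by -T
  -- transports the slice from there to x.
  obtain ⟨T, z₀, ⟨h1, h2, h3⟩, h4⟩ := (hx.2.eventually hmap).exists
  have hy : Θ z₀ ∈ region := h4 ▸ flow_mem hx.1 T
  have hfl := contDiffAt_flow (q := q) hy (-T)
  have hΦd := ((hfl.differentiableAt (by simp)).hasFDerivAt).comp z₀
    (h1.differentiableAt (by simp)).hasFDerivAt
  have hS : ∀ᶠ z in 𝓝 z₀, ((fun y => flow q y (-T)) ∘ Θ) z ∈ unstable q 0 ↔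
      ∀ i : Fin 4, 2 ≤ (i : ℕ) → z i = 0 := by
    filter_upwards [h3, h1.continuousAt.eventually (isOpen_region.mem_nhds hy)] with z hz hzr
    have hzr' : Θ z ∈ region := hzr
    rw [Function.comp_apply, flow_mem_unstable_iff hzr', hz hzr']
    constructor
    · rintro ⟨hz2, hz3⟩ i hi
      fin_cases i
      · simp at hi
      · simp at hi
      · exact hz2
      · exact hz3
    · exact fun h => ⟨h 2 (by simp), h 3 (by simp)⟩
  obtain ⟨φ, hφ1, hφ2⟩ := exists_slice_chart (hfl.comp z₀ h1) hΦd
    ((injective_fderiv_flow hy (-T)).comp h2) hS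
  refine ⟨φ, ?_, hφ2⟩
  rwa [Function.comp_apply, h4, flow_flow_neg hx.1] at hφ1

/-! ### Reflection symmetry exchanging P₂ and P₃, and conclusion -/

/-- The reflection `(Σ₋, N₊) ↦ (-Σ₋, -N₊)`. -/
def reflect : R4 ≃L[ℝ] R4 :=
  (LinearIsometryEquiv.piLpCongrRight 2 fun i : Fin 4 =>
    if i = 1 ∨ i = 2 then LinearIsometryEquiv.neg ℝ else LinearIsometryEquiv.refl ℝ ℝ
    ).toContinuousLinearEquiv

theorem reflect_apply (x : R4) :
    reflect x 0 = x 0 ∧ reflect x 1 = -x 1 ∧ reflect x 2 = -x 2 ∧ reflect x 3 = x 3 := by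
  refine ⟨?_, ?_, ?_, ?_⟩ <;> simp [reflect]

theorem reducedField_reflect (q : ℝ) (x : R4) :
    reducedField q (reflect x) = reflect (reducedField q x) := by
  obtain ⟨e0, e1, e2, e3⟩ := reflect_apply x
  obtain ⟨f0, f1, f2, f3⟩ := reflect_apply (reducedField q x)
  have hd : dec q (reflect x) = dec q x := by simp [dec, density, e0, e1, e3]
  ext i
  fin_cases i
  · refine (reducedField_zero _ _).trans (Eq.trans ?_ f0.symm)
    rw [reducedField_zero, hd, e0, e3]
  · refine (reducedField_one _ _).trans (Eq.trans ?_ f1.symm)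
    rw [reducedField_one, hd, e1, e2, e3]; ring
  · refine (reducedField_two _ _).trans (Eq.trans ?_ f2.symm)
    rw [reducedField_two, hd, e0, e1, e2, e3]; ring
  · refine (reducedField_three _ _).trans (Eq.trans ?_ f3.symm)
    rw [reducedField_three, hd, e0, e1, e2, e3]; ring

theorem reflect_reflect (x : R4) : reflect (reflect x) = x := by
  obtain ⟨e0, e1, e2, e3⟩ := reflect_apply x
  obtain ⟨f0, f1, f2, f3⟩ := reflect_apply (reflect x)
  ext i
  fin_cases i
  · exact f0.trans e0
  · exact f1.trans (by rw [e1, neg_neg]; rfl)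
  · exact f2.trans (by rw [e2, neg_neg]; rfl)
  · exact f3.trans e3

theorem reflect_mem_region (hx : x ∈ region) : reflect x ∈ region := by
  obtain ⟨e0, e1, e2, e3⟩ := reflect_apply x
  refine ⟨?_, by rw [e2, e3, abs_neg]; exact hx.2⟩
  have := hx.1
  unfold density at this ⊢
  rwa [e0, e1, e3, neg_sq]

theorem reflect_mem_unstable (hx : x ∈ unstable q p) : reflect x ∈ unstable q (reflect p) := by
  refine ⟨reflect_mem_region hx.1, ?_⟩
  refine ((reflect.continuous.tendsto p).comp hx.2).congr fun t => ?_
  have h1 : reflect (flow q x 0) ∈ region := by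
    rw [flow_zero hx.1]; exact reflect_mem_region hx.1
  have := eq_flow (q := q) (c := fun t => reflect (flow q x t)) (t₀ := 0) (fun t => by
    rw [reducedField_reflect]
    exact (reflect : R4 →L[ℝ] R4).hasFDerivAt.comp_hasDerivAt t (hasDerivAt_flow hx.1 t)) h1 t
  simpa [flow_zero hx.1] using this

theorem unstable_reflect (q : ℝ) (p : R4) :
    unstable q (reflect p) = reflect ⁻¹' unstable q p := by
  ext x
  refine ⟨fun hx => ?_, fun hx => ?_⟩
  · simpa [reflect_reflect] using reflect_mem_unstable hx
  · simpa [reflect_reflect] using reflect_mem_unstable (Set.mem_preimage.1 hx)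

theorem IsEmbeddedSubmanifold.preimage {n k : ℕ} {S : Set (EuclideanSpace ℝ (Fin n))}
    (hS : IsEmbeddedSubmanifold k S) (e : EuclideanSpace ℝ (Fin n) ≃L[ℝ] EuclideanSpace ℝ (Fin n)) :
    IsEmbeddedSubmanifold k (e ⁻¹' S) := by
  refine ⟨hS.1, fun x hx => ?_⟩
  obtain ⟨φ, h1, h2, h3, h4⟩ := hS.2 (e x) hx
  refine ⟨e.toHomeomorph.transOpenPartialHomeomorph φ, h1, ?_, ?_, fun y hy => h4 _ hy⟩
  · exact h2.comp e.contDiff.contDiffOn fun y hy => hy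
  · exact e.symm.contDiff.comp_contDiffOn h3

theorem toR4_pointF : toR4 pointF = 0 := by
  ext i; fin_cases i <;> rfl

theorem lift_toR4_pointF : lift (toR4 pointF) = pointF := by
  ext i; fin_cases i <;> simp [lift, toR4, pointF, density]

theorem toR4_pointP2 (γ : ℝ) : toR4 (pointP2 γ) = reducedP2 (qStar γ) := by
  ext i; fin_cases i <;> rfl

theorem toR4_pointP3 (γ : ℝ) : toR4 (pointP3 γ) = reflect (reducedP2 (qStar γ)) := by
  obtain ⟨e0, e1, e2, e3⟩ := reflect_apply (reducedP2 (qStar γ))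
  ext i
  fin_cases i
  · exact e0.symm
  · refine Eq.trans ?_ e1.symm
    simp [toR4, pointP3, reducedP2]
  · exact e2.symm
  · exact e3.symm

theorem lift_eq_of_density {P : State} (h : density (toR4 P) = P 4) : lift (toR4 P) = P := by
  ext i
  fin_cases i
  · rfl
  · rfl
  · rfl
  · rfl
  · exact h

theorem density_reflect (x : R4) : density (reflect x) = density x := by
  obtain ⟨e0, e1, -, e3⟩ := reflect_apply x
  simp [density, e0, e1, e3]

end BianchiVI0

end

theorem mainTheorem4 (γ : ℝ) (hγ : 2 / 3 < γ) (hγ' : γ < 2) :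
    ((BianchiVI0.unstableP2 γ).Nonempty ∧
      BianchiVI0.IsEmbeddedSubmanifold 1 (BianchiVI0.unstableP2 γ)) ∧
    ((BianchiVI0.unstableP3 γ).Nonempty ∧
      BianchiVI0.IsEmbeddedSubmanifold 1 (BianchiVI0.unstableP3 γ)) ∧
    ((BianchiVI0.unstableF γ).Nonempty ∧
      BianchiVI0.IsEmbeddedSubmanifold 2 (BianchiVI0.unstableF γ)) := by
  open BianchiVI0 in
  have hq : 0 < qStar γ := by unfold qStar; linarith
  have hq2 : qStar γ < 2 := by unfold qStar; linarith
  have hdens := density_reducedP2 hq hq2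
  have hP2 : unstableP2 γ = unstable (qStar γ) (reducedP2 (qStar γ)) := by
    rw [unstableP2, toR4_image_unstableSet, toR4_pointP2]
    · simp only [pointP2, Matrix.cons_val]; linarith
    · exact lift_eq_of_density (by rw [toR4_pointP2, hdens]; rfl)
  have hP3 : unstableP3 γ = reflect ⁻¹' unstable (qStar γ) (reducedP2 (qStar γ)) := by
    rw [unstableP3, toR4_image_unstableSet, toR4_pointP3, unstable_reflect]
    · simp only [pointP3, Matrix.cons_val]; linarith
    · exact lift_eq_of_density (by rw [toR4_pointP3, density_reflect, hdens]; rfl)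
  have hF : unstableF γ = unstable (qStar γ) 0 := by
    rw [unstableF, toR4_image_unstableSet, toR4_pointF]
    · simp [pointF]
    · exact lift_toR4_pointF
  have hne := unstable_reducedP2_nonempty hq hq2
  have hsub := isEmbeddedSubmanifold_one_of_single_orbit hq hq2 (reducedP2_notMem_region _)
    (unstable_reducedP2_single_orbit hq hq2)
  rw [hP2, hP3, hF]
  exact ⟨⟨hne, hsub⟩, ⟨hne.preimage reflect.surjective, hsub.preimage reflect⟩,
    unstable_origin_nonempty hq hq2, isEmbeddedSubmanifold_unstable_origin hq hq2⟩
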